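/- Let $G$ be a finite group. A Tambara functor assigns to every finite $G$-set $X$ a nonempty set $\underline{R}(X)$ and to every $G$-map $f$ a restriction $r_f$ (contravariant), a transfer $t_f$ and a norm $n_f$ (both covariant), functorially, such that coproducts of $G$-sets are sent by restrictions to products of sets, $r_j t_i = t_p r_q$ and $r_j n_i = n_p r_q$ for every pullback square $jp = iq$, $n_j t_i = t_h n_g r_f$ for every exponential diagram (one isomorphic to $X \xleftarrow{e} Y\times_Z \prod_{i,j}X \xrightarrow{\pi_2} \prod_{i,j}X \xrightarrow{p} Z$ over $X \xrightarrow{i} Y \xrightarrow{j} Z$, where $\prod_{i,j}X$ is the $G$-set of pairs $(z,s)$ with $z\in Z$ and $s$ a section of $i$ over $j^{-1}(z)$, $p(z,s)=z$ and $e(y,(z,s))=s(y)$), and such that the addition $\underline{R}(X)^2\cong \underline{R}(X\sqcup X)\to \underline{R}(X)$ given by the transfer along the fold map makes each $\underline{R}(X)$ an abelian group. Forgetting the norms gives a Mackey functor; with the multiplication given by the norm along the fold map it is a commutative Green functor (a Mackey functor with values commutative rings, restrictions ring homomorphisms, and $t_f(a\cdot r_f b)=t_f(a)\cdot b$). A Tambara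 structure on a commutative Green functor is a family of norms making its underlying Mackey functor a Tambara functor and inducing the given product. Maps of Tambara functors commute with $r,t,n$; maps of commutative Green functors commute with $r,t$ and are levelwise ring homomorphisms. A pairing $\underline{M},\underline{N}\to\underline{P}$ of Mackey functors is a family of biadditive maps $\theta_X:\underline{M}(X)\times\underline{N}(X)\to\underline{P}(X)$ with $r_f\theta(a,b)=\theta(r_fa,r_fb)$, $t_f\theta(a,r_fb)=\theta(t_fa,b)$ and $t_f\theta(r_fa,b)=\theta(a,t_fb)$. For commutative Green functors, the box product $\underline{R}_1\otimes\underline{R}_2$ is a commutative Green functor $\underline{P}$ with maps $j_i:\underline{R}_i\to\underline{P}$ such that $(a,b)\mapsto j_1(a)j_2(b)$ is the universal pairing of the underlying Mackey functors; given maps $g_i:\underline{R}_0\to\underline{R}_i$, the relative box product $\underline{R}_1\otimes_{\underline{R}_0}\underline{R}_2$ is defined in the same way by universality among the balanced pairings, those with $\theta(a\,g_1(c),b)=\theta(a,g_2(c)\,b)$. Then: 1. The category of Tambara functors has all small colimits, and the forgetful functor to the category of commutative Green functors preserves them. 2. Let $\{\underline{X}_\alpha\}$ be a set-indexed family of Tambara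 functors. Its coproduct in the category of commutative Green functors exists and has a unique Tambara structure for which the canonical inclusions of the $\underline{X}_\alpha$ are maps of Tambara functors; this structure makes it the coproduct in the category of Tambara functors. 3. For two Tambara functors $\underline{R}_1,\underline{R}_2$ the box product $\underline{R}_1\otimes\underline{R}_2$ exists. A commutative Green functor with maps from $\underline{R}_1$ and $\underline{R}_2$ is their coproduct in commutative Green functors if and only if it is their box product. The box product has a unique Tambara structure for which $j_1,j_2$ are maps of Tambara functors, and this structure makes it the coproduct in the category of Tambara functors. 4. For maps of Tambara functors $g_1:\underline{R}_0\to\underline{R}_1$ and $g_2:\underline{R}_0\to\underline{R}_2$ the relative box product $\underline{R}_1\otimes_{\underline{R}_0}\underline{R}_2$ exists. A commutative Green functor with maps from $\underline{R}_1$ and $\underline{R}_2$ is the pushout of $g_1,g_2$ in commutative Green functors if and only if it is the relative box product. The relative box product has a unique Tambara structure for which $j_1,j_2$ are maps of Tambara functors, and this structure makes it the pushout in the category of Tambara functors. -/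

import Mathlib

open CategoryTheory CategoryTheory.Limits

universe u

/-! ### Finite `G`-sets -/

/-- A finite `G`-set. -/
structure FinGSet (G : Type u) [Group G] where
  carrier : Type u
  [action : MulAction G carrier]
  [finite : Finite carrier]

namespace FinGSet

variable {G : Type u} [Group G]

instance : CoeSort (FinGSet G) (Type u) := ⟨FinGSet.carrier⟩

attribute [instance] FinGSet.action FinGSet.finite

/-- The category of finite `G`-sets and `G`-equivariant maps. -/
instance : Category (FinGSet G) where
  Hom X Y := X →[G] Y
  id X := MulActionHom.id G
  comp f g := MulActionHom.comp g f

instance : ConcreteCategory (FinGSet G) (fun X Y => X →[G] Y) where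
  hom f := f
  ofHom f := f

/-- A `G`-equivariant function as a morphism of finite `G`-sets. -/
def mkHom {X Y : FinGSet G} (f : X → Y) (hf : ∀ (g : G) (x : X), f (g • x) = g • f x) : X ⟶ Y :=
  (⟨f, hf⟩ : X →[G] Y)

@[simp] theorem mkHom_apply {X Y : FinGSet G} (f : X → Y)
    (hf : ∀ (g : G) (x : X), f (g • x) = g • f x) (x : X) : mkHom f hf x = f x := rfl

@[ext] theorem hom_ext {X Y : FinGSet G} {f g : X ⟶ Y} (h : ∀ x : X, f x = g x) : f = g :=
  ConcreteCategory.hom_ext _ _ h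

@[simp] theorem hom_smul {X Y : FinGSet G} (f : X ⟶ Y) (g : G) (x : X) : f (g • x) = g • f x :=
  (ConcreteCategory.hom f).map_smul' g x

/-- A bijective `G`-map is an isomorphism of finite `G`-sets. -/
noncomputable def isoOfBijective {X Y : FinGSet G} (f : X ⟶ Y) (hf : Function.Bijective f) :
    X ≅ Y where
  hom := f
  inv := mkHom (Equiv.ofBijective f hf).symm (fun g y => by
    apply hf.1
    rw [hom_smul]
    exact ((Equiv.ofBijective f hf).apply_symm_apply _).trans
      (congrArg (g • ·) ((Equiv.ofBijective f hf).apply_symm_apply y).symm))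
  hom_inv_id := by
    ext x
    exact (Equiv.ofBijective f hf).symm_apply_apply x
  inv_hom_id := by
    ext x
    exact (Equiv.ofBijective f hf).apply_symm_apply x

theorem isPullback_of_existsUnique {P X Y Z : FinGSet G} {p : P ⟶ X} {q : P ⟶ Y} {j : X ⟶ Z}
    {i : Y ⟶ Z} (w : ∀ a, j (p a) = i (q a))
    (h : ∀ x y, j x = i y → ∃! a, p a = x ∧ q a = y) : IsPullback p q j i := by
  have w' : p ≫ j = q ≫ i := by ext a; simpa using w a
  refine ⟨⟨w'⟩, ⟨PullbackCone.isLimitAux' _ fun s => ?_⟩⟩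
  have hs : ∀ a : s.pt, j (s.fst a) = i (s.snd a) := fun a => by
    have := congrArg (fun k : s.pt ⟶ Z => k a) s.condition
    simpa using this
  choose l hl hu using fun a : s.pt => h _ _ (hs a)
  refine ⟨mkHom l fun g a => ?_, ?_, ?_, ?_⟩
  · refine (hu (g • a) (g • l a) ⟨?_, ?_⟩).symm
    · simp [(hl a).1]
    · simp [(hl a).2]
  · ext a; exact (hl a).1
  · ext a; exact (hl a).2
  · intro m h1 h2
    ext a
    refine hu a (m a) ⟨?_, ?_⟩
    · exact congrArg (fun k : s.pt ⟶ X => k a) h1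
    · exact congrArg (fun k : s.pt ⟶ Y => k a) h2

/-- The disjoint union of two finite `G`-sets. -/
def sum (X Y : FinGSet G) : FinGSet G := ⟨X ⊕ Y⟩

def inl (X Y : FinGSet G) : X ⟶ X.sum Y := mkHom (Y := X.sum Y) Sum.inl fun _ _ => rfl

def inr (X Y : FinGSet G) : Y ⟶ X.sum Y := mkHom (Y := X.sum Y) Sum.inr fun _ _ => rfl

def sumDesc {X Y Z : FinGSet G} (f : X ⟶ Z) (g : Y ⟶ Z) : X.sum Y ⟶ Z :=
  mkHom (X := X.sum Y) (Sum.elim f g) (by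
    rintro a (x | y)
    · exact hom_smul f a x
    · exact hom_smul g a y)

def sumMap {X Y X' Y' : FinGSet G} (f : X ⟶ X') (g : Y ⟶ Y') : X.sum Y ⟶ X'.sum Y' :=
  sumDesc (f ≫ inl X' Y') (g ≫ inr X' Y')

/-- The fold map `X ⊔ X ⟶ X`. -/
def fold (X : FinGSet G) : X.sum X ⟶ X := sumDesc (𝟙 X) (𝟙 X)

@[simp] theorem inl_desc {X Y Z : FinGSet G} (f : X ⟶ Z) (g : Y ⟶ Z) :
    inl X Y ≫ sumDesc f g = f := rfl

@[simp] theorem inr_desc {X Y Z : FinGSet G} (f : X ⟶ Z) (g : Y ⟶ Z) :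
    inr X Y ≫ sumDesc f g = g := rfl

theorem sum_hom_ext {X Y Z : FinGSet G} {f g : X.sum Y ⟶ Z} (h1 : inl X Y ≫ f = inl X Y ≫ g)
    (h2 : inr X Y ≫ f = inr X Y ≫ g) : f = g := by
  ext a
  rcases a with x | y
  · exact congrArg (fun k : X ⟶ Z => k x) h1
  · exact congrArg (fun k : Y ⟶ Z => k y) h2

/-- The disjoint union is a coproduct. -/
def sumIsColimit (X Y : FinGSet G) : IsColimit (BinaryCofan.mk (inl X Y) (inr X Y)) :=
  BinaryCofan.isColimitMk (fun s => sumDesc s.inl s.inr) (fun _ => rfl) (fun _ => rfl)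
    (fun _ _ h1 h2 => sum_hom_ext h1 h2)

/-- The empty `G`-set. -/
def empty (G : Type u) [Group G] : FinGSet G :=
  letI : MulAction G PEmpty.{u + 1} :=
    { smul := fun _ x => x, one_smul := fun _ => rfl, mul_smul := fun _ _ _ => rfl }
  ⟨PEmpty.{u + 1}⟩

instance : IsEmpty (empty G) := inferInstanceAs (IsEmpty PEmpty)

/-- The unique map out of the empty `G`-set. -/
def fromEmpty (X : FinGSet G) : empty G ⟶ X := mkHom isEmptyElim fun _ x => isEmptyElim x

/-! ### Exponential diagrams -/

/-- The set of pairs `(z, s)` with `z ∈ Z` and `s` a section of `i`, defined on the fibre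
`j⁻¹(z)`. -/
@[ext] structure FibreSection {X Y Z : FinGSet G} (i : X ⟶ Y) (j : Y ⟶ Z) : Type u where
  pt : Z
  sec : {y : Y // j y = pt} → X
  sec_spec : ∀ y, i (sec y) = y.1

namespace FibreSection

variable {X Y Z : FinGSet G} {i : X ⟶ Y} {j : Y ⟶ Z}

theorem ext' {s t : FibreSection i j} (h : s.pt = t.pt)
    (h' : ∀ (y : Y) (hs : j y = s.pt) (ht : j y = t.pt), s.sec ⟨y, hs⟩ = t.sec ⟨y, ht⟩) :
    s = t := by
  obtain ⟨z, s, hs⟩ := s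
  obtain ⟨z', t, ht⟩ := t
  obtain rfl : z = z' := h
  congr
  funext ⟨y, hy⟩
  exact h' y hy hy

theorem sec_congr {s t : FibreSection i j} (h : s = t) {y y' : Y} (hy : y = y')
    (hs : j y = s.pt) (ht : j y' = t.pt) : s.sec ⟨y, hs⟩ = t.sec ⟨y', ht⟩ := by
  subst h; subst hy; rfl

theorem fibre_aux {a : G} {z : Z} {y : Y} (h : j y = a • z) : j (a⁻¹ • y) = z := by
  rw [hom_smul, h, inv_smul_smul]

/-- The conjugation action: `a • (z, s) = (a • z, a • s(a⁻¹ • -))`. -/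
instance : MulAction G (FibreSection i j) where
  smul a s :=
    { pt := a • s.pt
      sec := fun y => a • s.sec ⟨a⁻¹ • y.1, fibre_aux y.2⟩
      sec_spec := fun y => by rw [hom_smul, s.sec_spec, smul_inv_smul] }
  one_smul s := by
    refine ext' (one_smul G s.pt) fun y hs ht => ?_
    change (1 : G) • s.sec ⟨(1 : G)⁻¹ • y, _⟩ = _
    rw [one_smul]
    exact sec_congr rfl (by rw [inv_one, one_smul]) _ _
  mul_smul a b s := by
    refine ext' (mul_smul a b s.pt) fun y hs ht => ?_
    change (a * b) • s.sec ⟨(a * b)⁻¹ • y, _⟩ = a • b • s.sec ⟨b⁻¹ • a⁻¹ • y, _⟩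
    rw [mul_smul]
    congr 2
    exact sec_congr rfl (by rw [mul_inv_rev, mul_smul]) _ _

theorem smul_pt (a : G) (s : FibreSection i j) : (a • s).pt = a • s.pt := rfl

theorem smul_sec (a : G) (s : FibreSection i j) (y : Y) (h : j y = (a • s).pt) :
    (a • s).sec ⟨y, h⟩ = a • s.sec ⟨a⁻¹ • y, fibre_aux h⟩ := rfl

instance : Finite (FibreSection i j) :=
  Finite.of_injective
    (fun s => (⟨s.pt, s.sec⟩ : Σ z : Z, ({y : Y // j y = z} → X))) (by
      rintro ⟨z, s, hs⟩ ⟨z', t, ht⟩ h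
      obtain ⟨rfl, h⟩ := Sigma.mk.inj_iff.mp h
      obtain rfl := eq_of_heq h
      rfl)

end FibreSection

section Exponential

variable {X Y Z : FinGSet G} (i : X ⟶ Y) (j : Y ⟶ Z)

/-- The `G`-set `∏_{i,j} X` of sections of `i` defined on fibres of `j`. -/
def depProd : FinGSet G := ⟨FibreSection i j⟩

/-- The projection `p : ∏_{i,j} X ⟶ Z`, `(z, s) ↦ z`. -/
def depProdProj : depProd i j ⟶ Z :=
  mkHom (X := depProd i j) FibreSection.pt FibreSection.smul_pt

/-- The fibre product `Y ×_Z ∏_{i,j} X`. -/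
def depProdPullback : FinGSet G :=
  letI : MulAction G {a : Y × FibreSection i j // j a.1 = a.2.pt} :=
    { smul := fun g a => ⟨g • a.1, by
        change j (g • a.1.1) = g • a.1.2.pt
        rw [hom_smul, a.2]⟩
      one_smul := fun a => Subtype.ext (one_smul G a.1)
      mul_smul := fun g h a => Subtype.ext (mul_smul g h a.1) }
  ⟨{a : Y × FibreSection i j // j a.1 = a.2.pt}⟩

/-- The projection `π₂ : Y ×_Z ∏_{i,j} X ⟶ ∏_{i,j} X`. -/
def depProdSnd : depProdPullback i j ⟶ depProd i j :=
  mkHom (X := depProdPullback i j) (Y := depProd i j) (fun a => a.1.2) fun _ _ => rfl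

/-- The evaluation `e : Y ×_Z ∏_{i,j} X ⟶ X`, `(y, (z, s)) ↦ s(y)`. -/
def depProdEval : depProdPullback i j ⟶ X :=
  mkHom (X := depProdPullback i j) (fun a => a.1.2.sec ⟨a.1.1, a.2⟩) fun g a => by
    change g • a.1.2.sec ⟨g⁻¹ • g • a.1.1, _⟩ = g • a.1.2.sec ⟨a.1.1, _⟩
    congr 1
    exact FibreSection.sec_congr rfl (inv_smul_smul _ _) _ _

/-- The diagram with edges `f : A ⟶ X`, `g : A ⟶ B`, `h : B ⟶ Z`, `i : X ⟶ Y`, `j : Y ⟶ Z` is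
an exponential diagram, i.e. isomorphic to the diagram with edges `e`, `π₂`, `p`, `i`, `j`.
(It suffices to allow isomorphisms which are the identity on `X`, `Y` and `Z`, since
`∏_{i,j} X` is functorial in isomorphisms of the pair `(i, j)`.) -/
def IsExponential {A B : FinGSet G} (f : A ⟶ X) (g : A ⟶ B) (h : B ⟶ Z) : Prop :=
  ∃ (α : A ≅ depProdPullback i j) (β : B ≅ depProd i j),
    f = α.hom ≫ depProdEval i j ∧ g ≫ β.hom = α.hom ≫ depProdSnd i j ∧ h = β.hom ≫ depProdProj i j

end Exponential

end FinGSet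

open FinGSet

/-! ### Semi-Mackey and Mackey functors -/

/-- A semi-Mackey functor: a contravariant functor (restrictions `res`) and a covariant functor
(transfers `tr`) from finite `G`-sets to nonempty sets with the same values on objects, taking
coproducts to products and satisfying base change for pullback squares. -/
structure SemiMackeyFunctor (G : Type u) [Group G] where
  obj : FinGSet G → Type u
  nonempty : ∀ X, Nonempty (obj X)
  res : ∀ {X Y : FinGSet G}, (X ⟶ Y) → obj Y → obj X
  tr : ∀ {X Y : FinGSet G}, (X ⟶ Y) → obj X → obj Y
  res_id : ∀ (X : FinGSet G) (a : obj X), res (𝟙 X) a = a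
  res_comp : ∀ {X Y Z : FinGSet G} (f : X ⟶ Y) (g : Y ⟶ Z) (a : obj Z),
    res (f ≫ g) a = res f (res g a)
  tr_id : ∀ (X : FinGSet G) (a : obj X), tr (𝟙 X) a = a
  tr_comp : ∀ {X Y Z : FinGSet G} (f : X ⟶ Y) (g : Y ⟶ Z) (a : obj X),
    tr (f ≫ g) a = tr g (tr f a)
  bijective_res : ∀ {X Y Z : FinGSet G} (i : X ⟶ Z) (j : Y ⟶ Z),
    IsColimit (BinaryCofan.mk i j) →
      Function.Bijective (fun a : obj Z => ((res i a, res j a) : obj X × obj Y))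
  res_tr : ∀ {P X Y Z : FinGSet G} (p : P ⟶ X) (q : P ⟶ Y) (j : X ⟶ Z) (i : Y ⟶ Z),
    IsPullback p q j i → ∀ a : obj Y, res j (tr i a) = tr p (res q a)

namespace SemiMackeyFunctor

variable {G : Type u} [Group G] (M : SemiMackeyFunctor G)

/-- The inverse of the bijection `M(X ⊔ Y) → M(X) × M(Y)`. -/
noncomputable def pair {X Y : FinGSet G} (a : M.obj X) (b : M.obj Y) : M.obj (X.sum Y) :=
  (Equiv.ofBijective _ (M.bijective_res _ _ (sumIsColimit X Y))).symm (a, b)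

/-- The operation `M(X) × M(X) ≅ M(X ⊔ X) → M(X)` given by the transfer along the fold map. -/
noncomputable def add {X : FinGSet G} (a b : M.obj X) : M.obj X := M.tr (fold X) (M.pair a b)

/-- The neutral element, coming from the transfer `M(∅) → M(X)`. -/
noncomputable def zero (X : FinGSet G) : M.obj X :=
  M.tr (fromEmpty X) (Classical.choice (M.nonempty (empty G)))

variable {M}

theorem pair_spec {X Y : FinGSet G} (a : M.obj X) (b : M.obj Y) :
    M.res (inl X Y) (M.pair a b) = a ∧ M.res (inr X Y) (M.pair a b) = b :=
  Prod.mk_inj.mp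
    ((Equiv.ofBijective _ (M.bijective_res _ _ (sumIsColimit X Y))).apply_symm_apply (a, b))

@[simp] theorem res_inl_pair {X Y : FinGSet G} (a : M.obj X) (b : M.obj Y) :
    M.res (inl X Y) (M.pair a b) = a := (pair_spec a b).1

@[simp] theorem res_inr_pair {X Y : FinGSet G} (a : M.obj X) (b : M.obj Y) :
    M.res (inr X Y) (M.pair a b) = b := (pair_spec a b).2

theorem sum_ext {X Y : FinGSet G} {c d : M.obj (X.sum Y)}
    (h1 : M.res (inl X Y) c = M.res (inl X Y) d) (h2 : M.res (inr X Y) c = M.res (inr X Y) d) :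
    c = d :=
  (M.bijective_res _ _ (sumIsColimit X Y)).1 (Prod.ext h1 h2)

theorem eq_pair {X Y : FinGSet G} {c : M.obj (X.sum Y)} {a : M.obj X} {b : M.obj Y}
    (h1 : M.res (inl X Y) c = a) (h2 : M.res (inr X Y) c = b) : c = M.pair a b :=
  sum_ext (by simpa using h1) (by simpa using h2)

theorem subsingleton_empty (a b : M.obj (empty G)) : a = b := by
  have hc : IsColimit (BinaryCofan.mk (𝟙 (empty G)) (𝟙 (empty G))) :=
    BinaryCofan.isColimitMk (fun s => s.inl) (fun s => Category.id_comp _)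
      (fun s => by ext x; exact isEmptyElim x) (fun s m _ _ => by ext x; exact isEmptyElim x)
  obtain ⟨c, hc⟩ := (M.bijective_res _ _ hc).2 (a, b)
  simp only [res_id, Prod.mk.injEq] at hc
  exact hc.1.symm.trans hc.2

theorem tr_iso {X Y : FinGSet G} (e : X ≅ Y) (a : M.obj X) : M.tr e.hom a = M.res e.inv a := by
  have hp : IsPullback (𝟙 Y) e.inv (𝟙 Y) e.hom := IsPullback.of_vert_isIso ⟨by simp⟩
  have := M.res_tr _ _ _ _ hp a
  rwa [res_id, tr_id] at this

theorem tr_sumMap_pair {X Y X' Y' : FinGSet G} (f : X ⟶ X') (g : Y ⟶ Y') (a : M.obj X)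
    (b : M.obj Y) : M.tr (sumMap f g) (M.pair a b) = M.pair (M.tr f a) (M.tr g b) := by
  apply eq_pair
  · rw [M.res_tr f (inl X Y) (inl X' Y') (sumMap f g), res_inl_pair]
    refine isPullback_of_existsUnique (fun _ => rfl) ?_
    rintro x (y | y) h
    · exact ⟨y, ⟨(Sum.inl_injective h).symm, rfl⟩, fun z hz => Sum.inl_injective hz.2⟩
    · exact absurd h Sum.inl_ne_inr
  · rw [M.res_tr g (inr X Y) (inr X' Y') (sumMap f g), res_inr_pair]
    refine isPullback_of_existsUnique (fun _ => rfl) ?_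
    rintro x (y | y) h
    · exact absurd h Sum.inr_ne_inl
    · exact ⟨y, ⟨(Sum.inr_injective h).symm, rfl⟩, fun z hz => Sum.inr_injective hz.2⟩

theorem tr_inr {X Y : FinGSet G} (b : M.obj Y) : M.tr (inr X Y) b = M.pair (M.zero X) b := by
  apply eq_pair
  · rw [M.res_tr (fromEmpty X) (fromEmpty Y) (inl X Y) (inr X Y)]
    · exact congrArg _ (subsingleton_empty _ _)
    · exact isPullback_of_existsUnique (fun x => isEmptyElim x)
        fun x y h => absurd h Sum.inl_ne_inr
  · rw [M.res_tr (𝟙 Y) (𝟙 Y) (inr X Y) (inr X Y), res_id, tr_id]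
    refine isPullback_of_existsUnique (fun _ => rfl) fun x y h => ?_
    exact ⟨x, ⟨rfl, Sum.inr_injective h⟩, fun z hz => hz.1⟩

theorem zero_add {X : FinGSet G} (a : M.obj X) : M.add (M.zero X) a = a := by
  rw [add, ← tr_inr, ← tr_comp, fold, inr_desc, tr_id]

/-- The symmetry of the disjoint union. -/
def swapIso (X Y : FinGSet G) : X.sum Y ≅ Y.sum X where
  hom := sumDesc (inr Y X) (inl Y X)
  inv := sumDesc (inr X Y) (inl X Y)
  hom_inv_id := sum_hom_ext rfl rfl
  inv_hom_id := sum_hom_ext rfl rfl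

/-- The associativity of the disjoint union. -/
def assocIso (X Y Z : FinGSet G) : (X.sum Y).sum Z ≅ X.sum (Y.sum Z) where
  hom := sumDesc (sumDesc (inl _ _) (inl _ _ ≫ inr _ _)) (inr _ _ ≫ inr _ _)
  inv := sumDesc (inl _ _ ≫ inl _ _) (sumDesc (inr _ _ ≫ inl _ _) (inr _ _))
  hom_inv_id := sum_hom_ext (sum_hom_ext rfl rfl) rfl
  inv_hom_id := sum_hom_ext rfl (sum_hom_ext rfl rfl)

theorem add_comm {X : FinGSet G} (a b : M.obj X) : M.add a b = M.add b a := by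
  have h : M.tr (swapIso X X).hom (M.pair a b) = M.pair b a := by
    rw [tr_iso]
    refine eq_pair ?_ ?_
    · rw [← res_comp]; exact res_inr_pair a b
    · rw [← res_comp]; exact res_inl_pair a b
  rw [add, add, ← h, ← tr_comp]
  congr 1
  exact sum_hom_ext rfl rfl

theorem add_assoc {X : FinGSet G} (a b c : M.obj X) :
    M.add (M.add a b) c = M.add a (M.add b c) := by
  have h : M.tr (assocIso X X X).hom (M.pair (M.pair a b) c) = M.pair a (M.pair b c) := by
    rw [tr_iso]
    refine eq_pair ?_ (eq_pair ?_ ?_)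
    · rw [← res_comp]
      change M.res (inl _ _ ≫ inl _ _) _ = _
      rw [res_comp, res_inl_pair, res_inl_pair]
    · rw [← res_comp, ← res_comp]
      change M.res (inr _ _ ≫ inl _ _) _ = _
      rw [res_comp, res_inl_pair, res_inr_pair]
    · rw [← res_comp, ← res_comp]
      exact res_inr_pair _ c
  have e1 : M.pair (M.add a b) c = M.tr (sumMap (fold X) (𝟙 X)) (M.pair (M.pair a b) c) := by
    rw [tr_sumMap_pair, tr_id, add]
  have e2 : M.pair a (M.add b c) = M.tr (sumMap (𝟙 X) (fold X)) (M.pair a (M.pair b c)) := by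
    rw [tr_sumMap_pair, tr_id, add]
  rw [add, e1, add, e2, ← h, ← tr_comp, ← tr_comp, ← tr_comp]
  congr 1
  exact sum_hom_ext (sum_hom_ext rfl rfl) rfl

theorem res_add {X Y : FinGSet G} (f : X ⟶ Y) (a b : M.obj Y) :
    M.res f (M.add a b) = M.add (M.res f a) (M.res f b) := by
  have hp : IsPullback (fold X) (sumMap f f) f (fold Y) := by
    refine isPullback_of_existsUnique (by rintro (x | x) <;> rfl) ?_
    rintro x (y | y) h
    · refine ⟨Sum.inl x, ⟨rfl, congrArg Sum.inl h⟩, ?_⟩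
      rintro (z | z) ⟨h1, h2⟩
      · exact congrArg Sum.inl h1
      · exact absurd h2 Sum.inr_ne_inl
    · refine ⟨Sum.inr x, ⟨rfl, congrArg Sum.inr h⟩, ?_⟩
      rintro (z | z) ⟨h1, h2⟩
      · exact absurd h2 Sum.inl_ne_inr
      · exact congrArg Sum.inr h1
  rw [add, M.res_tr _ _ _ _ hp, add]
  congr 1
  refine eq_pair ?_ ?_
  · rw [← res_comp]
    change M.res (f ≫ inl _ _) _ = _
    rw [res_comp, res_inl_pair]
  · rw [← res_comp]
    change M.res (f ≫ inr _ _) _ = _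
    rw [res_comp, res_inr_pair]

theorem res_zero {X Y : FinGSet G} (f : X ⟶ Y) : M.res f (M.zero Y) = M.zero X := by
  rw [zero, M.res_tr (fromEmpty X) (𝟙 _) f (fromEmpty Y)]
  · exact congrArg _ (subsingleton_empty _ _)
  · exact isPullback_of_existsUnique (fun x => isEmptyElim x) fun x y h => isEmptyElim y

theorem tr_add {X Y : FinGSet G} (f : X ⟶ Y) (a b : M.obj X) :
    M.tr f (M.add a b) = M.add (M.tr f a) (M.tr f b) := by
  rw [add, add, ← tr_sumMap_pair, ← tr_comp, ← tr_comp]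
  congr 1
  exact sum_hom_ext rfl rfl

theorem tr_zero {X Y : FinGSet G} (f : X ⟶ Y) : M.tr f (M.zero X) = M.zero Y := by
  have h : fromEmpty X ≫ f = fromEmpty Y := by ext x; exact isEmptyElim x
  rw [zero, ← tr_comp, h, zero]

/-- A map of semi-Mackey functors. -/
@[ext] structure Hom (M N : SemiMackeyFunctor G) where
  app : ∀ X : FinGSet G, M.obj X → N.obj X
  app_res : ∀ {X Y : FinGSet G} (f : X ⟶ Y) (a : M.obj Y), app X (M.res f a) = N.res f (app Y a)
  app_tr : ∀ {X Y : FinGSet G} (f : X ⟶ Y) (a : M.obj X), app Y (M.tr f a) = N.tr f (app X a)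

theorem Hom.app_pair {M N : SemiMackeyFunctor G} (φ : Hom M N) {X Y : FinGSet G} (a : M.obj X)
    (b : M.obj Y) : φ.app _ (M.pair a b) = N.pair (φ.app _ a) (φ.app _ b) := by
  apply eq_pair <;> simp [← φ.app_res]

theorem Hom.app_add {M N : SemiMackeyFunctor G} (φ : Hom M N) {X : FinGSet G} (a b : M.obj X) :
    φ.app _ (M.add a b) = N.add (φ.app _ a) (φ.app _ b) := by
  rw [add, add, φ.app_tr, φ.app_pair]

theorem Hom.app_zero {M N : SemiMackeyFunctor G} (φ : Hom M N) (X : FinGSet G) :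
    φ.app _ (M.zero X) = N.zero X := by
  rw [zero, zero, φ.app_tr]
  exact congrArg _ (subsingleton_empty _ _)

end SemiMackeyFunctor

/-- A Mackey functor: a semi-Mackey functor whose values are abelian groups. -/
structure MackeyFunctor (G : Type u) [Group G] extends SemiMackeyFunctor G where
  exists_neg : ∀ (X : FinGSet G) (a : obj X), ∃ b : obj X,
    toSemiMackeyFunctor.add a b = toSemiMackeyFunctor.zero X

/-! ### Commutative Green functors -/

/-- A commutative Green functor: a Mackey functor whose values are commutative rings, such that
the restrictions are ring homomorphisms and the transfers are module maps (Frobenius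
reciprocity). -/
structure CommGreenFunctor (G : Type u) [Group G] extends MackeyFunctor G where
  mul : ∀ {X : FinGSet G}, obj X → obj X → obj X
  one : ∀ X : FinGSet G, obj X
  mul_assoc : ∀ {X : FinGSet G} (a b c : obj X), mul (mul a b) c = mul a (mul b c)
  mul_comm : ∀ {X : FinGSet G} (a b : obj X), mul a b = mul b a
  one_mul : ∀ {X : FinGSet G} (a : obj X), mul (one X) a = a
  mul_add : ∀ {X : FinGSet G} (a b c : obj X),
    mul a (toSemiMackeyFunctor.add b c) = toSemiMackeyFunctor.add (mul a b) (mul a c)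
  res_mul : ∀ {X Y : FinGSet G} (f : X ⟶ Y) (a b : obj Y), res f (mul a b) = mul (res f a) (res f b)
  res_one : ∀ {X Y : FinGSet G} (f : X ⟶ Y), res f (one Y) = one X
  frobenius : ∀ {X Y : FinGSet G} (f : X ⟶ Y) (a : obj X) (b : obj Y),
    tr f (mul a (res f b)) = mul (tr f a) b

namespace CommGreenFunctor

variable {G : Type u} [Group G]

/-- A map of commutative Green functors: a map of Mackey functors which is levelwise a ring
homomorphism. -/
@[ext] structure Hom (R S : CommGreenFunctor G) extends
    SemiMackeyFunctor.Hom R.toSemiMackeyFunctor S.toSemiMackeyFunctor where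
  app_mul : ∀ {X : FinGSet G} (a b : R.obj X), app X (R.mul a b) = S.mul (app X a) (app X b)
  app_one : ∀ X : FinGSet G, app X (R.one X) = S.one X

/-- The category of commutative Green functors. -/
instance : Category (CommGreenFunctor G) where
  Hom := Hom
  id R :=
    { app := fun _ a => a
      app_res := fun _ _ => rfl
      app_tr := fun _ _ => rfl
      app_mul := fun _ _ => rfl
      app_one := fun _ => rfl }
  comp φ ψ :=
    { app := fun X a => ψ.app X (φ.app X a)
      app_res := fun f a => by rw [φ.app_res, ψ.app_res]
      app_tr := fun f a => by rw [φ.app_tr, ψ.app_tr]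
      app_mul := fun a b => by rw [φ.app_mul, ψ.app_mul]
      app_one := fun X => by rw [φ.app_one, ψ.app_one] }

end CommGreenFunctor

/-! ### Semi-Tambara and Tambara functors -/

/-- A semi-Tambara functor: restrictions `res`, transfers `tr` and norms `nm` on finite `G`-sets,
with values in nonempty sets. The conditions on `nm` say that it is a covariant functor, that it
satisfies base change, and that the distributive law holds. -/
structure SemiTambaraFunctor (G : Type u) [Group G] extends SemiMackeyFunctor G where
  nm : ∀ {X Y : FinGSet G}, (X ⟶ Y) → obj X → obj Y
  nm_id : ∀ (X : FinGSet G) (a : obj X), nm (𝟙 X) a = a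
  nm_comp : ∀ {X Y Z : FinGSet G} (f : X ⟶ Y) (g : Y ⟶ Z) (a : obj X),
    nm (f ≫ g) a = nm g (nm f a)
  res_nm : ∀ {P X Y Z : FinGSet G} (p : P ⟶ X) (q : P ⟶ Y) (j : X ⟶ Z) (i : Y ⟶ Z),
    IsPullback p q j i → ∀ a : obj Y, res j (nm i a) = nm p (res q a)
  nm_tr : ∀ {A B X Y Z : FinGSet G} (i : X ⟶ Y) (j : Y ⟶ Z) (f : A ⟶ X) (g : A ⟶ B) (h : B ⟶ Z),
    IsExponential i j f g h → ∀ a : obj X, nm j (tr i a) = tr h (nm g (res f a))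

namespace SemiTambaraFunctor

variable {G : Type u} [Group G] (T : SemiTambaraFunctor G)

/-- The restrictions and norms of a semi-Tambara functor, viewed as a semi-Mackey functor with
the norms in place of the transfers. -/
def normSemiMackey : SemiMackeyFunctor G where
  obj := T.obj
  nonempty := T.nonempty
  res := T.res
  tr := T.nm
  res_id := T.res_id
  res_comp := T.res_comp
  tr_id := T.nm_id
  tr_comp := T.nm_comp
  bijective_res := T.bijective_res
  res_tr := T.res_nm

/-- The multiplication `T(X) × T(X) ≅ T(X ⊔ X) → T(X)` given by the norm along the fold map. -/
noncomputable def mul {X : FinGSet G} (a b : T.obj X) : T.obj X :=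
  T.nm (fold X) (T.pair a b)

/-- The multiplicative unit, coming from the norm `T(∅) → T(X)`. -/
noncomputable def one (X : FinGSet G) : T.obj X :=
  T.nm (fromEmpty X) (Classical.choice (T.nonempty (empty G)))

variable {T}

theorem mul_eq {X : FinGSet G} (a b : T.obj X) : T.mul a b = T.normSemiMackey.add a b := rfl

theorem one_eq (X : FinGSet G) : T.one X = T.normSemiMackey.zero X := rfl

theorem mul_comm {X : FinGSet G} (a b : T.obj X) : T.mul a b = T.mul b a :=
  SemiMackeyFunctor.add_comm (M := T.normSemiMackey) a b

theorem mul_assoc {X : FinGSet G} (a b c : T.obj X) : T.mul (T.mul a b) c = T.mul a (T.mul b c) :=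
  SemiMackeyFunctor.add_assoc (M := T.normSemiMackey) a b c

theorem one_mul {X : FinGSet G} (a : T.obj X) : T.mul (T.one X) a = a :=
  SemiMackeyFunctor.zero_add (M := T.normSemiMackey) a

theorem res_mul {X Y : FinGSet G} (f : X ⟶ Y) (a b : T.obj Y) :
    T.res f (T.mul a b) = T.mul (T.res f a) (T.res f b) :=
  SemiMackeyFunctor.res_add (M := T.normSemiMackey) f a b

theorem res_one {X Y : FinGSet G} (f : X ⟶ Y) : T.res f (T.one Y) = T.one X :=
  SemiMackeyFunctor.res_zero (M := T.normSemiMackey) f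

/-- The section over `f x` with values `x` and `f x` used in the proof of Frobenius
reciprocity. -/
def frobSection {X Y : FinGSet G} (f : X ⟶ Y) (x : X) :
    FibreSection (sumMap f (𝟙 Y)) (fold Y) where
  pt := f x
  sec y := Sum.elim (fun _ => Sum.inl x) (fun y' => Sum.inr y') y.1
  sec_spec := by
    rintro ⟨(y | y), h⟩
    · exact congrArg Sum.inl h.symm
    · rfl

theorem isExponential_frob {X Y : FinGSet G} (f : X ⟶ Y) :
    IsExponential (sumMap f (𝟙 Y)) (fold Y) (sumMap (𝟙 X) f) (fold X) f := by
  let b : X ⟶ depProd (sumMap f (𝟙 Y)) (fold Y) :=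
    mkHom (Y := depProd (sumMap f (𝟙 Y)) (fold Y)) (frobSection f) (by
      intro g x
      refine FibreSection.ext' (hom_smul f g x) ?_
      rintro (y | y) h h'
      · rfl
      · exact congrArg Sum.inr (smul_inv_smul g y).symm)
  have hb : Function.Bijective b := by
    constructor
    · intro x x' h
      have h1 : f x = f x' := congrArg FibreSection.pt h
      have := FibreSection.sec_congr (s := frobSection f x) (t := frobSection f x') h
        (y := Sum.inl (f x)) rfl rfl h1
      exact Sum.inl_injective this
    · intro s
      have h0 : fold Y (Sum.inl s.pt) = s.pt := rfl
      have hs := s.sec_spec ⟨Sum.inl s.pt, h0⟩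
      rcases hx : s.sec ⟨Sum.inl s.pt, h0⟩ with x | y
      · rw [hx] at hs
        have hfx : f x = s.pt := Sum.inl_injective hs
        refine ⟨x, FibreSection.ext' hfx ?_⟩
        rintro (y | y) h h'
        · obtain rfl : y = s.pt := h'
          exact hx.symm
        · have := s.sec_spec ⟨Sum.inr y, h'⟩
          rcases hy : s.sec ⟨Sum.inr y, h'⟩ with x' | y'
          · rw [hy] at this
            exact absurd this Sum.inl_ne_inr
          · rw [hy] at this
            exact congrArg Sum.inr (Sum.inr_injective this).symm
      · rw [hx] at hs
        exact absurd hs Sum.inr_ne_inl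
  have hfold : ∀ w : X.sum X, fold Y (sumMap f f w) = f (fold X w) := by rintro (x | x) <;> rfl
  let a : X.sum X ⟶ depProdPullback (sumMap f (𝟙 Y)) (fold Y) :=
    mkHom (Y := depProdPullback (sumMap f (𝟙 Y)) (fold Y))
      (fun w => ⟨(sumMap f f w, b (fold X w)), hfold w⟩) (fun g w => by
        refine Subtype.ext (Prod.ext ?_ ?_)
        · exact hom_smul (sumMap f f) g w
        · exact (congrArg b (hom_smul (fold X) g w)).trans (hom_smul b g _))
  have ha : Function.Bijective a := by
    constructor
    · intro w w' h
      have h1 : sumMap f f w = sumMap f f w' := congrArg (fun c => c.1.1) h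
      have h2 : fold X w = fold X w' := hb.1 (congrArg (fun c => c.1.2) h)
      rcases w with x | x <;> rcases w' with x' | x'
      · exact congrArg Sum.inl h2
      · exact absurd h1 Sum.inl_ne_inr
      · exact absurd h1 Sum.inr_ne_inl
      · exact congrArg Sum.inr h2
    · rintro ⟨⟨y, s⟩, hy⟩
      obtain ⟨x, rfl⟩ := hb.2 s
      rcases y with y | y
      · refine ⟨Sum.inl x, Subtype.ext (Prod.ext ?_ rfl)⟩
        exact congrArg Sum.inl hy.symm
      · refine ⟨Sum.inr x, Subtype.ext (Prod.ext ?_ rfl)⟩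
        exact congrArg Sum.inr hy.symm
  refine ⟨isoOfBijective a ha, isoOfBijective b hb, ?_, rfl, rfl⟩
  exact sum_hom_ext rfl rfl

theorem frobenius {X Y : FinGSet G} (f : X ⟶ Y) (a : T.obj X) (b : T.obj Y) :
    T.tr f (T.mul a (T.res f b)) = T.mul (T.tr f a) b := by
  have e : T.pair (T.tr f a) b = T.tr (sumMap f (𝟙 Y)) (T.pair a b) := by
    rw [SemiMackeyFunctor.tr_sumMap_pair, T.tr_id]
  rw [mul, mul, e, T.nm_tr _ _ _ _ _ (isExponential_frob f)]
  congr 2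
  symm
  refine SemiMackeyFunctor.eq_pair ?_ ?_
  · rw [← T.res_comp]
    exact SemiMackeyFunctor.res_inl_pair a b
  · rw [← T.res_comp]
    change T.res (f ≫ inr _ _) _ = _
    rw [T.res_comp, SemiMackeyFunctor.res_inr_pair]

theorem mul_add {X : FinGSet G} (a b c : T.obj X) :
    T.mul a (T.add b c) = T.add (T.mul a b) (T.mul a c) := by
  rw [mul_comm, SemiMackeyFunctor.add, ← frobenius, SemiMackeyFunctor.add]
  congr 1
  refine SemiMackeyFunctor.eq_pair ?_ ?_
  · rw [res_mul, SemiMackeyFunctor.res_inl_pair, ← T.res_comp, fold, inl_desc, T.res_id, mul_comm]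
  · rw [res_mul, SemiMackeyFunctor.res_inr_pair, ← T.res_comp, fold, inr_desc, T.res_id, mul_comm]

end SemiTambaraFunctor

/-- A Tambara functor: a semi-Tambara functor whose additive monoids are abelian groups. -/
structure TambaraFunctor (G : Type u) [Group G] extends SemiTambaraFunctor G where
  exists_neg : ∀ (X : FinGSet G) (a : obj X), ∃ b : obj X,
    toSemiMackeyFunctor.add a b = toSemiMackeyFunctor.zero X

namespace TambaraFunctor

variable {G : Type u} [Group G]

/-- A map of Tambara functors: a family of maps commuting with restrictions, transfers and
norms. -/
@[ext] structure Hom (T U : TambaraFunctor G) extends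
    SemiMackeyFunctor.Hom T.toSemiMackeyFunctor U.toSemiMackeyFunctor where
  app_nm : ∀ {X Y : FinGSet G} (f : X ⟶ Y) (a : T.obj X), app Y (T.nm f a) = U.nm f (app X a)

/-- The category of Tambara functors. -/
instance : Category (TambaraFunctor G) where
  Hom := Hom
  id T :=
    { app := fun _ a => a
      app_res := fun _ _ => rfl
      app_tr := fun _ _ => rfl
      app_nm := fun _ _ => rfl }
  comp φ ψ :=
    { app := fun X a => ψ.app X (φ.app X a)
      app_res := fun f a => by rw [φ.app_res, ψ.app_res]
      app_tr := fun f a => by rw [φ.app_tr, ψ.app_tr]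
      app_nm := fun f a => by rw [φ.app_nm, ψ.app_nm] }

/-- The underlying commutative Green functor of a Tambara functor. -/
noncomputable def toGreen (T : TambaraFunctor G) : CommGreenFunctor G where
  toSemiMackeyFunctor := T.toSemiMackeyFunctor
  exists_neg := T.exists_neg
  mul := T.mul
  one := T.one
  mul_assoc := SemiTambaraFunctor.mul_assoc
  mul_comm := SemiTambaraFunctor.mul_comm
  one_mul := SemiTambaraFunctor.one_mul
  mul_add := SemiTambaraFunctor.mul_add
  res_mul := SemiTambaraFunctor.res_mul
  res_one := SemiTambaraFunctor.res_one
  frobenius := SemiTambaraFunctor.frobenius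

/-- The norms of a map of Tambara functors, viewed as a map of semi-Mackey functors. -/
def Hom.norm {T U : TambaraFunctor G} (φ : Hom T U) :
    SemiMackeyFunctor.Hom T.normSemiMackey U.normSemiMackey where
  app := φ.app
  app_res := φ.app_res
  app_tr := φ.app_nm

/-- The forgetful functor from Tambara functors to commutative Green functors. -/
noncomputable def forgetToGreen (G : Type u) [Group G] :
    TambaraFunctor G ⥤ CommGreenFunctor G where
  obj T := T.toGreen
  map {T U} φ :=
    { app := φ.app
      app_res := φ.app_res
      app_tr := φ.app_tr
      app_mul := fun a b => (Hom.norm φ).app_add a b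
      app_one := fun X => (Hom.norm φ).app_zero X }

end TambaraFunctor

/-! ### Tambara structures on a commutative Green functor -/

/-- A Tambara functor structure on a commutative Green functor `R`: norm maps making the
underlying Mackey functor of `R` into a Tambara functor, and inducing the given product. -/
@[ext] structure TambaraStructure {G : Type u} [Group G] (R : CommGreenFunctor G) where
  nm : ∀ {X Y : FinGSet G}, (X ⟶ Y) → R.obj X → R.obj Y
  nm_id : ∀ (X : FinGSet G) (a : R.obj X), nm (𝟙 X) a = a
  nm_comp : ∀ {X Y Z : FinGSet G} (f : X ⟶ Y) (g : Y ⟶ Z) (a : R.obj X),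
    nm (f ≫ g) a = nm g (nm f a)
  res_nm : ∀ {P X Y Z : FinGSet G} (p : P ⟶ X) (q : P ⟶ Y) (j : X ⟶ Z) (i : Y ⟶ Z),
    IsPullback p q j i → ∀ a : R.obj Y, R.res j (nm i a) = nm p (R.res q a)
  nm_tr : ∀ {A B X Y Z : FinGSet G} (i : X ⟶ Y) (j : Y ⟶ Z) (f : A ⟶ X) (g : A ⟶ B) (h : B ⟶ Z),
    IsExponential i j f g h → ∀ a : R.obj X, nm j (R.tr i a) = R.tr h (nm g (R.res f a))
  nm_fold : ∀ (X : FinGSet G) (a b : R.obj X), nm (fold X) (R.pair a b) = R.mul a b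

namespace TambaraStructure

variable {G : Type u} [Group G] {R : CommGreenFunctor G}

/-- The Tambara functor given by a Tambara structure on `R`. -/
def toTambara (S : TambaraStructure R) : TambaraFunctor G where
  toSemiMackeyFunctor := R.toSemiMackeyFunctor
  nm := S.nm
  nm_id := S.nm_id
  nm_comp := S.nm_comp
  res_nm := S.res_nm
  nm_tr := S.nm_tr
  exists_neg := R.exists_neg

/-- A map of commutative Green functors `T ⟶ R` is a map of Tambara functors with respect to the
Tambara structure `S` on `R`. -/
def IsTambaraMap (S : TambaraStructure R) {T : TambaraFunctor G}
    (φ : (TambaraFunctor.forgetToGreen G).obj T ⟶ R) : Prop :=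
  ∀ {X Y : FinGSet G} (f : X ⟶ Y) (a : T.obj X), φ.app Y (T.nm f a) = S.nm f (φ.app X a)

/-- The corresponding map of Tambara functors. -/
def lift (S : TambaraStructure R) {T : TambaraFunctor G}
    (φ : (TambaraFunctor.forgetToGreen G).obj T ⟶ R) (h : S.IsTambaraMap φ) :
    T ⟶ S.toTambara where
  app := φ.app
  app_res := φ.app_res
  app_tr := φ.app_tr
  app_nm := h

end TambaraStructure

/-! ### Box products -/

/-- A (Dress) pairing `M, N → P` of Mackey functors: biadditive maps `M(X) × N(X) → P(X)` which
are natural with respect to restrictions and satisfy Frobenius reciprocity in each variable. -/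
structure DressPairing {G : Type u} [Group G] (M N P : MackeyFunctor G) where
  app : ∀ {X : FinGSet G}, M.obj X → N.obj X → P.obj X
  add_left : ∀ {X : FinGSet G} (a a' : M.obj X) (b : N.obj X),
    app (M.add a a') b = P.add (app a b) (app a' b)
  add_right : ∀ {X : FinGSet G} (a : M.obj X) (b b' : N.obj X),
    app a (N.add b b') = P.add (app a b) (app a b')
  res_app : ∀ {X Y : FinGSet G} (f : X ⟶ Y) (a : M.obj Y) (b : N.obj Y),
    P.res f (app a b) = app (M.res f a) (N.res f b)
  tr_left : ∀ {X Y : FinGSet G} (f : X ⟶ Y) (a : M.obj X) (b : N.obj Y),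
    P.tr f (app a (N.res f b)) = app (M.tr f a) b
  tr_right : ∀ {X Y : FinGSet G} (f : X ⟶ Y) (a : M.obj Y) (b : N.obj X),
    P.tr f (app (M.res f a) b) = app a (N.tr f b)

namespace CommGreenFunctor

variable {G : Type u} [Group G]

/-- The pairing `(a, b) ↦ j₁(a) · j₂(b)` determined by two maps of commutative Green functors
with the same target. -/
def pairing {R₁ R₂ P : CommGreenFunctor G} (j₁ : R₁ ⟶ P) (j₂ : R₂ ⟶ P) :
    DressPairing R₁.toMackeyFunctor R₂.toMackeyFunctor P.toMackeyFunctor where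
  app {X} a b := P.mul (j₁.app X a) (j₂.app X b)
  add_left a a' b := by
    rw [P.mul_comm, j₁.app_add, P.mul_add, P.mul_comm _ (j₁.app _ a), P.mul_comm _ (j₁.app _ a')]
  add_right a b b' := by rw [j₂.app_add, P.mul_add]
  res_app f a b := by rw [P.res_mul, j₁.app_res, j₂.app_res]
  tr_left f a b := by rw [j₂.app_res, P.frobenius, j₁.app_tr]
  tr_right f a b := by
    rw [j₁.app_res, P.mul_comm, P.frobenius, ← j₂.app_tr, P.mul_comm]

/-- `P`, with `j₁ : R₁ ⟶ P` and `j₂ : R₂ ⟶ P`, is the box product `R₁ ⊗ R₂`: the pairing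
`(a, b) ↦ j₁(a) · j₂(b)` is universal among the pairings of the underlying Mackey functors. -/
def IsBoxProduct {R₁ R₂ P : CommGreenFunctor G} (j₁ : R₁ ⟶ P) (j₂ : R₂ ⟶ P) : Prop :=
  ∀ (N : MackeyFunctor G) (θ : DressPairing R₁.toMackeyFunctor R₂.toMackeyFunctor N),
    ∃! φ : SemiMackeyFunctor.Hom P.toSemiMackeyFunctor N.toSemiMackeyFunctor,
      ∀ (X : FinGSet G) (a : R₁.obj X) (b : R₂.obj X),
        φ.app X ((pairing j₁ j₂).app a b) = θ.app a b

/-- A pairing of `R₁` and `R₂` is balanced over `R₀` (with respect to `g₁ : R₀ ⟶ R₁` and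
`g₂ : R₀ ⟶ R₂`) if `θ(a · g₁(c), b) = θ(a, g₂(c) · b)`. -/
def IsBalanced {R₀ R₁ R₂ : CommGreenFunctor G} (g₁ : R₀ ⟶ R₁) (g₂ : R₀ ⟶ R₂)
    {N : MackeyFunctor G} (θ : DressPairing R₁.toMackeyFunctor R₂.toMackeyFunctor N) : Prop :=
  ∀ (X : FinGSet G) (a : R₁.obj X) (c : R₀.obj X) (b : R₂.obj X),
    θ.app (R₁.mul a (g₁.app X c)) b = θ.app a (R₂.mul (g₂.app X c) b)

/-- `P`, with `j₁ : R₁ ⟶ P` and `j₂ : R₂ ⟶ P`, is the relative box product `R₁ ⊗_{R₀} R₂`: the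
pairing `(a, b) ↦ j₁(a) · j₂(b)` is balanced over `R₀`, and universal among such pairings. -/
def IsRelativeBoxProduct {R₀ R₁ R₂ P : CommGreenFunctor G} (g₁ : R₀ ⟶ R₁) (g₂ : R₀ ⟶ R₂)
    (j₁ : R₁ ⟶ P) (j₂ : R₂ ⟶ P) : Prop :=
  IsBalanced g₁ g₂ (pairing j₁ j₂) ∧
  ∀ (N : MackeyFunctor G) (θ : DressPairing R₁.toMackeyFunctor R₂.toMackeyFunctor N),
    IsBalanced g₁ g₂ θ →
    ∃! φ : SemiMackeyFunctor.Hom P.toSemiMackeyFunctor N.toSemiMackeyFunctor,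
      ∀ (X : FinGSet G) (a : R₁.obj X) (b : R₂.obj X),
        φ.app X ((pairing j₁ j₂).app a b) = θ.app a b

end CommGreenFunctor

/-! ### Elementwise descriptions of limits and colimits of finite `G`-sets -/

namespace FinGSet

variable {G : Type u} [Group G]

/-! Colimits are built from coproducts and coequalizers, so it is enough to construct these two for
Tambara functors in such a way that the same object is also universal among commutative Green
functors. The statements on Tambara structures are then formal: norms are transported along an
isomorphism of Green functors, and the universal property among Tambara functors shows that no other
norms are possible.

Nonempty coproducts. By Frobenius reciprocity a product of transfers is again a transfer of a
product, so the elements generated by the `R i` are the transfers `tr f (∏ m i)` with `f : A ⟶ X`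
and almost all `m i` equal to `1`. The coproduct consists of formal symbols of this kind modulo one
relation, `Link`: a transfer in a single factor may be pulled out of the product if the other
factors are restricted. Its norms are forced by the distributive law. They are well defined and
satisfy the axioms because exponential diagrams compose in both variables and are stable under base
change (`IsExp.trans`, `IsExp.comp`, `IsExp.baseChange`). Negating one factor gives additive
inverses.

The empty coproduct is the Burnside functor, whose elements are differences of classes of finite
`G`-sets over `X`. It is realised inside a ghost functor of multiplicative functions, where the
class of `B` becomes the function counting the lifts `W ⟶ B` of a map `W ⟶ X`. Two facts carry this.
Norms of differences of classes are differences of classes, by a formula valid in every Tambara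
functor (`isVirtual_nm_negOne`). Finite `G`-sets over `X` are determined by their numbers of lifts
(`exists_iso_of_card_lifts`), so that an equality in the ghost functor comes from an isomorphism of
`G`-sets and therefore holds in every Green functor.

Coequalizers. A reflexive pair is coequalized by the levelwise quotient: all unary operations
descend at once, and the section makes the pairing of two elements descend. An arbitrary pair `f, g
: R ⟶ S` is replaced by the reflexive pair from the coproduct of `R` and `S` to `S`, whose
components are `f`, respectively `g`, and the identity.

Box products. For two factors the relation `Link` is exactly Frobenius reciprocity in each variable
of a Dress pairing, so the coproduct carries the universal pairing. Balanced pairings are those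
whose induced maps factor through the coequalizer of the two maps from `R₀`. A universal pairing is
unique up to an isomorphism of Green functors (`IsUniversalPairing.exists_iso`), which gives the
equivalences with coproducts and pushouts. -/

theorem comp_app {X Y Z : FinGSet G} (f : X ⟶ Y) (g : Y ⟶ Z) (x : X) : (f ≫ g) x = g (f x) := rfl

theorem congr_hom {X Y : FinGSet G} {f g : X ⟶ Y} (h : f = g) (x : X) : f x = g x := by rw [h]

/-- The fibre product of finite `G`-sets. -/
def pb {X Y Z : FinGSet G} (j : X ⟶ Z) (i : Y ⟶ Z) : FinGSet G :=
  letI : MulAction G {a : X × Y // j a.1 = i a.2} :=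
    { smul := fun g a => ⟨g • a.1, by
        change j (g • a.1.1) = i (g • a.1.2)
        rw [hom_smul, hom_smul, a.2]⟩
      one_smul := fun a => Subtype.ext (one_smul G a.1)
      mul_smul := fun g h a => Subtype.ext (mul_smul g h a.1) }
  ⟨{a : X × Y // j a.1 = i a.2}⟩

def pbFst {X Y Z : FinGSet G} (j : X ⟶ Z) (i : Y ⟶ Z) : pb j i ⟶ X :=
  mkHom (X := pb j i) (fun a => a.1.1) fun _ _ => rfl

def pbSnd {X Y Z : FinGSet G} (j : X ⟶ Z) (i : Y ⟶ Z) : pb j i ⟶ Y :=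
  mkHom (X := pb j i) (fun a => a.1.2) fun _ _ => rfl

theorem isPullback_pb {X Y Z : FinGSet G} (j : X ⟶ Z) (i : Y ⟶ Z) :
    IsPullback (pbFst j i) (pbSnd j i) j i :=
  isPullback_of_existsUnique (fun a => a.2) fun x y h =>
    ⟨⟨(x, y), h⟩, ⟨rfl, rfl⟩, fun _ hb => Subtype.ext (Prod.ext hb.1 hb.2)⟩

theorem bijective_of_iso {X Y : FinGSet G} (e : X ≅ Y) : Function.Bijective e.hom :=
  Function.bijective_iff_has_inverse.mpr
    ⟨e.inv, fun x => congr_hom e.hom_inv_id x, fun x => congr_hom e.inv_hom_id x⟩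

section

variable {P X Y Z : FinGSet G} {p : P ⟶ X} {q : P ⟶ Y} {j : X ⟶ Z} {i : Y ⟶ Z}

theorem pullback_w (h : IsPullback p q j i) (a : P) : j (p a) = i (q a) := congr_hom h.w a

theorem pullback_ext (h : IsPullback p q j i) {a b : P} (h1 : p a = p b) (h2 : q a = q b) :
    a = b := by
  let e := h.isoIsPullback _ _ (isPullback_pb j i)
  refine (bijective_of_iso e).1 (Subtype.ext (Prod.ext ?_ ?_))
  · exact (congr_hom (h.isoIsPullback_hom_fst _ _ (isPullback_pb j i)) a).trans
      (h1.trans (congr_hom (h.isoIsPullback_hom_fst _ _ (isPullback_pb j i)) b).symm)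
  · exact (congr_hom (h.isoIsPullback_hom_snd _ _ (isPullback_pb j i)) a).trans
      (h2.trans (congr_hom (h.isoIsPullback_hom_snd _ _ (isPullback_pb j i)) b).symm)

theorem pullback_exists (h : IsPullback p q j i) {x : X} {y : Y} (hxy : j x = i y) :
    ∃ a, p a = x ∧ q a = y := by
  refine ⟨(h.isoIsPullback _ _ (isPullback_pb j i)).inv ⟨(x, y), hxy⟩, ?_, ?_⟩
  · exact congr_hom (h.isoIsPullback_inv_fst _ _ (isPullback_pb j i)) _
  · exact congr_hom (h.isoIsPullback_inv_snd _ _ (isPullback_pb j i)) _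

theorem isPullback_of_elements (w : ∀ a, j (p a) = i (q a))
    (he : ∀ x y, j x = i y → ∃ a, p a = x ∧ q a = y)
    (hi : ∀ a b, p a = p b → q a = q b → a = b) : IsPullback p q j i :=
  isPullback_of_existsUnique w fun x y h => by
    obtain ⟨a, h1, h2⟩ := he x y h
    exact ⟨a, ⟨h1, h2⟩, fun b hb => hi _ _ (hb.1.trans h1.symm) (hb.2.trans h2.symm)⟩

end

theorem comp_sumDesc_desc {X Y Z W : FinGSet G} (f : X ⟶ Z) (g : Y ⟶ Z) (k : Z ⟶ W) :
    sumDesc f g ≫ k = sumDesc (f ≫ k) (g ≫ k) := sum_hom_ext rfl rfl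

/-- A coproduct of finite `G`-sets is isomorphic to the disjoint union. -/
noncomputable def sumIso {X Y Z : FinGSet G} {i : X ⟶ Z} {j : Y ⟶ Z}
    (h : IsColimit (BinaryCofan.mk i j)) : X.sum Y ≅ Z :=
  (sumIsColimit X Y).coconePointUniqueUpToIso h

theorem inl_sumIso {X Y Z : FinGSet G} {i : X ⟶ Z} {j : Y ⟶ Z}
    (h : IsColimit (BinaryCofan.mk i j)) : inl X Y ≫ (sumIso h).hom = i :=
  (sumIsColimit X Y).comp_coconePointUniqueUpToIso_hom h ⟨WalkingPair.left⟩

theorem inr_sumIso {X Y Z : FinGSet G} {i : X ⟶ Z} {j : Y ⟶ Z}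
    (h : IsColimit (BinaryCofan.mk i j)) : inr X Y ≫ (sumIso h).hom = j :=
  (sumIsColimit X Y).comp_coconePointUniqueUpToIso_hom h ⟨WalkingPair.right⟩

/-- The sub-`G`-set defined by an invariant predicate. -/
def sub (X : FinGSet G) (p : X → Prop) (hp : ∀ (g : G) (x : X), p x → p (g • x)) : FinGSet G :=
  letI : MulAction G {x : X // p x} :=
    { smul := fun g x => ⟨g • x.1, hp g x.1 x.2⟩
      one_smul := fun x => Subtype.ext (one_smul G x.1)
      mul_smul := fun g h x => Subtype.ext (mul_smul g h x.1) }
  ⟨{x : X // p x}⟩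

def subIncl (X : FinGSet G) (p : X → Prop) (hp : ∀ (g : G) (x : X), p x → p (g • x)) :
    sub X p hp ⟶ X :=
  mkHom (X := sub X p hp) Subtype.val fun _ _ => rfl

theorem not_smul_of_not {X : FinGSet G} {p : X → Prop} (hp : ∀ (g : G) (x : X), p x → p (g • x))
    (g : G) (x : X) (h : ¬ p x) : ¬ p (g • x) := fun h' => h (by
  have := hp g⁻¹ _ h'
  rwa [inv_smul_smul] at this)

/-! ### A small skeleton of the category of finite `G`-sets -/

/-- The `G`-actions on standard finite sets. -/
structure StdGSet (G : Type u) [Group G] : Type u where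
  card : ℕ
  act : MulAction G (ULift.{u} (Fin card))

/-- The finite `G`-set given by an action on a standard finite set. -/
def StdGSet.toFinGSet (s : StdGSet G) : FinGSet G :=
  letI := s.act
  ⟨ULift.{u} (Fin s.card)⟩

theorem exists_stdGSet_iso (X : FinGSet G) : ∃ s : StdGSet G, Nonempty (s.toFinGSet ≅ X) := by
  obtain ⟨n, ⟨e⟩⟩ := Finite.exists_equiv_fin X
  let e' : ULift.{u} (Fin n) ≃ X := Equiv.ulift.trans e.symm
  let s : StdGSet G := ⟨n, e'.mulAction G⟩
  refine ⟨s, ⟨isoOfBijective (mkHom (X := s.toFinGSet) e' fun g x => ?_) e'.bijective⟩⟩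
  exact e'.apply_symm_apply _

/-! ### Elementwise description of exponential diagrams -/

/-- The elementwise form of an exponential diagram. -/
structure IsExp {A B X Y Z : FinGSet G} (i : X ⟶ Y) (j : Y ⟶ Z) (f : A ⟶ X) (g : A ⟶ B)
    (h : B ⟶ Z) : Prop where
  comm : ∀ a, j (i (f a)) = h (g a)
  lift : ∀ y b, j y = h b → ∃ a, i (f a) = y ∧ g a = b
  inj : ∀ a a', i (f a) = i (f a') → g a = g a' → a = a'
  sect : ∀ (z : Z) (s : {y : Y // j y = z} → X), (∀ y, i (s y) = y.1) →
    ∃ b, h b = z ∧ ∀ a (ha : j (i (f a)) = z), g a = b → f a = s ⟨i (f a), ha⟩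
  ext : ∀ b b', h b = h b' → (∀ a a', g a = b → g a' = b' → i (f a) = i (f a') → f a = f a') →
    b = b'

section

variable {A B X Y Z : FinGSet G} {i : X ⟶ Y} {j : Y ⟶ Z} {f : A ⟶ X} {g : A ⟶ B} {h : B ⟶ Z}

theorem depProd_isExponential (i : X ⟶ Y) (j : Y ⟶ Z) :
    IsExponential i j (depProdEval i j) (depProdSnd i j) (depProdProj i j) :=
  ⟨Iso.refl _, Iso.refl _, rfl, rfl, rfl⟩

theorem isExp_depProd (i : X ⟶ Y) (j : Y ⟶ Z) :
    IsExp i j (depProdEval i j) (depProdSnd i j) (depProdProj i j) where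
  comm a := (congrArg j (a.1.2.sec_spec ⟨a.1.1, a.2⟩)).trans a.2
  lift y b hyb := ⟨⟨(y, b), hyb⟩, b.sec_spec ⟨y, hyb⟩, rfl⟩
  inj a a' h1 h2 := by
    refine Subtype.ext (Prod.ext ?_ h2)
    exact (a.1.2.sec_spec ⟨a.1.1, a.2⟩).symm.trans (h1.trans (a'.1.2.sec_spec ⟨a'.1.1, a'.2⟩))
  sect z s hs := by
    refine ⟨(⟨z, s, hs⟩ : FibreSection i j), rfl, ?_⟩
    rintro ⟨⟨y, b⟩, hyb⟩ ha rfl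
    exact congrArg s (Subtype.ext (hs ⟨y, hyb⟩).symm)
  ext b b' hb hs := FibreSection.ext' hb fun y h1 h2 =>
    hs ⟨(y, b), h1⟩ ⟨(y, b'), h2⟩ rfl rfl
      ((b.sec_spec ⟨y, h1⟩).trans (b'.sec_spec ⟨y, h2⟩).symm)

theorem IsExp.of_isExponential (H : IsExponential i j f g h) : IsExp i j f g h := by
  obtain ⟨α, β, rfl, hg, rfl⟩ := H
  have D := isExp_depProd i j
  have hα := bijective_of_iso α
  have hβ := bijective_of_iso β
  have hg' : ∀ a, β.hom (g a) = depProdSnd i j (α.hom a) := fun a => congr_hom hg a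
  refine ⟨fun a => ?_, fun y b hb => ?_, fun a a' h1 h2 => ?_, fun z s hs => ?_,
    fun b b' hb hs => ?_⟩
  · simp only [comp_app]; rw [D.comm, hg']
  · obtain ⟨c, h1, h2⟩ := D.lift y (β.hom b) hb
    obtain ⟨a, rfl⟩ := hα.2 c
    exact ⟨a, h1, hβ.1 ((hg' a).trans h2)⟩
  · refine hα.1 (D.inj _ _ h1 ?_)
    rw [← hg', ← hg', h2]
  · obtain ⟨c, h1, h2⟩ := D.sect z s hs
    obtain ⟨b, rfl⟩ := hβ.2 c
    refine ⟨b, h1, fun a ha hab => h2 (α.hom a) ha ?_⟩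
    rw [← hg', hab]
  · refine hβ.1 (D.ext _ _ hb fun c c' h1 h2 h3 => ?_)
    obtain ⟨a, rfl⟩ := hα.2 c
    obtain ⟨a', rfl⟩ := hα.2 c'
    exact hs a a' (hβ.1 ((hg' a).trans h1)) (hβ.1 ((hg' a').trans h2)) h3

/-- The comparison with the standard diagram is forced: a point `b` goes to the section `y ↦ f a`,
where `a` is the unique point of `A` lying over `y` and `b`. The fields `sect` and `ext` give
surjectivity and injectivity, and uniqueness of `a` gives equivariance. -/
theorem IsExp.isExponential (H : IsExp i j f g h) : IsExponential i j f g h := by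
  choose l hl1 hl2 using H.lift
  have hf : ∀ (b : B) (y : Y) (hy : j y = h b) (a : A), i (f a) = y → g a = b →
      l y b hy = a := fun b y hy a h1 h2 =>
    H.inj _ _ ((hl1 y b hy).trans h1.symm) ((hl2 y b hy).trans h2.symm)
  let β₀ : B → FibreSection i j := fun b =>
    ⟨h b, fun y => f (l y.1 b y.2), fun y => hl1 y.1 b y.2⟩
  let β : B ⟶ depProd i j := mkHom (Y := depProd i j) β₀ (by
    intro c b
    refine FibreSection.ext' (hom_smul h c b) fun y h1 h2 => ?_
    change f (l y (c • b) h1) = c • f (l (c⁻¹ • y) b _)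
    have h3 : j y = h (c • b) := h1
    have h4 : j (c⁻¹ • y) = h b := by rw [hom_smul, h3, hom_smul, inv_smul_smul]
    rw [hf (c • b) y h1 (c • l (c⁻¹ • y) b h4), hom_smul]
    · rw [hom_smul, hom_smul, hl1, smul_inv_smul]
    · rw [hom_smul, hl2])
  have hβ : Function.Bijective β := by
    constructor
    · intro b b' hbb
      refine H.ext b b' (congrArg FibreSection.pt hbb) fun a a' h1 h2 h3 => ?_
      have e1 : j (i (f a)) = h b := by rw [H.comm, h1]
      have e2 : j (i (f a')) = h b' := by rw [H.comm, h2]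
      have := FibreSection.sec_congr (s := β₀ b) (t := β₀ b') hbb h3 e1 e2
      change f (l _ b e1) = f (l _ b' e2) at this
      rwa [hf b _ e1 a rfl h1, hf b' _ e2 a' rfl h2] at this
    · intro s
      obtain ⟨b, h1, h2⟩ := H.sect s.pt s.sec s.sec_spec
      refine ⟨b, FibreSection.ext' h1 fun y hy hy' => ?_⟩
      change f (l y b hy) = _
      have hy2 : j y = h b := hy
      have h3 : j (i (f (l y b hy2))) = s.pt := by rw [hl1]; exact hy'
      rw [h2 (l y b hy) h3 (hl2 y b hy)]
      exact congrArg s.sec (Subtype.ext (hl1 y b hy))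
  let α : A ⟶ depProdPullback i j := mkHom (Y := depProdPullback i j)
    (fun a => ⟨(i (f a), β (g a)), H.comm a⟩) (fun c a => by
      refine Subtype.ext (Prod.ext ?_ ?_)
      · change i (f (c • a)) = c • i (f a)
        rw [hom_smul, hom_smul]
      · exact (congrArg β (hom_smul g c a)).trans (hom_smul β c _))
  have hα : Function.Bijective α := by
    constructor
    · intro a a' haa
      exact H.inj a a' (congrArg (fun c => c.1.1) haa) (hβ.1 (congrArg (fun c => c.1.2) haa))
    · rintro ⟨⟨y, s⟩, hy⟩
      obtain ⟨b, rfl⟩ := hβ.2 s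
      refine ⟨l y b hy, Subtype.ext (Prod.ext (hl1 y b hy) (congrArg β (hl2 y b hy)))⟩
  refine ⟨isoOfBijective α hα, isoOfBijective β hβ, ?_, rfl, rfl⟩
  ext a
  have h1 : j (i (f a)) = h (g a) := H.comm a
  exact (congrArg f (hf (g a) (i (f a)) h1 a rfl rfl)).symm

theorem isExponential_iff : IsExponential i j f g h ↔ IsExp i j f g h :=
  ⟨IsExp.of_isExponential, IsExp.isExponential⟩

end

/-- The square with vertices `A`, `Y`, `B`, `Z` of an exponential diagram is a pullback. -/
theorem IsExp.isPullback {A B X Y Z : FinGSet G} {i : X ⟶ Y} {j : Y ⟶ Z} {f : A ⟶ X} {g : A ⟶ B}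
    {h : B ⟶ Z} (H : IsExp i j f g h) : IsPullback g (f ≫ i) h j :=
  isPullback_of_elements (fun a => (H.comm a).symm)
    (fun b y hby => by
      obtain ⟨a, h1, h2⟩ := H.lift y b hby.symm
      exact ⟨a, h2, h1⟩)
    (fun a a' h1 h2 => H.inj a a' h2 h1)

theorem IsExp.id_right {X Y : FinGSet G} (i : X ⟶ Y) : IsExp i (𝟙 Y) (𝟙 X) (𝟙 X) i where
  comm _ := rfl
  lift y b h := ⟨b, h.symm, rfl⟩
  inj _ _ _ h := h
  sect z s hs := ⟨s ⟨z, rfl⟩, hs _, by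
    rintro a ha rfl
    exact congrArg s (Subtype.ext ha.symm)⟩
  ext b b' h1 h2 := h2 b b' rfl rfl h1

theorem IsExp.id_left {X Z : FinGSet G} (j : X ⟶ Z) : IsExp (𝟙 X) j (𝟙 X) j (𝟙 Z) where
  comm _ := rfl
  lift y _ h := ⟨y, rfl, h⟩
  inj _ _ h _ := h
  sect z _ hs := ⟨z, rfl, fun a ha _ => (hs ⟨a, ha⟩).symm⟩
  ext _ _ h1 _ := h1

/-- Exponential diagrams compose in the second variable. -/
theorem IsExp.comp {A B X Y Z V A' B' Q : FinGSet G} {i : X ⟶ Y} {j : Y ⟶ Z} {f : A ⟶ X}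
    {g : A ⟶ B} {h : B ⟶ Z} (H : IsExp i j f g h) {k : Z ⟶ V} {f' : A' ⟶ B} {g' : A' ⟶ B'}
    {h' : B' ⟶ V} (H' : IsExp h k f' g' h') {q : Q ⟶ A} {q' : Q ⟶ A'}
    (hQ : IsPullback q' q f' g) : IsExp i (j ≫ k) (q ≫ f) (q' ≫ g') h' where
  comm a := by
    simp only [comp_app]
    rw [H.comm, ← pullback_w hQ, H'.comm]
  lift y b' hy := by
    obtain ⟨a', h1, h2⟩ := H'.lift (j y) b' hy
    obtain ⟨a, h3, h4⟩ := H.lift y (f' a') h1.symm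
    obtain ⟨c, rfl, rfl⟩ := pullback_exists hQ h4.symm
    exact ⟨c, h3, h2⟩
  inj c c' h1 h2 := by
    simp only [comp_app] at h1 h2
    have h3 : q' c = q' c' := by
      refine H'.inj _ _ ?_ h2
      rw [pullback_w hQ, pullback_w hQ, ← H.comm, ← H.comm, h1]
    refine pullback_ext hQ h3 (H.inj _ _ h1 ?_)
    rw [← pullback_w hQ, ← pullback_w hQ, h3]
  sect v s hs := by
    simp only [comp_app] at *
    -- Restricted to the fibre of `j` over a point `z` with `k z = v`, the section `s` is a section
    -- of `i`, hence a point of `B`. These points form a section of `h` over the fibre of `k`, to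
    -- which `H'` applies.
    have hb : ∀ z : {z : Z // k z = v}, ∃ b, h b = z.1 ∧ ∀ a (ha : j (i (f a)) = z.1), g a = b →
        f a = s ⟨i (f a), by rw [comp_app, ha, z.2]⟩ := fun z =>
      H.sect z.1 (fun y => s ⟨y.1, by rw [comp_app, y.2, z.2]⟩) (fun y => hs _)
    choose t ht1 ht2 using hb
    obtain ⟨b', h1, h2⟩ := H'.sect v t ht1
    refine ⟨b', h1, fun c hc hcb => ?_⟩
    simp only [comp_app] at *
    have e : k (h (f' (q' c))) = v := by rw [H'.comm, hcb, h1]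
    have h3 := h2 (q' c) e hcb
    have e2 : j (i (f (q c))) = h (f' (q' c)) := by rw [H.comm, ← pullback_w hQ]
    have e3 : g (q c) = t ⟨h (f' (q' c)), e⟩ := by rw [← h3, pullback_w hQ]
    exact ht2 ⟨_, e⟩ (q c) e2 e3
  ext b b' hb hs := by
    simp only [comp_app] at *
    refine H'.ext b b' hb fun a a' h1 h2 h3 => H.ext _ _ h3 fun c c' h4 h5 h6 => ?_
    obtain ⟨x, rfl, rfl⟩ := pullback_exists hQ h4.symm
    obtain ⟨x', rfl, rfl⟩ := pullback_exists hQ h5.symm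
    exact hs x x' h1 h2 h6

/-- Exponential diagrams and composition in the first variable. -/
theorem IsExp.trans {A B X Y Z X' P A' B' : FinGSet G} {i : X ⟶ Y} {j : Y ⟶ Z} {f : A ⟶ X}
    {g : A ⟶ B} {h : B ⟶ Z} (H : IsExp i j f g h) {k : X' ⟶ X} {p : P ⟶ A} {q : P ⟶ X'}
    (hP : IsPullback p q f k) {f' : A' ⟶ P} {g' : A' ⟶ B'} {h' : B' ⟶ B}
    (H' : IsExp p g f' g' h') : IsExp (k ≫ i) j (f' ≫ q) g' (h' ≫ h) where
  comm a := by
    simp only [comp_app]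
    rw [← pullback_w hP, H.comm, H'.comm]
  lift y b' hy := by
    simp only [comp_app] at *
    obtain ⟨a, h1, h2⟩ := H.lift y (h' b') hy
    obtain ⟨a', h3, h4⟩ := H'.lift a b' h2
    refine ⟨a', ?_, h4⟩
    rw [← pullback_w hP, h3, h1]
  inj c c' h1 h2 := by
    simp only [comp_app] at *
    refine H'.inj c c' (H.inj _ _ ?_ ?_) h2
    · rw [pullback_w hP, h1, ← pullback_w hP]
    · rw [H'.comm, h2, ← H'.comm]
  sect z s hs := by
    simp only [comp_app] at *
    -- A section of `k ≫ i` amounts to a section of `i`, that is a point `b` of `B`, together with a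
    -- lift of it to `X'`; the lift is a section of `p` over the fibre of `g` at `b`.
    obtain ⟨b, hb1, hb2⟩ := H.sect z (fun y => k (s y)) hs
    have hc : ∀ a : {a : A // g a = b}, ∃ c : P, p c = a.1 ∧
        q c = s ⟨i (f a.1), by rw [H.comm, a.2, hb1]⟩ := fun a =>
      pullback_exists hP (hb2 a.1 _ a.2)
    choose t ht1 ht2 using hc
    obtain ⟨b', h1, h2⟩ := H'.sect b t ht1
    refine ⟨b', by rw [h1, hb1], fun a ha hab => ?_⟩
    simp only [comp_app] at *
    have e : g (p (f' a)) = b := by rw [H'.comm, hab, h1]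
    refine ((congrArg q (h2 a e hab)).trans (ht2 _)).trans (congrArg s (Subtype.ext ?_))
    exact congrArg i (pullback_w hP _)
  ext b b' hb hs := by
    simp only [comp_app] at *
    have hbb : h' b = h' b' := by
      refine H.ext _ _ hb fun a a' h1 h2 h3 => ?_
      obtain ⟨c, hc1, hc2⟩ := H'.lift a b h1
      obtain ⟨c', hc1', hc2'⟩ := H'.lift a' b' h2
      rw [← hc1, ← hc1', pullback_w hP, pullback_w hP]
      rw [hs c c' hc2 hc2']
      rw [← pullback_w hP, ← pullback_w hP, hc1, hc1', h3]
    refine H'.ext b b' hbb fun c c' h1 h2 h3 => pullback_ext hP h3 (hs c c' h1 h2 ?_)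
    rw [← pullback_w hP, ← pullback_w hP, h3]

/-- Exponential diagrams are stable under base change. -/
theorem IsExp.baseChange {A B X Y Z Z' Y' X' B' A' : FinGSet G} {i : X ⟶ Y} {j : Y ⟶ Z}
    {f : A ⟶ X} {g : A ⟶ B} {h : B ⟶ Z} (H : IsExp i j f g h) {v : Z' ⟶ Z} {j' : Y' ⟶ Z'}
    {y : Y' ⟶ Y} (hY : IsPullback j' y v j) {i' : X' ⟶ Y'} {x : X' ⟶ X}
    (hX : IsPullback i' x y i) {h' : B' ⟶ Z'} {b : B' ⟶ B} (hB : IsPullback h' b v h)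
    {g' : A' ⟶ B'} {a : A' ⟶ A} (hA : IsPullback g' a b g) {f' : A' ⟶ X'}
    (h1 : f' ≫ x = a ≫ f) (h2 : f' ≫ i' ≫ j' = g' ≫ h') : IsExp i' j' f' g' h' := by
  have e1 : ∀ c, x (f' c) = f (a c) := fun c => congr_hom h1 c
  have e2 : ∀ c, j' (i' (f' c)) = h' (g' c) := fun c => congr_hom h2 c
  have e3 : ∀ c, y (i' (f' c)) = i (f (a c)) := fun c => by rw [pullback_w hX, e1]
  refine ⟨e2, fun y' b' hy => ?_, fun c c' hc1 hc2 => ?_, fun z s hs => ?_, fun c c' hc hs => ?_⟩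
  · have : j (y y') = h (b b') := by rw [← pullback_w hY, hy, pullback_w hB]
    obtain ⟨c, hc1, hc2⟩ := H.lift _ _ this
    obtain ⟨d, rfl, rfl⟩ := pullback_exists hA hc2.symm
    refine ⟨d, pullback_ext hY ?_ ?_, rfl⟩
    · rw [e2, hy]
    · rw [e3, hc1]
  · refine pullback_ext hA hc2 (H.inj _ _ ?_ ?_)
    · rw [← e3, ← e3, hc1]
    · rw [← pullback_w hA, ← pullback_w hA, hc2]
  -- The map `y` identifies the fibre of `j'` over `z` with the fibre of `j` over `v z`; the section
  -- `s` is carried over along the inverse `l`.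
  · have hl : ∀ w : {w : Y // j w = v z}, ∃ w' : Y', j' w' = z ∧ y w' = w.1 := fun w =>
      pullback_exists hY w.2.symm
    choose l hl1 hl2 using hl
    obtain ⟨c, hc1, hc2⟩ := H.sect (v z) (fun w => x (s ⟨l w, hl1 w⟩)) (fun w => by
      rw [← pullback_w hX, hs, hl2])
    obtain ⟨d, rfl, rfl⟩ := pullback_exists hB hc1.symm
    refine ⟨d, rfl, fun m hm hmd => ?_⟩
    have h3 : j (i (f (a m))) = v (h' d) := by rw [H.comm, ← pullback_w hA, hmd, hc1]
    have h4 := hc2 (a m) h3 (by rw [← pullback_w hA, hmd])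
    have h5 : l ⟨i (f (a m)), h3⟩ = i' (f' m) := by
      refine pullback_ext hY ?_ ?_
      · rw [hl1, hm]
      · rw [hl2, e3]
    refine pullback_ext hX (hs ⟨i' (f' m), hm⟩).symm ?_
    rw [e1, h4]
    congr 2
    exact Subtype.ext h5
  · refine pullback_ext hB hc (H.ext _ _ ?_ fun d d' hd hd' hdd => ?_)
    · rw [← pullback_w hB, ← pullback_w hB, hc]
    · obtain ⟨m, rfl, rfl⟩ := pullback_exists hA hd.symm
      obtain ⟨m', rfl, rfl⟩ := pullback_exists hA hd'.symm
      rw [← e1, ← e1]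
      congr 1
      refine hs m m' rfl rfl (pullback_ext hY ?_ ?_)
      · rw [e2, e2, hc]
      · rw [e3, e3, hdd]

end FinGSet

/-! ### Further identities in semi-Mackey, Green and Tambara functors -/

namespace SemiMackeyFunctor

variable {G : Type u} [Group G]

/-- It suffices to check that coproducts are sent to products for disjoint unions. -/
theorem bijective_res_of_sum {obj : FinGSet G → Type u}
    {res : ∀ {X Y : FinGSet G}, (X ⟶ Y) → obj Y → obj X}
    (res_id : ∀ (X : FinGSet G) (a : obj X), res (𝟙 X) a = a)
    (res_comp : ∀ {X Y Z : FinGSet G} (f : X ⟶ Y) (g : Y ⟶ Z) (a : obj Z),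
      res (f ≫ g) a = res f (res g a))
    (h : ∀ X Y : FinGSet G, Function.Bijective
      (fun a : obj (X.sum Y) => ((res (inl X Y) a, res (inr X Y) a) : obj X × obj Y)))
    {X Y Z : FinGSet G} (i : X ⟶ Z) (j : Y ⟶ Z) (hc : IsColimit (BinaryCofan.mk i j)) :
    Function.Bijective (fun a : obj Z => ((res i a, res j a) : obj X × obj Y)) := by
  have hb : Function.Bijective (res (sumIso hc).hom) :=
    Function.bijective_iff_has_inverse.mpr ⟨res (sumIso hc).inv,
      fun a => by rw [← res_comp, Iso.inv_hom_id, res_id],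
      fun a => by rw [← res_comp, Iso.hom_inv_id, res_id]⟩
  convert (h X Y).comp hb using 1
  funext a
  simp only [Function.comp, ← res_comp, inl_sumIso, inr_sumIso]

variable {M : SemiMackeyFunctor G}

theorem add_zero {X : FinGSet G} (a : M.obj X) : M.add a (M.zero X) = a := by
  rw [add_comm, zero_add]

theorem res_pair {X Y X' Y' : FinGSet G} (f : X ⟶ X') (g : Y ⟶ Y') (a : M.obj X')
    (b : M.obj Y') : M.res (sumMap f g) (M.pair a b) = M.pair (M.res f a) (M.res g b) := by
  apply eq_pair
  · rw [← res_comp]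
    change M.res (f ≫ inl _ _) _ = _
    rw [res_comp, res_inl_pair]
  · rw [← res_comp]
    change M.res (g ≫ inr _ _) _ = _
    rw [res_comp, res_inr_pair]

theorem tr_sumDesc_pair {X Y Z : FinGSet G} (f : X ⟶ Z) (g : Y ⟶ Z) (a : M.obj X)
    (b : M.obj Y) : M.tr (sumDesc f g) (M.pair a b) = M.add (M.tr f a) (M.tr g b) := by
  rw [add, ← tr_sumMap_pair, ← tr_comp]
  congr 1
  exact sum_hom_ext rfl rfl

/-- An element over a disjoint union is the sum of the transfers of its restrictions. -/
theorem eq_add_tr_res {X Y : FinGSet G} (a : M.obj (X.sum Y)) :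
    a = M.add (M.tr (inl X Y) (M.res (inl X Y) a)) (M.tr (inr X Y) (M.res (inr X Y) a)) := by
  rw [← tr_sumDesc_pair]
  have : sumDesc (inl X Y) (inr X Y) = 𝟙 _ := sum_hom_ext rfl rfl
  rw [this, tr_id]
  exact eq_pair rfl rfl

theorem tr_inv_res {X Y : FinGSet G} (e : X ≅ Y) (a : M.obj Y) : M.tr e.hom (M.res e.hom a) = a := by
  rw [tr_iso, ← res_comp, Iso.inv_hom_id, res_id]

end SemiMackeyFunctor

namespace SemiTambaraFunctor

variable {G : Type u} [Group G] {T : SemiTambaraFunctor G}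

theorem nm_mul {X Y : FinGSet G} (f : X ⟶ Y) (a b : T.obj X) :
    T.nm f (T.mul a b) = T.mul (T.nm f a) (T.nm f b) :=
  SemiMackeyFunctor.tr_add (M := T.normSemiMackey) f a b

theorem nm_one {X Y : FinGSet G} (f : X ⟶ Y) : T.nm f (T.one X) = T.one Y :=
  SemiMackeyFunctor.tr_zero (M := T.normSemiMackey) f

end SemiTambaraFunctor

namespace CommGreenFunctor

variable {G : Type u} [Group G]

/-- The multiplicative monoids of a commutative Green functor. -/
instance commMonoid (R : CommGreenFunctor G) (X : FinGSet G) : CommMonoid (R.obj X) where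
  mul := R.mul
  one := R.one X
  mul_assoc := R.mul_assoc
  mul_comm := R.mul_comm
  one_mul := R.one_mul
  mul_one a := (R.mul_comm _ _).trans (R.one_mul a)

theorem mul_def {R : CommGreenFunctor G} {X : FinGSet G} (a b : R.obj X) : a * b = R.mul a b := rfl

/-- Restriction as a homomorphism of multiplicative monoids. -/
def resHom (R : CommGreenFunctor G) {X Y : FinGSet G} (f : X ⟶ Y) : R.obj Y →* R.obj X where
  toFun := R.res f
  map_one' := R.res_one f
  map_mul' := R.res_mul f

/-- A map of commutative Green functors as a homomorphism of multiplicative monoids. -/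
def Hom.appHom {R S : CommGreenFunctor G} (φ : R ⟶ S) (X : FinGSet G) : R.obj X →* S.obj X where
  toFun := φ.app X
  map_one' := φ.app_one X
  map_mul' := φ.app_mul

@[ext] theorem hom_ext {R S : CommGreenFunctor G} {φ ψ : R ⟶ S}
    (h : ∀ X a, φ.app X a = ψ.app X a) : φ = ψ :=
  Hom.ext (funext fun X => funext fun a => h X a)

theorem congr_app {R S : CommGreenFunctor G} {φ ψ : R ⟶ S} (h : φ = ψ) {X : FinGSet G}
    (a : R.obj X) : φ.app X a = ψ.app X a := by rw [h]

end CommGreenFunctor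

namespace TambaraFunctor

variable {G : Type u} [Group G]

@[ext] theorem hom_ext {R S : TambaraFunctor G} {φ ψ : R ⟶ S}
    (h : ∀ X a, φ.app X a = ψ.app X a) : φ = ψ :=
  Hom.ext (funext fun X => funext fun a => h X a)

theorem congr_app {R S : TambaraFunctor G} {φ ψ : R ⟶ S} (h : φ = ψ) {X : FinGSet G}
    (a : R.obj X) : φ.app X a = ψ.app X a := by rw [h]

theorem comp_app {R S T : TambaraFunctor G} (φ : R ⟶ S) (ψ : S ⟶ T) {X : FinGSet G}
    (a : R.obj X) : (φ ≫ ψ).app X a = ψ.app X (φ.app X a) := rfl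

/-- The norm of a Tambara functor as a homomorphism of multiplicative monoids. -/
def nmHom (T : TambaraFunctor G) {X Y : FinGSet G} (f : X ⟶ Y) :
    T.toGreen.obj X →* T.toGreen.obj Y where
  toFun := T.nm f
  map_one' := SemiTambaraFunctor.nm_one f
  map_mul' := SemiTambaraFunctor.nm_mul f

end TambaraFunctor

/-! ### Transport of norms along isomorphisms of Green functors -/

namespace TambaraStructure

variable {G : Type u} [Group G]

/-- Transport of the norms along a levelwise bijection. -/
def ofEquiv {T : TambaraFunctor G} {R : CommGreenFunctor G} (v : ∀ X, T.obj X → R.obj X)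
    (w : ∀ X, R.obj X → T.obj X) (hvw : ∀ X a, v X (w X a) = a) (hwv : ∀ X a, w X (v X a) = a)
    (v_res : ∀ {X Y : FinGSet G} (f : X ⟶ Y) a, v X (T.res f a) = R.res f (v Y a))
    (v_tr : ∀ {X Y : FinGSet G} (f : X ⟶ Y) a, v Y (T.tr f a) = R.tr f (v X a))
    (v_mul : ∀ {X : FinGSet G} (a b : T.obj X), v X (T.mul a b) = R.mul (v X a) (v X b)) :
    TambaraStructure R := by
  have w_res : ∀ {X Y : FinGSet G} (f : X ⟶ Y) a, w X (R.res f a) = T.res f (w Y a) :=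
    fun {X Y} f a => by rw [← hwv X (T.res f _), v_res, hvw]
  have w_tr : ∀ {X Y : FinGSet G} (f : X ⟶ Y) a, w Y (R.tr f a) = T.tr f (w X a) :=
    fun {X Y} f a => by rw [← hwv Y (T.tr f _), v_tr, hvw]
  exact
  { nm := fun {X Y} f a => v Y (T.nm f (w X a))
    nm_id := fun X a => by rw [T.nm_id, hvw]
    nm_comp := fun f g a => by rw [hwv, T.nm_comp]
    res_nm := fun p q j i h a => by rw [← v_res, w_res, T.res_nm p q j i h]
    nm_tr := fun i j f g h H a => by rw [← v_tr, w_tr, w_res, T.nm_tr i j f g h H]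
    nm_fold := fun X a b => by
      have : w _ (R.pair a b) = T.pair (w X a) (w X b) :=
        SemiMackeyFunctor.eq_pair (by rw [← w_res, SemiMackeyFunctor.res_inl_pair])
          (by rw [← w_res, SemiMackeyFunctor.res_inr_pair])
      rw [this]
      exact (v_mul _ _).trans (by rw [hvw, hvw]) }

/-- The Tambara structure on a commutative Green functor isomorphic to a Tambara functor. -/
def ofIso {T : TambaraFunctor G} {R : CommGreenFunctor G}
    (e : (TambaraFunctor.forgetToGreen G).obj T ≅ R) : TambaraStructure R :=
  ofEquiv (T := T) (fun X => e.hom.app X) (fun X => e.inv.app X)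
    (fun _ a => CommGreenFunctor.congr_app e.inv_hom_id a)
    (fun _ a => CommGreenFunctor.congr_app e.hom_inv_id a)
    e.hom.app_res e.hom.app_tr e.hom.app_mul

theorem ofIso_isTambaraMap {T : TambaraFunctor G} {R : CommGreenFunctor G}
    (e : (TambaraFunctor.forgetToGreen G).obj T ≅ R) : (ofIso e).IsTambaraMap e.hom := by
  intro X Y f a
  have hh : e.inv.app X (e.hom.app X a) = a := CommGreenFunctor.congr_app e.hom_inv_id a
  change _ = e.hom.app Y (T.nm f (e.inv.app X (e.hom.app X a)))
  rw [hh]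

/-- Each component of `e.hom` is surjective, so compatibility of `e.hom` with the norms prescribes
them on all of `R`. -/
theorem eq_ofIso {T : TambaraFunctor G} {R : CommGreenFunctor G}
    (e : (TambaraFunctor.forgetToGreen G).obj T ≅ R) (S : TambaraStructure R)
    (h : S.IsTambaraMap e.hom) : S = ofIso e := by
  ext X Y f a
  have hi : e.hom.app X (e.inv.app X a) = a := CommGreenFunctor.congr_app e.inv_hom_id a
  change _ = e.hom.app Y (T.nm f (e.inv.app X a))
  refine Eq.trans ?_ (h f (e.inv.app X a)).symm
  rw [hi]

/-- The isomorphism of Tambara functors underlying `ofIso`. -/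
def isoOfIso {T : TambaraFunctor G} {R : CommGreenFunctor G}
    (e : (TambaraFunctor.forgetToGreen G).obj T ≅ R) : T ≅ (ofIso e).toTambara where
  hom := (ofIso e).lift e.hom (ofIso_isTambaraMap e)
  inv :=
    { app := e.inv.app
      app_res := e.inv.app_res
      app_tr := e.inv.app_tr
      app_nm := fun f a => CommGreenFunctor.congr_app e.hom_inv_id (T.nm f _) }
  hom_inv_id := TambaraFunctor.hom_ext fun _ a => CommGreenFunctor.congr_app e.hom_inv_id a
  inv_hom_id := TambaraFunctor.hom_ext fun _ a => CommGreenFunctor.congr_app e.inv_hom_id a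

end TambaraStructure

/-! ### The coproduct of a nonempty family of Tambara functors -/

namespace TambaraCoproduct

variable {G : Type u} [Group G] {ι : Type u} (R : ι → TambaraFunctor G)

/-- Families of elements `m i ∈ R i (A)`, almost all of which are equal to `1`. -/
@[ext] structure Fam (A : FinGSet G) : Type u where
  val : ∀ i, (R i).obj A
  finite : {i | val i ≠ (R i).one A}.Finite

namespace Fam

variable {R}

/-- Restrictions preserve `1`, so no new index enters the finite support; the same holds for the
norms below. -/
def res {A B : FinGSet G} (f : A ⟶ B) (m : Fam R B) : Fam R A where
  val i := (R i).res f (m.val i)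
  finite := m.finite.subset fun i h h' => h (by rw [h', SemiTambaraFunctor.res_one])

def nm {A B : FinGSet G} (f : A ⟶ B) (m : Fam R A) : Fam R B where
  val i := (R i).nm f (m.val i)
  finite := m.finite.subset fun i h h' => h (by rw [h', SemiTambaraFunctor.nm_one])

noncomputable def pair {A B : FinGSet G} (m : Fam R A) (n : Fam R B) : Fam R (A.sum B) where
  val i := (R i).pair (m.val i) (n.val i)
  finite := (m.finite.union n.finite).subset fun i h => by
    by_contra h'
    simp only [Set.mem_union, Set.mem_ofPred_eq, not_or, not_not] at h'
    refine h ?_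
    rw [h'.1, h'.2]
    exact (SemiMackeyFunctor.eq_pair (SemiTambaraFunctor.res_one _)
      (SemiTambaraFunctor.res_one _)).symm

theorem res_res {A B C : FinGSet G} (f : A ⟶ B) (g : B ⟶ C) (m : Fam R C) :
    (m.res g).res f = m.res (f ≫ g) := Fam.ext (funext fun i => ((R i).res_comp _ _ _).symm)

theorem res_id {A : FinGSet G} (m : Fam R A) : m.res (𝟙 A) = m :=
  Fam.ext (funext fun i => (R i).res_id _ _)

theorem nm_nm {A B C : FinGSet G} (f : A ⟶ B) (g : B ⟶ C) (m : Fam R A) :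
    (m.nm f).nm g = m.nm (f ≫ g) := Fam.ext (funext fun i => ((R i).nm_comp _ _ _).symm)

theorem nm_id {A : FinGSet G} (m : Fam R A) : m.nm (𝟙 A) = m :=
  Fam.ext (funext fun i => (R i).nm_id _ _)

theorem res_nm {P X Y Z : FinGSet G} {p : P ⟶ X} {q : P ⟶ Y} {j : X ⟶ Z} {i : Y ⟶ Z}
    (h : IsPullback p q j i) (m : Fam R Y) : (m.nm i).res j = (m.res q).nm p :=
  Fam.ext (funext fun k => (R k).res_nm p q j i h _)

theorem res_inl_pair {A B : FinGSet G} (m : Fam R A) (n : Fam R B) :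
    (m.pair n).res (inl A B) = m :=
  Fam.ext (funext fun i => SemiMackeyFunctor.res_inl_pair (m.val i) (n.val i))

theorem res_inr_pair {A B : FinGSet G} (m : Fam R A) (n : Fam R B) :
    (m.pair n).res (inr A B) = n :=
  Fam.ext (funext fun i => SemiMackeyFunctor.res_inr_pair (m.val i) (n.val i))

theorem eq_pair_res {A B : FinGSet G} (m : Fam R (A.sum B)) :
    m = (m.res (inl A B)).pair (m.res (inr A B)) :=
  Fam.ext (funext fun _ => SemiMackeyFunctor.eq_pair rfl rfl)

end Fam

/-- `n` is obtained from `m` by transferring one of the factors along `u`, where the other factors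
of `m` are restricted from those of `n`. -/
def Link {A' A : FinGSet G} (v : A' ⟶ A) (m : Fam R A') (n : Fam R A) : Prop :=
  ∃ i, n.val i = (R i).tr v (m.val i) ∧ ∀ k ≠ i, m.val k = (R k).res v (n.val k)

variable {R}

/-- Base change for transfers in the distinguished factor, functoriality of restriction in the
others. This makes restriction well defined on classes. -/
theorem Link.res {P A A' B : FinGSet G} {p : P ⟶ B} {q : P ⟶ A'} {f : B ⟶ A} {v : A' ⟶ A}
    (h : IsPullback p q f v) {m : Fam R A'} {n : Fam R A} (H : Link R v m n) :
    Link R p (m.res q) (n.res f) := by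
  obtain ⟨i, h1, h2⟩ := H
  refine ⟨i, ?_, fun k hk => ?_⟩
  · change (R i).res f (n.val i) = (R i).tr p ((R i).res q (m.val i))
    rw [h1, (R i).res_tr p q f v h]
  · change (R k).res q (m.val k) = (R k).res p ((R k).res f (n.val k))
    rw [h2 k hk, ← (R k).res_comp, ← (R k).res_comp, h.w]

/-- In the distinguished factor this is the distributive law for the exponential diagram over `p`
and `g`; in the others it is base change for norms along the pullback square of that diagram. -/
theorem Link.nm {P A X X' B A' B' : FinGSet G} {f : A ⟶ X} {g : A ⟶ B} {v : X' ⟶ X} {p : P ⟶ A}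
    {q : P ⟶ X'} (hP : IsPullback p q f v) {f' : A' ⟶ P} {g' : A' ⟶ B'} {h' : B' ⟶ B}
    (H' : IsExp p g f' g' h') {m : Fam R X'} {n : Fam R X} (H : Link R v m n) :
    Link R h' ((m.res (f' ≫ q)).nm g') ((n.res f).nm g) := by
  obtain ⟨i, h1, h2⟩ := H.res hP
  refine ⟨i, ?_, fun k hk => ?_⟩
  · change (R i).nm g ((n.res f).val i) = (R i).tr h' ((R i).nm g' ((R i).res (f' ≫ q) (m.val i)))
    rw [h1, (R i).nm_tr _ _ _ _ _ H'.isExponential, (R i).res_comp]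
    rfl
  · change (R k).nm g' ((R k).res (f' ≫ q) (m.val k)) =
      (R k).res h' ((R k).nm g ((n.res f).val k))
    rw [(R k).res_nm _ _ _ _ H'.isPullback, (R k).res_comp, (R k).res_comp, ← h2 k hk]
    rfl

theorem Link.pair_left {A' A B : FinGSet G} {v : A' ⟶ A} {m : Fam R A'} {n : Fam R A}
    (H : Link R v m n) (l : Fam R B) : Link R (sumMap v (𝟙 B)) (m.pair l) (n.pair l) := by
  obtain ⟨i, h1, h2⟩ := H
  refine ⟨i, ?_, fun k hk => ?_⟩
  · change (R i).pair _ _ = (R i).tr _ ((R i).pair _ _)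
    rw [SemiMackeyFunctor.tr_sumMap_pair, (R i).tr_id, h1]
  · change (R k).pair _ _ = (R k).res _ ((R k).pair _ _)
    rw [SemiMackeyFunctor.res_pair, (R k).res_id, h2 k hk]

theorem Link.pair_right {A' A B : FinGSet G} {v : A' ⟶ A} {m : Fam R A'} {n : Fam R A}
    (H : Link R v m n) (l : Fam R B) : Link R (sumMap (𝟙 B) v) (l.pair m) (l.pair n) := by
  obtain ⟨i, h1, h2⟩ := H
  refine ⟨i, ?_, fun k hk => ?_⟩
  · change (R i).pair _ _ = (R i).tr _ ((R i).pair _ _)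
    rw [SemiMackeyFunctor.tr_sumMap_pair, (R i).tr_id, h1]
  · change (R k).pair _ _ = (R k).res _ ((R k).pair _ _)
    rw [SemiMackeyFunctor.res_pair, (R k).res_id, h2 k hk]

/-- Isomorphic representatives need no relation of their own, since the transfer along an
isomorphism inverts the restriction. Some distinguished index must be chosen, so the family has to
be nonempty. -/
theorem Link.of_iso [Nonempty ι] {A' A : FinGSet G} (e : A' ≅ A) (n : Fam R A) :
    Link R e.hom (n.res e.hom) n :=
  ⟨Classical.arbitrary ι, (SemiMackeyFunctor.tr_inv_res e _).symm, fun _ _ => rfl⟩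

variable (R)

/-- Formal transfers along `A → X` of formal products of elements of the `R i (A)`. -/
structure Pre (X : FinGSet G) : Type (u + 1) where
  {src : FinGSet G}
  map : src ⟶ X
  fam : Fam R src

/-- Only generators are listed, since `Quot` passes to the generated equivalence relation. No
relation for sums appears, because addition is a transfer along a fold map. -/
inductive Rel (X : FinGSet G) : Pre R X → Pre R X → Prop
  | of {A' A : FinGSet G} (v : A' ⟶ A) (f : A ⟶ X) (m : Fam R A') (n : Fam R A) :
      Link R v m n → Rel X ⟨v ≫ f, m⟩ ⟨f, n⟩

theorem quot_iso [Nonempty ι] {X A A' : FinGSet G} (e : A' ≅ A) (f : A ⟶ X) (n : Fam R A) :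
    Quot.mk (Rel R X) ⟨e.hom ≫ f, n.res e.hom⟩ = Quot.mk (Rel R X) ⟨f, n⟩ :=
  Quot.sound (Rel.of e.hom f _ _ (Link.of_iso e n))

/-- The sources of formal transfers range over a large type, but every class has a representative
whose source is a standard finite `G`-set. -/
instance [Nonempty ι] (X : FinGSet G) : Small.{u} (Quot (Rel R X)) := by
  let F : (Σ s : StdGSet G, (s.toFinGSet ⟶ X) × Fam R s.toFinGSet) → Quot (Rel R X) :=
    fun a => Quot.mk _ ⟨a.2.1, a.2.2⟩
  refine small_of_surjective (f := F) ?_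
  rintro ⟨⟨f, m⟩⟩
  obtain ⟨s, ⟨e⟩⟩ := exists_stdGSet_iso (G := G) ‹_›
  exact ⟨⟨s, e.hom ≫ f, m.res e.hom⟩, quot_iso R e f m⟩

variable [Nonempty ι]

/-- The values of the coproduct. -/
def Obj (X : FinGSet G) : Type u := Shrink.{u} (Quot (Rel R X))

variable {R}

noncomputable def mk {A X : FinGSet G} (f : A ⟶ X) (m : Fam R A) : Obj R X :=
  equivShrink (Quot (Rel R X)) (Quot.mk _ ⟨f, m⟩)

theorem mk_link {A A' X : FinGSet G} {v : A' ⟶ A} (f : A ⟶ X) {m : Fam R A'} {n : Fam R A}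
    (h : Link R v m n) : mk (v ≫ f) m = mk f n :=
  congrArg _ (Quot.sound (Rel.of v f m n h))

theorem mk_iso {A A' X : FinGSet G} (e : A' ≅ A) (f : A ⟶ X) (n : Fam R A) :
    mk (e.hom ≫ f) (n.res e.hom) = mk f n := mk_link f (Link.of_iso e n)

theorem ind {X : FinGSet G} {p : Obj R X → Prop}
    (h : ∀ (A : FinGSet G) (f : A ⟶ X) (m : Fam R A), p (mk f m)) (x : Obj R X) : p x := by
  obtain ⟨y, rfl⟩ := (equivShrink (Quot (Rel R X))).surjective x
  induction y using Quot.ind with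
  | _ y => exact h _ y.map y.fam

noncomputable def lift {X : FinGSet G} {T : Sort*} (F : ∀ {A : FinGSet G}, (A ⟶ X) → Fam R A → T)
    (hF : ∀ {A A' : FinGSet G} (v : A' ⟶ A) (f : A ⟶ X) (m : Fam R A') (n : Fam R A),
      Link R v m n → F (v ≫ f) m = F f n) (x : Obj R X) : T :=
  Quot.lift (fun y : Pre R X => F y.map y.fam)
    (by rintro _ _ ⟨v, f, m, n, h⟩; exact hF v f m n h) ((equivShrink _).symm x)

theorem mk_pullback {P P' X X' A : FinGSet G} {p : P ⟶ X'} {q : P ⟶ A} {p' : P' ⟶ X'} {q' : P' ⟶ A}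
    {g : X' ⟶ X} {f : A ⟶ X} (h : IsPullback p q g f) (h' : IsPullback p' q' g f) (m : Fam R A) :
    mk p (m.res q) = mk p' (m.res q') := by
  have := mk_iso (h.isoIsPullback _ _ h') p' (m.res q')
  rwa [Fam.res_res, h.isoIsPullback_hom_fst, h.isoIsPullback_hom_snd] at this

theorem mk_pullback_link {P P' X X' A A' : FinGSet G} {p : P ⟶ X'} {q : P ⟶ A} {p' : P' ⟶ X'}
    {q' : P' ⟶ A'} {g : X' ⟶ X} {f : A ⟶ X} {v : A' ⟶ A} (h : IsPullback p q g f)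
    (h' : IsPullback p' q' g (v ≫ f)) {m : Fam R A'} {n : Fam R A} (H : Link R v m n) :
    mk p' (m.res q') = mk p (n.res q) := by
  rw [mk_pullback h' ((isPullback_pb q v).paste_horiz h)]
  exact mk_link p (H.res (isPullback_pb q v))

/-- Restriction in the coproduct. -/
noncomputable def res {X' X : FinGSet G} (g : X' ⟶ X) (x : Obj R X) : Obj R X' :=
  lift (fun f m => mk (pbFst g f) (m.res (pbSnd g f)))
    (fun v f _ _ h => mk_pullback_link (isPullback_pb g f) (isPullback_pb g (v ≫ f)) h) x

theorem res_mk {P X' X A : FinGSet G} {p : P ⟶ X'} {q : P ⟶ A} {g : X' ⟶ X} {f : A ⟶ X}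
    (h : IsPullback p q g f) (m : Fam R A) : res g (mk f m) = mk p (m.res q) := by
  simp only [res, lift, mk, Equiv.symm_apply_apply]
  exact mk_pullback (isPullback_pb g f) h m

/-- Transfer in the coproduct. -/
noncomputable def tr {X X' : FinGSet G} (g : X ⟶ X') (x : Obj R X) : Obj R X' :=
  lift (fun f m => mk (f ≫ g) m)
    (fun v f m n h => by rw [Category.assoc]; exact mk_link (f ≫ g) h) x

theorem tr_mk {A X X' : FinGSet G} (g : X ⟶ X') (f : A ⟶ X) (m : Fam R A) :
    tr g (mk f m) = mk (f ≫ g) m := by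
  simp only [tr, lift, mk, Equiv.symm_apply_apply]
  rfl

/-- Both diagrams are compared with the standard one: `mk_iso` absorbs the isomorphism between the
`G`-sets of sections, and base change for norms absorbs the one between the fibre products. -/
theorem mk_isExp {A B A' B' X Y Z : FinGSet G} {i : X ⟶ Y} {j : Y ⟶ Z} {f : A ⟶ X} {g : A ⟶ B}
    {h : B ⟶ Z} {f' : A' ⟶ X} {g' : A' ⟶ B'} {h' : B' ⟶ Z} (H : IsExp i j f g h)
    (H' : IsExp i j f' g' h') (m : Fam R X) :
    mk h ((m.res f).nm g) = mk h' ((m.res f').nm g') := by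
  have key : ∀ {A B : FinGSet G} {f : A ⟶ X} {g : A ⟶ B} {h : B ⟶ Z}, IsExp i j f g h →
      mk h ((m.res f).nm g) =
        mk (depProdProj i j) ((m.res (depProdEval i j)).nm (depProdSnd i j)) := by
    intro A B f g h H
    obtain ⟨α, β, rfl, hg, rfl⟩ := H.isExponential
    have hp : IsPullback g α.hom β.hom (depProdSnd i j) :=
      IsPullback.flip (IsPullback.of_horiz_isIso ⟨hg.symm⟩)
    rw [← mk_iso β (depProdProj i j), Fam.res_nm hp, Fam.res_res]
  rw [key H, key H']

/-- Norm in the coproduct. -/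
noncomputable def nm {Y Z : FinGSet G} (j : Y ⟶ Z) (x : Obj R Y) : Obj R Z :=
  lift (fun i m => mk (depProdProj i j) ((m.res (depProdEval i j)).nm (depProdSnd i j)))
    (fun v i m n h => by
      -- The norm of the representative over `v ≫ i` is computed with a diagram built in two stages,
      -- by `IsExp.trans`; it is then linked to the norm of the other representative along the
      -- projection belonging to `H'`.
      have hP := isPullback_pb (depProdEval i j) v
      have H' := isExp_depProd (pbFst (depProdEval i j) v) (depProdSnd i j)
      rw [mk_isExp (isExp_depProd (v ≫ i) j) ((isExp_depProd i j).trans hP H')]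
      exact mk_link _ (h.nm hP H')) x

theorem nm_mk {A B X Y Z : FinGSet G} {i : X ⟶ Y} {j : Y ⟶ Z} {f : A ⟶ X} {g : A ⟶ B} {h : B ⟶ Z}
    (H : IsExp i j f g h) (m : Fam R X) : nm j (mk i m) = mk h ((m.res f).nm g) := by
  simp only [nm, lift, mk, Equiv.symm_apply_apply]
  exact mk_isExp (isExp_depProd i j) H m

theorem res_id (X : FinGSet G) (x : Obj R X) : res (𝟙 X) x = x := by
  induction x using ind with | h A f m =>
  rw [res_mk (IsPullback.flip (IsPullback.of_horiz_isIso ⟨rfl⟩) : IsPullback f (𝟙 A) (𝟙 X) f),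
    Fam.res_id]

theorem res_comp {X Y Z : FinGSet G} (f : X ⟶ Y) (g : Y ⟶ Z) (x : Obj R Z) :
    res (f ≫ g) x = res f (res g x) := by
  induction x using ind with | h A k m =>
  have h1 := isPullback_pb g k
  have h2 := isPullback_pb f (pbFst g k)
  rw [res_mk h1, res_mk h2, Fam.res_res, res_mk (h2.paste_vert h1)]

theorem res_tr {P X Y Z : FinGSet G} (p : P ⟶ X) (q : P ⟶ Y) (j : X ⟶ Z) (i : Y ⟶ Z)
    (h : IsPullback p q j i) (x : Obj R Y) : res j (tr i x) = tr p (res q x) := by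
  induction x using ind with | h A k m =>
  have h2 := isPullback_pb q k
  rw [tr_mk, res_mk h2, tr_mk, res_mk (h2.paste_horiz h)]

noncomputable def pair {X Y : FinGSet G} (x : Obj R X) (y : Obj R Y) : Obj R (X.sum Y) :=
  lift (fun f m => lift (fun g n => mk (sumMap f g) (m.pair n))
    (fun v g n n' h => by
      have : sumMap f (v ≫ g) = sumMap (𝟙 _) v ≫ sumMap f g := sum_hom_ext rfl rfl
      rw [this]
      exact mk_link _ (h.pair_right m)) y)
    (fun v f m m' h => by
      induction y using ind with | h B g n =>
      simp only [lift, mk, Equiv.symm_apply_apply]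
      have : sumMap (v ≫ f) g = sumMap v (𝟙 _) ≫ sumMap f g := sum_hom_ext rfl rfl
      rw [this]
      exact mk_link _ (h.pair_left n)) x

theorem pair_mk {A B X Y : FinGSet G} (f : A ⟶ X) (g : B ⟶ Y) (m : Fam R A) (n : Fam R B) :
    pair (mk f m) (mk g n) = mk (sumMap f g) (m.pair n) := by
  simp only [pair, lift, mk, Equiv.symm_apply_apply]
  rfl

end TambaraCoproduct

/-! ### Finite `G`-sets over a disjoint union -/

namespace FinGSet

variable {G : Type u} [Group G]

theorem isPullback_inl {A B X Y : FinGSet G} (f : A ⟶ X) (g : B ⟶ Y) :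
    IsPullback f (inl A B) (inl X Y) (sumMap f g) := by
  refine isPullback_of_elements (fun _ => rfl) ?_ (fun a b _ h => Sum.inl_injective h)
  rintro x (y | y) h
  · exact ⟨y, (Sum.inl_injective h).symm, rfl⟩
  · exact absurd h Sum.inl_ne_inr

theorem isPullback_inr {A B X Y : FinGSet G} (f : A ⟶ X) (g : B ⟶ Y) :
    IsPullback g (inr A B) (inr X Y) (sumMap f g) := by
  refine isPullback_of_elements (fun _ => rfl) ?_ (fun a b _ h => Sum.inr_injective h)
  rintro x (y | y) h
  · exact absurd h Sum.inr_ne_inl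
  · exact ⟨y, (Sum.inr_injective h).symm, rfl⟩

/-- Every `G`-set over a disjoint union decomposes. -/
theorem exists_iso_sumMap {A X Y : FinGSet G} (f : A ⟶ X.sum Y) :
    ∃ (B C : FinGSet G) (b : B ⟶ X) (c : C ⟶ Y) (e : B.sum C ≅ A), e.hom ≫ f = sumMap b c := by
  have h1 := isPullback_pb (inl X Y) f
  have h2 := isPullback_pb (inr X Y) f
  refine ⟨_, _, pbFst (inl X Y) f, pbFst (inr X Y) f,
    isoOfBijective (sumDesc (pbSnd (inl X Y) f) (pbSnd (inr X Y) f)) ⟨?_, fun a => ?_⟩,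
    sum_hom_ext h1.w.symm h2.w.symm⟩
  · rintro (a | a) (b | b) h
    · refine congrArg Sum.inl (pullback_ext h1 (Sum.inl_injective (β := Y) ?_) h)
      exact (pullback_w h1 a).trans ((congrArg f h).trans (pullback_w h1 b).symm)
    · exact absurd ((pullback_w h1 a).trans ((congrArg f h).trans (pullback_w h2 b).symm))
        Sum.inl_ne_inr
    · exact absurd ((pullback_w h2 a).trans ((congrArg f h).trans (pullback_w h1 b).symm))
        Sum.inr_ne_inl
    · refine congrArg Sum.inr (pullback_ext h2 (Sum.inr_injective (α := X) ?_) h)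
      exact (pullback_w h2 a).trans ((congrArg f h).trans (pullback_w h2 b).symm)
  · rcases hx : f a with x | y
    · obtain ⟨b, -, hb⟩ := pullback_exists h1 (x := x) (y := a) hx.symm
      exact ⟨Sum.inl b, hb⟩
    · obtain ⟨b, -, hb⟩ := pullback_exists h2 (x := y) (y := a) hx.symm
      exact ⟨Sum.inr b, hb⟩

end FinGSet

/-! ### The semi-Mackey structure of the coproduct -/

namespace TambaraCoproduct

variable {G : Type u} [Group G] {ι : Type u} {R : ι → TambaraFunctor G} [Nonempty ι]

theorem res_inl_pair {X Y : FinGSet G} (x : Obj R X) (y : Obj R Y) :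
    res (inl X Y) (pair x y) = x := by
  induction x using ind with | h A f m =>
  induction y using ind with | h B g n =>
  rw [pair_mk, res_mk (isPullback_inl f g), Fam.res_inl_pair]

theorem res_inr_pair {X Y : FinGSet G} (x : Obj R X) (y : Obj R Y) :
    res (inr X Y) (pair x y) = y := by
  induction x using ind with | h A f m =>
  induction y using ind with | h B g n =>
  rw [pair_mk, res_mk (isPullback_inr f g), Fam.res_inr_pair]

theorem pair_res {X Y : FinGSet G} (x : Obj R (X.sum Y)) :
    pair (res (inl X Y) x) (res (inr X Y) x) = x := by
  induction x using ind with | h A f m =>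
  obtain ⟨B, C, b, c, e, he⟩ := exists_iso_sumMap f
  rw [← mk_iso e, he, res_mk (isPullback_inl b c), res_mk (isPullback_inr b c), pair_mk,
    ← Fam.eq_pair_res]

/-- The underlying semi-Mackey functor of the coproduct. -/
noncomputable def toSemiMackey (R : ι → TambaraFunctor G) : SemiMackeyFunctor G where
  obj := Obj R
  nonempty X := ⟨mk (𝟙 X) ⟨fun i => (R i).one X, by simp⟩⟩
  res := res
  tr := tr
  res_id := res_id
  res_comp := res_comp
  tr_id X x := by
    induction x using ind with | h A f m =>
    rw [tr_mk, Category.comp_id]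
  tr_comp f g x := by
    induction x using ind with | h A k m =>
    rw [tr_mk, tr_mk, tr_mk, Category.assoc]
  bijective_res := SemiMackeyFunctor.bijective_res_of_sum res_id res_comp fun X Y =>
    ⟨fun x y h => by
      rw [← pair_res x, ← pair_res y, (Prod.mk.inj h).1, (Prod.mk.inj h).2],
    fun ⟨x, y⟩ => ⟨pair x y, Prod.ext (res_inl_pair x y) (res_inr_pair x y)⟩⟩
  res_tr := res_tr

theorem toSemiMackey_pair {X Y : FinGSet G} (x : Obj R X) (y : Obj R Y) :
    (toSemiMackey R).pair x y = pair x y :=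
  (SemiMackeyFunctor.eq_pair (M := toSemiMackey R) (res_inl_pair x y) (res_inr_pair x y)).symm

theorem toSemiMackey_add {A B X : FinGSet G} (f : A ⟶ X) (g : B ⟶ X) (m : Fam R A) (n : Fam R B) :
    (toSemiMackey R).add (mk f m) (mk g n) = mk (sumDesc f g) (m.pair n) := by
  refine (congrArg ((toSemiMackey R).tr (fold X)) ((toSemiMackey_pair (mk f m) (mk g n)).trans
    (pair_mk f g m n))).trans ((tr_mk _ _ _).trans ?_)
  congr 1
  exact sum_hom_ext rfl rfl

end TambaraCoproduct

namespace CommGreenFunctor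

variable {G : Type u} [Group G]

theorem frobenius_right {R : CommGreenFunctor G} {X Y : FinGSet G} (f : X ⟶ Y) (a : R.obj Y)
    (b : R.obj X) : R.tr f (R.mul (R.res f a) b) = R.mul a (R.tr f b) := by
  rw [R.mul_comm, R.frobenius, R.mul_comm]

/-- A map of Mackey functors between commutative Green functors is multiplicative if it is
multiplicative on elements whose transfers exhaust the source. -/
theorem map_mul_of_generators {P N : CommGreenFunctor G}
    (φ : SemiMackeyFunctor.Hom P.toSemiMackeyFunctor N.toSemiMackeyFunctor)
    (S : ∀ X, P.obj X → Prop) (hres : ∀ {X Y : FinGSet G} (f : X ⟶ Y) a, S Y a → S X (P.res f a))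
    (hgen : ∀ X (x : P.obj X), ∃ (A : FinGSet G) (f : A ⟶ X) (a : P.obj A), S A a ∧ x = P.tr f a)
    (hmul : ∀ X a b, S X a → S X b → φ.app X (P.mul a b) = N.mul (φ.app X a) (φ.app X b))
    {X : FinGSet G} (x y : P.obj X) : φ.app X (P.mul x y) = N.mul (φ.app X x) (φ.app X y) := by
  -- Frobenius reciprocity is applied once in each argument. The partner of a transferred generator
  -- gets restricted, which is why `S` must be stable under restriction.
  have h1 : ∀ {X : FinGSet G} (x y : P.obj X), S X x →
      φ.app X (P.mul x y) = N.mul (φ.app X x) (φ.app X y) := by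
    intro X x y hx
    obtain ⟨A, f, a, ha, rfl⟩ := hgen X y
    rw [← frobenius_right, φ.app_tr, hmul A _ _ (hres f x hx) ha, φ.app_res, φ.app_tr,
      frobenius_right]
  obtain ⟨A, f, a, ha, rfl⟩ := hgen X x
  rw [← P.frobenius, φ.app_tr, h1 _ _ ha, φ.app_res, φ.app_tr, N.frobenius]

end CommGreenFunctor

/-- Writing the omitted factor as `1` keeps the product over the whole index type, so that
`map_finprod` can be applied to what remains, as in `prodApp_link`. -/
theorem finprod_eq_mul_finprod_ite {α M : Type*} [CommMonoid M] (f : α → M)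
    (hf : (Function.mulSupport f).Finite) (i : α) [DecidableEq α] :
    ∏ᶠ k, f k = f i * ∏ᶠ k, if k = i then 1 else f k := by
  rw [← mul_finprod_cond_ne i hf]
  congr 1
  refine finprod_congr fun k => ?_
  by_cases h : k = i <;> simp [h]

/-! ### Products of families; norms and additive inverses in the coproduct -/

namespace TambaraCoproduct

variable {G : Type u} [Group G] {ι : Type u} {R : ι → TambaraFunctor G}

namespace Fam

open Classical in
/-- Replace one of the elements of a family. -/
noncomputable def update {A : FinGSet G} (m : Fam R A) (i : ι) (a : (R i).obj A) : Fam R A where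
  val := Function.update m.val i a
  finite := (m.finite.insert i).subset fun k hk => by
    by_cases h : k = i
    · exact Or.inl h
    · right
      simpa [Function.update_of_ne h] using hk

theorem update_self {A : FinGSet G} (m : Fam R A) (i : ι) (a : (R i).obj A) :
    (m.update i a).val i = a := by simp [update]

theorem update_ne {A : FinGSet G} (m : Fam R A) {i k : ι} (a : (R i).obj A) (h : k ≠ i) :
    (m.update i a).val k = m.val k := by simp [update, h]

/-- With the product spelled as a norm along the fold map, it is by definition the factorwise
product, and `ofFam_mul` follows from the formula for norms of product classes. -/
noncomputable instance {A : FinGSet G} : CommMonoid (Fam R A) where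
  mul m n := (m.pair n).nm (fold A)
  one := ⟨fun i => (R i).one A, by simp⟩
  mul_assoc a b c := Fam.ext (funext fun i =>
    SemiTambaraFunctor.mul_assoc (a.val i) (b.val i) (c.val i))
  mul_comm a b := Fam.ext (funext fun i => SemiTambaraFunctor.mul_comm (a.val i) (b.val i))
  one_mul a := Fam.ext (funext fun i => SemiTambaraFunctor.one_mul (a.val i))
  mul_one a := Fam.ext (funext fun i =>
    (SemiTambaraFunctor.mul_comm (a.val i) _).trans (SemiTambaraFunctor.one_mul (a.val i)))

theorem nm_one {A B : FinGSet G} (f : A ⟶ B) : (1 : Fam R A).nm f = 1 :=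
  Fam.ext (funext fun _ => SemiTambaraFunctor.nm_one f)

/-- Evaluation of families as a homomorphism. -/
def valHom (A : FinGSet G) (i : ι) : Fam R A →* (R i).toGreen.obj A where
  toFun m := m.val i
  map_one' := rfl
  map_mul' _ _ := rfl

/-- The family with a single element different from `1`. -/
noncomputable def single {A : FinGSet G} (i : ι) (a : (R i).obj A) : Fam R A :=
  (1 : Fam R A).update i a

theorem single_self {A : FinGSet G} (i : ι) (a : (R i).obj A) : (single i a).val i = a :=
  update_self _ _ _

theorem single_ne {A : FinGSet G} {i k : ι} (a : (R i).obj A) (h : k ≠ i) :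
    (single i a).val k = (R k).one A := update_ne _ _ h

theorem single_one {A : FinGSet G} (i : ι) : single i ((R i).one A) = 1 := by
  refine Fam.ext (funext fun k => ?_)
  by_cases h : k = i
  · subst h; rw [single_self]; rfl
  · rw [single_ne _ h]; rfl

theorem res_single {A B : FinGSet G} (f : A ⟶ B) (i : ι) (a : (R i).obj B) :
    (single i a).res f = single i ((R i).res f a) := by
  refine Fam.ext (funext fun k => ?_)
  change (R k).res f _ = _
  by_cases h : k = i
  · subst h; rw [single_self, single_self]
  · rw [single_ne _ h, single_ne _ h, SemiTambaraFunctor.res_one]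

theorem nm_single {A B : FinGSet G} (f : A ⟶ B) (i : ι) (a : (R i).obj A) :
    (single i a).nm f = single i ((R i).nm f a) := by
  refine Fam.ext (funext fun k => ?_)
  change (R k).nm f _ = _
  by_cases h : k = i
  · subst h; rw [single_self, single_self]
  · rw [single_ne _ h, single_ne _ h, SemiTambaraFunctor.nm_one]

theorem mulSupport_single {A : FinGSet G} (m : Fam R A) :
    (Function.mulSupport fun i => single i (m.val i)).Finite :=
  m.finite.subset fun i hi h => hi ((congrArg (single i) h).trans (single_one i))

theorem eq_finprod_single {A : FinGSet G} (m : Fam R A) : m = ∏ᶠ i, single i (m.val i) := by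
  refine Fam.ext (funext fun k => ?_)
  have h := (valHom A k).map_finprod (mulSupport_single m)
  refine Eq.trans ?_ h.symm
  rw [finprod_eq_single _ k]
  · exact (single_self k (m.val k)).symm
  · intro i hi
    exact single_ne _ hi.symm

end Fam

/-- All other factors are `1` on both sides and restriction preserves `1`. This is what makes the
inclusions into the coproduct commute with transfers. -/
theorem Link.single {A' A : FinGSet G} (v : A' ⟶ A) (i : ι) (a : (R i).obj A') :
    Link R v (Fam.single i a) (Fam.single i ((R i).tr v a)) :=
  ⟨i, by rw [Fam.single_self, Fam.single_self], fun k hk => by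
    rw [Fam.single_ne _ hk, Fam.single_ne _ hk, SemiTambaraFunctor.res_one]⟩

variable [Nonempty ι]

theorem nm_id (X : FinGSet G) (x : Obj R X) : nm (𝟙 X) x = x := by
  induction x using ind with | h A f m =>
  rw [nm_mk (IsExp.id_right f), Fam.res_id, Fam.nm_id]

theorem nm_comp {X Y Z : FinGSet G} (f : X ⟶ Y) (g : Y ⟶ Z) (x : Obj R X) :
    nm (f ≫ g) x = nm g (nm f x) := by
  induction x using ind with | h A i m =>
  have H := isExp_depProd i f
  have H' := isExp_depProd (depProdProj i f) g
  have hQ := isPullback_pb (depProdEval (depProdProj i f) g) (depProdSnd i f)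
  rw [nm_mk H, nm_mk H', nm_mk (H.comp H' hQ), Fam.res_nm hQ, Fam.res_res, Fam.nm_nm]

/-- An exponential diagram for `k` and `i` pulls back along `j` to one that computes the right-hand
side, so that only base change for norms of families is left. -/
theorem res_nm {P X Y Z : FinGSet G} (p : P ⟶ X) (q : P ⟶ Y) (j : X ⟶ Z) (i : Y ⟶ Z)
    (h : IsPullback p q j i) (x : Obj R Y) : res j (nm i x) = nm p (res q x) := by
  induction x using ind with | h A k m =>
  have H := isExp_depProd k i
  have hX := isPullback_pb q k
  have hB := isPullback_pb j (depProdProj k i)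
  have hA := isPullback_pb (pbSnd j (depProdProj k i)) (depProdSnd k i)
  have e1 : pbSnd (pbSnd j (depProdProj k i)) (depProdSnd k i) ≫ depProdEval k i ≫ k ≫ i =
      (pbFst (pbSnd j (depProdProj k i)) (depProdSnd k i) ≫ pbFst j (depProdProj k i)) ≫ j := by
    rw [Category.assoc, hB.w, hA.w_assoc]
    congr 1
    ext a
    exact H.comm a
  -- The evaluation edge of the pulled back diagram is constructed in two stages: first its
  -- composite `y` to `P`, then the lift `f'` to the fibre product of `q` and `k`.
  obtain ⟨y, hy1, hy2⟩ : ∃ y, y ≫ p = pbFst (pbSnd j (depProdProj k i)) (depProdSnd k i) ≫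
      pbFst j (depProdProj k i) ∧ y ≫ q =
        pbSnd (pbSnd j (depProdProj k i)) (depProdSnd k i) ≫ depProdEval k i ≫ k :=
    ⟨h.lift _ _ (by rw [← e1]; rfl), h.lift_fst _ _ _, h.lift_snd _ _ _⟩
  obtain ⟨f', hf1, hf2⟩ : ∃ f', f' ≫ pbFst q k = y ∧ f' ≫ pbSnd q k =
      pbSnd (pbSnd j (depProdProj k i)) (depProdSnd k i) ≫ depProdEval k i :=
    ⟨hX.lift _ _ hy2, hX.lift_fst _ _ _, hX.lift_snd _ _ _⟩
  have H' := H.baseChange h hX hB hA (f' := f') hf2 (by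
    rw [← Category.assoc, hf1, hy1])
  rw [nm_mk H, res_mk hX, nm_mk H', res_mk hB, Fam.res_nm hA, Fam.res_res, Fam.res_res, hf2]

/-- A transfer merely composes the structure map of a representative, so the distributive law is the
composition of exponential diagrams in the first variable. -/
theorem nm_tr {A B X Y Z : FinGSet G} (i : X ⟶ Y) (j : Y ⟶ Z) (f : A ⟶ X) (g : A ⟶ B) (h : B ⟶ Z)
    (H : IsExponential i j f g h) (x : Obj R X) : nm j (tr i x) = tr h (nm g (res f x)) := by
  induction x using ind with | h A k m =>
  have hP := isPullback_pb f k
  have H' := isExp_depProd (pbFst f k) g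
  rw [tr_mk, res_mk hP, nm_mk H', tr_mk, nm_mk ((isExponential_iff.mp H).trans hP H'), Fam.res_res]

/-- The underlying semi-Tambara functor of the coproduct. -/
noncomputable def toSemiTambara (R : ι → TambaraFunctor G) : SemiTambaraFunctor G where
  toSemiMackeyFunctor := toSemiMackey R
  nm := nm
  nm_id := nm_id
  nm_comp := nm_comp
  res_nm := res_nm
  nm_tr := nm_tr

theorem toSemiMackey_zero (X : FinGSet G) (l : Fam R (empty G)) :
    (toSemiMackey R).zero X = mk (fromEmpty X) l := by
  have h : Classical.choice ((toSemiMackey R).nonempty (empty G)) = mk (𝟙 _) l :=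
    SemiMackeyFunctor.subsingleton_empty (M := toSemiMackey R) _ _
  exact (congrArg ((toSemiMackey R).tr (fromEmpty X)) h).trans (tr_mk _ _ _)

/-- Negating one factor negates the product. The link `h1` along the fold map turns the sum into the
class with `i`-th factor zero, and the link `h2` from the empty `G`-set shows that this class is
zero. -/
theorem exists_neg (X : FinGSet G) (x : Obj R X) :
    ∃ y, (toSemiMackey R).add x y = (toSemiMackey R).zero X := by
  induction x using ind with | h A f m =>
  obtain ⟨i⟩ := ‹Nonempty ι›
  obtain ⟨b, hb⟩ := (R i).exists_neg A (m.val i)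
  refine ⟨mk f (m.update i b), ?_⟩
  have h1 : Link R (fold A) (m.pair (m.update i b)) (m.update i ((R i).zero A)) := by
    refine ⟨i, ?_, fun k hk => ?_⟩
    · rw [Fam.update_self, ← hb]
      change _ = (R i).tr (fold A) ((R i).pair (m.val i) ((m.update i b).val i))
      rw [Fam.update_self]
      rfl
    · rw [Fam.update_ne _ _ hk]
      refine (SemiMackeyFunctor.eq_pair ?_ ?_).symm
      · rw [← (R k).res_comp, fold, inl_desc, (R k).res_id]
      · rw [← (R k).res_comp, fold, inr_desc, (R k).res_id, Fam.update_ne _ _ hk]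
  have h2 : Link R (fromEmpty A) ((m.update i ((R i).zero A)).res (fromEmpty A))
      (m.update i ((R i).zero A)) := by
    refine ⟨i, ?_, fun k _ => rfl⟩
    rw [Fam.update_self]
    exact congrArg _ (SemiMackeyFunctor.subsingleton_empty _ _)
  rw [toSemiMackey_add, toSemiMackey_zero X ((m.update i ((R i).zero A)).res (fromEmpty A))]
  have e1 : sumDesc f f = fold A ≫ f := sum_hom_ext rfl rfl
  have e2 : fromEmpty X = fromEmpty A ≫ f := by ext x; exact isEmptyElim x
  rw [e1, mk_link f h1, e2, mk_link f h2]

end TambaraCoproduct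

/-! ### Universal properties of the coproduct -/

namespace TambaraFunctor

open TambaraCoproduct

variable {G : Type u} [Group G] {ι : Type u} [Nonempty ι] (R : ι → TambaraFunctor G)

/-- The map of commutative Green functors underlying a map of Tambara functors. -/
noncomputable def toGreenHom {T U : TambaraFunctor G} (φ : T ⟶ U) : T.toGreen ⟶ U.toGreen :=
  (forgetToGreen G).map φ

/-- The coproduct of a nonempty family of Tambara functors. -/
noncomputable def coprod : TambaraFunctor G where
  toSemiTambaraFunctor := toSemiTambara R
  exists_neg := TambaraCoproduct.exists_neg

namespace coprod

variable {R}

/-- The class of a formal product of elements `m i`. -/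
noncomputable def ofFam {A : FinGSet G} (m : Fam R A) : (coprod R).obj A :=
  TambaraCoproduct.mk (𝟙 A) m

theorem eq_tr_ofFam {X : FinGSet G} (x : (coprod R).obj X) :
    ∃ (A : FinGSet G) (f : A ⟶ X) (m : Fam R A), x = (coprod R).tr f (ofFam m) := by
  induction x using TambaraCoproduct.ind with | h A f m =>
  exact ⟨A, f, m, ((tr_mk f (𝟙 A) m).trans (by rw [Category.id_comp])).symm⟩

theorem res_ofFam {A B : FinGSet G} (f : A ⟶ B) (m : Fam R B) :
    (coprod R).res f (ofFam m) = ofFam (m.res f) :=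
  res_mk (IsPullback.of_horiz_isIso ⟨by simp⟩ : IsPullback (𝟙 A) f f (𝟙 B)) m

theorem nm_ofFam {A B : FinGSet G} (f : A ⟶ B) (m : Fam R A) :
    (coprod R).nm f (ofFam m) = ofFam (m.nm f) :=
  (nm_mk (IsExp.id_left f) m).trans (by rw [Fam.res_id]; rfl)

theorem nm_tr_ofFam {A B X Y Z : FinGSet G} {i : X ⟶ Y} {j : Y ⟶ Z} {f : A ⟶ X} {g : A ⟶ B}
    {h : B ⟶ Z} (H : IsExponential i j f g h) (m : Fam R X) :
    (coprod R).nm j ((coprod R).tr i (ofFam m)) = (coprod R).tr h (ofFam ((m.res f).nm g)) := by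
  rw [(coprod R).nm_tr i j f g h H, ← nm_ofFam, ← res_ofFam]

theorem tr_ofFam_of_link {A' A : FinGSet G} {v : A' ⟶ A} {m : Fam R A'} {n : Fam R A}
    (h : Link R v m n) : (coprod R).tr v (ofFam m) = ofFam n :=
  (tr_mk _ _ _).trans (mk_link (𝟙 A) h)

theorem ofFam_mul {A : FinGSet G} (m n : Fam R A) : ofFam (m * n) = (coprod R).mul (ofFam m) (ofFam n) := by
  have h : (coprod R).pair (ofFam m) (ofFam n) = ofFam (m.pair n) := by
    symm
    refine SemiMackeyFunctor.eq_pair ?_ ?_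
    · exact (res_ofFam _ _).trans (by rw [Fam.res_inl_pair])
    · exact (res_ofFam _ _).trans (by rw [Fam.res_inr_pair])
  exact (nm_ofFam (fold A) _).symm.trans (congrArg _ h.symm)

theorem ofFam_one {A : FinGSet G} : ofFam (1 : Fam R A) = (coprod R).one A := by
  have h : Classical.choice ((coprod R).nonempty (empty G)) = ofFam 1 :=
    SemiMackeyFunctor.subsingleton_empty _ _
  refine Eq.symm ((congrArg ((coprod R).nm (fromEmpty A)) h).trans ?_)
  rw [nm_ofFam, Fam.nm_one]

/-- `ofFam` as a homomorphism of monoids. -/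
noncomputable def ofFamHom (A : FinGSet G) : Fam R A →* (coprod R).toGreen.obj A where
  toFun := ofFam
  map_one' := ofFam_one
  map_mul' := ofFam_mul

/-- The inclusions into the coproduct. -/
noncomputable def incl (i : ι) : R i ⟶ coprod R where
  app X a := ofFam (Fam.single i a)
  app_res f a := by rw [← Fam.res_single, res_ofFam]
  app_tr f a := (tr_ofFam_of_link (Link.single f i a)).symm
  app_nm f a := by rw [← Fam.nm_single, nm_ofFam]

theorem ofFam_eq_finprod {A : FinGSet G} (m : Fam R A) :
    ofFam m = ∏ᶠ i, (show (coprod R).toGreen.obj A from (incl i).app A (m.val i)) := by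
  conv_lhs => rw [m.eq_finprod_single]
  exact (ofFamHom A).map_finprod m.mulSupport_single

section desc

variable {N : SemiMackeyFunctor G} (θ : ∀ A, Fam R A → N.obj A)
  (hres : ∀ {A B : FinGSet G} (f : A ⟶ B) m, θ A (m.res f) = N.res f (θ B m))
  (hlink : ∀ {A' A : FinGSet G} (v : A' ⟶ A) m n, Link R v m n → N.tr v (θ A' m) = θ A n)

/-- A map of semi-Mackey functors out of the coproduct. -/
noncomputable def descMackey : SemiMackeyFunctor.Hom (coprod R).toSemiMackeyFunctor N where
  app X x := lift (fun {A} f m => N.tr f (θ A m))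
    (fun v f m n h => by rw [N.tr_comp, hlink v m n h]) x
  app_res {X Y} f x := by
    induction x using TambaraCoproduct.ind with | h A k m =>
    have h := isPullback_pb f k
    refine (congrArg _ (res_mk h m)).trans ?_
    simp only [lift, TambaraCoproduct.mk, Equiv.symm_apply_apply]
    rw [hres, N.res_tr _ _ _ _ h]
  app_tr {X Y} f x := by
    induction x using TambaraCoproduct.ind with | h A k m =>
    refine (congrArg _ (tr_mk f k m)).trans ?_
    simp only [lift, TambaraCoproduct.mk, Equiv.symm_apply_apply]
    rw [N.tr_comp]

theorem descMackey_ofFam {A : FinGSet G} (m : Fam R A) :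
    (descMackey θ hres hlink).app A (ofFam m) = θ A m := by
  simp only [descMackey, ofFam, lift, TambaraCoproduct.mk, Equiv.symm_apply_apply]
  exact N.tr_id _ _

end desc

theorem mackeyHom_ext {N : SemiMackeyFunctor G}
    {φ ψ : SemiMackeyFunctor.Hom (coprod R).toSemiMackeyFunctor N}
    (h : ∀ A (m : Fam R A), φ.app A (ofFam m) = ψ.app A (ofFam m)) : φ = ψ := by
  refine SemiMackeyFunctor.Hom.ext (funext fun X => funext fun x => ?_)
  obtain ⟨A, f, m, rfl⟩ := eq_tr_ofFam x
  rw [φ.app_tr, ψ.app_tr]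
  exact congrArg _ (h A m)

section greenDesc

variable {Q : CommGreenFunctor G} (φ : ∀ i, (R i).toGreen ⟶ Q)

/-- The product of the images of a family of elements. -/
noncomputable def prodApp (A : FinGSet G) (m : Fam R A) : Q.obj A := ∏ᶠ i, (φ i).app A (m.val i)

theorem mulSupport_app {A : FinGSet G} (m : Fam R A) :
    (Function.mulSupport fun i => (φ i).app A (m.val i)).Finite :=
  m.finite.subset fun i hi h => hi ((congrArg ((φ i).app A) h).trans ((φ i).app_one A))

theorem prodApp_mul {A : FinGSet G} (m n : Fam R A) :
    prodApp φ A (m * n) = prodApp φ A m * prodApp φ A n := by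
  unfold prodApp
  rw [← finprod_mul_distrib (mulSupport_app φ m) (mulSupport_app φ n)]
  exact finprod_congr fun i => (φ i).app_mul (m.val i) (n.val i)

theorem prodApp_single {A : FinGSet G} (i : ι) (a : (R i).obj A) :
    prodApp φ A (Fam.single i a) = (φ i).app A a := by
  unfold prodApp
  rw [finprod_eq_single _ i]
  · rw [Fam.single_self]
  · intro k hk
    rw [Fam.single_ne _ hk]
    exact (φ k).app_one A

theorem prodApp_one {A : FinGSet G} : prodApp φ A 1 = 1 := by
  unfold prodApp
  exact (finprod_congr fun i => (φ i).app_one A).trans finprod_one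

theorem prodApp_res {A B : FinGSet G} (f : A ⟶ B) (m : Fam R B) :
    prodApp φ A (m.res f) = Q.res f (prodApp φ B m) := by
  refine Eq.trans ?_ ((Q.resHom f).map_finprod (mulSupport_app φ m)).symm
  exact finprod_congr fun i => (φ i).app_res f (m.val i)

/-- This is Frobenius reciprocity in `Q`: the distinguished factor is transferred, and the product
of the remaining ones is restricted along `v`. -/
theorem prodApp_link {A' A : FinGSet G} (v : A' ⟶ A) (m : Fam R A') (n : Fam R A)
    (h : Link R v m n) : Q.tr v (prodApp φ A' m) = prodApp φ A n := by
  classical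
  obtain ⟨i, h1, h2⟩ := h
  unfold prodApp
  rw [finprod_eq_mul_finprod_ite _ (mulSupport_app φ m) i,
    finprod_eq_mul_finprod_ite _ (mulSupport_app φ n) i, h1]
  have e : (φ i).app A ((R i).tr v (m.val i)) = Q.tr v ((φ i).app A' (m.val i)) :=
    (φ i).app_tr v (m.val i)
  rw [e]
  refine Eq.trans ?_ (Q.frobenius v _ _)
  congr 2
  refine Eq.trans ?_ ((Q.resHom v).map_finprod ?_).symm
  · refine finprod_congr fun k => ?_
    by_cases hk : k = i
    · simp [hk]
    · simp only [hk, if_false]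
      rw [h2 k hk]
      exact (φ k).app_res v (n.val k)
  · refine (mulSupport_app φ n).subset fun k hk => ?_
    by_cases hki : k = i
    · simp [hki] at hk
    · simpa [hki] using hk

/-- The map of commutative Green functors out of the coproduct. -/
noncomputable def descGreen : (coprod R).toGreen ⟶ Q where
  toHom := descMackey (prodApp φ) (prodApp_res φ) (prodApp_link φ)
  app_mul {X} a b := by
    refine CommGreenFunctor.map_mul_of_generators (P := (coprod R).toGreen) (N := Q) _
      (fun X x => ∃ m : Fam R X, x = ofFam m) ?_ ?_ ?_ a b
    · rintro X Y f _ ⟨m, rfl⟩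
      exact ⟨_, res_ofFam f m⟩
    · intro X x
      obtain ⟨A, f, m, h⟩ := eq_tr_ofFam x
      exact ⟨A, f, _, ⟨m, rfl⟩, h⟩
    · rintro X _ _ ⟨m, rfl⟩ ⟨n, rfl⟩
      have h := fun l : Fam R X => descMackey_ofFam _ (prodApp_res φ) (prodApp_link φ) l
      refine (congrArg _ (ofFam_mul m n).symm).trans ((h (m * n)).trans ?_)
      rw [prodApp_mul]
      exact (congrArg₂ Q.mul (h m) (h n)).symm
  app_one X := (congrArg _ ofFam_one.symm).trans
    ((descMackey_ofFam _ (prodApp_res φ) (prodApp_link φ) _).trans (prodApp_one φ))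

theorem descGreen_ofFam {A : FinGSet G} (m : Fam R A) :
    (descGreen φ).app A (ofFam m) = prodApp φ A m := descMackey_ofFam _ (prodApp_res φ) (prodApp_link φ) m

/-- The inclusions into the coproduct, as maps of commutative Green functors. -/
noncomputable def inclGreen (i : ι) : (R i).toGreen ⟶ (coprod R).toGreen :=
  toGreenHom (incl i)

theorem inclGreen_descGreen (i : ι) : inclGreen i ≫ descGreen φ = φ i :=
  CommGreenFunctor.hom_ext fun X a =>
    (descGreen_ofFam φ (Fam.single i a)).trans (prodApp_single φ i a)

/-- A product class is the product of the images of its factors under the inclusions, and every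
element of the coproduct is a transfer of a product class. -/
theorem greenHom_ext {ψ ψ' : (coprod R).toGreen ⟶ Q}
    (h : ∀ i, inclGreen i ≫ ψ = inclGreen i ≫ ψ') : ψ = ψ' := by
  have e : ∀ (χ : (coprod R).toGreen ⟶ Q) A (m : Fam R A), χ.app A (ofFam m) =
      ∏ᶠ i, (inclGreen i ≫ χ).app A (m.val i) := fun χ A m => by
    rw [ofFam_eq_finprod]
    refine (CommGreenFunctor.Hom.appHom χ A).map_finprod ?_
    exact mulSupport_app inclGreen m
  have : ψ.toHom = ψ'.toHom := mackeyHom_ext fun A m => by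
    rw [e, e]
    exact finprod_congr fun i => by rw [h]
  exact CommGreenFunctor.hom_ext fun X a =>
    congrFun (congrFun (congrArg SemiMackeyFunctor.Hom.app this) X) a

end greenDesc

theorem prodApp_nm {T : TambaraFunctor G} (φ : ∀ i, R i ⟶ T) {A B : FinGSet G} (f : A ⟶ B)
    (m : Fam R A) : prodApp (fun i => toGreenHom (φ i)) B (m.nm f) =
      T.nm f (prodApp (fun i => toGreenHom (φ i)) A m) := by
  refine Eq.trans ?_ ((T.nmHom f).map_finprod
    (mulSupport_app (fun i => toGreenHom (φ i)) m)).symm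
  exact finprod_congr fun i => (φ i).app_nm f (m.val i)

/-- The map of Tambara functors out of the coproduct. -/
noncomputable def desc {T : TambaraFunctor G} (φ : ∀ i, R i ⟶ T) : coprod R ⟶ T where
  toHom := (descGreen fun i => toGreenHom (φ i)).toHom
  app_nm {X Y} f x := by
    obtain ⟨A, k, m, rfl⟩ := eq_tr_ofFam x
    -- An element is a transfer of a product class, and the distributive law on both sides reduces
    -- its norm to norms of product classes, where `prodApp_nm` applies.
    have H := depProd_isExponential k f
    let ψ := descGreen fun i => toGreenHom (φ i)
    have h1 : ∀ {A B : FinGSet G} (l : A ⟶ B) (n : Fam R A),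
        ψ.app B ((coprod R).tr l (ofFam n)) =
          T.tr l (prodApp (fun i => toGreenHom (φ i)) A n) := fun l n =>
      (ψ.app_tr l _).trans (congrArg (T.tr l) (descGreen_ofFam _ n))
    rw [nm_tr_ofFam H]
    refine (h1 _ _).trans ?_
    rw [prodApp_nm, prodApp_res]
    refine Eq.trans ?_ (congrArg (T.nm f) (h1 k m)).symm
    exact (T.nm_tr _ _ _ _ _ H _).symm

end coprod

/-- The forgetful functor to commutative Green functors is faithful. -/
theorem toGreenHom_injective {T U : TambaraFunctor G} {φ ψ : T ⟶ U}
    (h : toGreenHom φ = toGreenHom ψ) : φ = ψ :=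
  hom_ext fun _ a => CommGreenFunctor.congr_app h a

/-- The coproduct of a nonempty family is a coproduct of Tambara functors. -/
noncomputable def coprodIsColimit : IsColimit (Cofan.mk (coprod R) coprod.incl) :=
  Cofan.IsColimit.mk _ (fun s => coprod.desc s.inj)
    (fun s i => toGreenHom_injective
      (coprod.inclGreen_descGreen (fun i => toGreenHom (s.inj i)) i))
    (fun s _ hm => toGreenHom_injective (coprod.greenHom_ext fun i =>
      (congrArg toGreenHom (hm i)).trans
        (coprod.inclGreen_descGreen (fun i => toGreenHom (s.inj i)) i).symm))

/-- The coproduct of a nonempty family is a coproduct of commutative Green functors. -/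
noncomputable def coprodGreenIsColimit : IsColimit
    (Cofan.mk (f := fun i => (R i).toGreen) (coprod R).toGreen fun i => coprod.inclGreen i) :=
  Cofan.IsColimit.mk _ (fun s => coprod.descGreen s.inj)
    (fun s i => coprod.inclGreen_descGreen s.inj i)
    (fun s _ hm => coprod.greenHom_ext fun i =>
      (hm i).trans (coprod.inclGreen_descGreen s.inj i).symm)

end TambaraFunctor

/-! ### Reflexive coequalizers of Tambara functors -/

namespace TambaraFunctor

variable {G : Type u} [Group G]

namespace ReflQuot

variable {W S : TambaraFunctor G} (d₀ d₁ : W ⟶ S)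

/-- Neither symmetry nor transitivity is needed: `Quot` generates the equivalence relation, and it
is enough that each operation preserves the generating pairs. -/
def Rel (X : FinGSet G) (a b : S.obj X) : Prop := ∃ w, d₀.app X w = a ∧ d₁.app X w = b

/-- The levelwise quotient. -/
def Obj (X : FinGSet G) : Type u := Quot (Rel d₀ d₁ X)

variable {d₀ d₁}

def mk {X : FinGSet G} (a : S.obj X) : Obj d₀ d₁ X := Quot.mk _ a

theorem mk_surjective {X : FinGSet G} (x : Obj d₀ d₁ X) : ∃ a, x = mk a := by
  obtain ⟨a, rfl⟩ := Quot.exists_rep x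
  exact ⟨a, rfl⟩

def res {X Y : FinGSet G} (f : X ⟶ Y) : Obj d₀ d₁ Y → Obj d₀ d₁ X :=
  Quot.map (S.res f) fun _ _ ⟨w, h0, h1⟩ =>
    ⟨W.res f w, by rw [d₀.app_res, h0], by rw [d₁.app_res, h1]⟩

def tr {X Y : FinGSet G} (f : X ⟶ Y) : Obj d₀ d₁ X → Obj d₀ d₁ Y :=
  Quot.map (S.tr f) fun _ _ ⟨w, h0, h1⟩ =>
    ⟨W.tr f w, by rw [d₀.app_tr, h0], by rw [d₁.app_tr, h1]⟩

def nm {X Y : FinGSet G} (f : X ⟶ Y) : Obj d₀ d₁ X → Obj d₀ d₁ Y :=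
  Quot.map (S.nm f) fun _ _ ⟨w, h0, h1⟩ =>
    ⟨W.nm f w, by rw [d₀.app_nm, h0], by rw [d₁.app_nm, h1]⟩

theorem res_mk {X Y : FinGSet G} (f : X ⟶ Y) (a : S.obj Y) :
    res f (mk a : Obj d₀ d₁ Y) = mk (S.res f a) := rfl

theorem tr_mk {X Y : FinGSet G} (f : X ⟶ Y) (a : S.obj X) :
    tr f (mk a : Obj d₀ d₁ X) = mk (S.tr f a) := rfl

theorem nm_mk {X Y : FinGSet G} (f : X ⟶ Y) (a : S.obj X) :
    nm f (mk a : Obj d₀ d₁ X) = mk (S.nm f a) := rfl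

theorem res_id (X : FinGSet G) (x : Obj d₀ d₁ X) : res (𝟙 X) x = x := by
  obtain ⟨a, rfl⟩ := mk_surjective x
  rw [res_mk, S.res_id]

theorem res_comp {X Y Z : FinGSet G} (f : X ⟶ Y) (g : Y ⟶ Z) (x : Obj d₀ d₁ Z) :
    res (f ≫ g) x = res f (res g x) := by
  obtain ⟨a, rfl⟩ := mk_surjective x
  rw [res_mk, res_mk, res_mk, S.res_comp]

variable {s : S ⟶ W} (h₀ : ∀ X a, d₀.app X (s.app X a) = a) (h₁ : ∀ X a, d₁.app X (s.app X a) = a)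

/-- Reflexivity enters here. Varying one argument at a time, the fixed one is lifted to `W` by the
section, so that both entries come from one element of `W`. -/
noncomputable def pair {X Y : FinGSet G} : Obj d₀ d₁ X → Obj d₀ d₁ Y → Obj d₀ d₁ (X.sum Y) :=
  Quot.map₂ S.pair
    (fun a _ _ ⟨w, h, h'⟩ => ⟨W.pair (s.app X a) w, by rw [d₀.app_pair, h₀, h],
      by rw [d₁.app_pair, h₁, h']⟩)
    (fun _ _ b ⟨w, h, h'⟩ => ⟨W.pair w (s.app Y b), by rw [d₀.app_pair, h₀, h],
      by rw [d₁.app_pair, h₁, h']⟩)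

theorem bijective_res (h₀ : ∀ X a, d₀.app X (s.app X a) = a)
    (h₁ : ∀ X a, d₁.app X (s.app X a) = a) (X Y : FinGSet G) : Function.Bijective
    (fun a : Obj d₀ d₁ (X.sum Y) => (res (inl X Y) a, res (inr X Y) a)) := by
  have h : ∀ x : Obj d₀ d₁ (X.sum Y), pair h₀ h₁ (res (inl X Y) x) (res (inr X Y) x) = x := by
    intro x
    obtain ⟨a, rfl⟩ := mk_surjective x
    exact congrArg mk (SemiMackeyFunctor.eq_pair rfl rfl).symm
  refine ⟨fun x y hxy => ?_, fun ⟨x, y⟩ => ?_⟩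
  · rw [← h x, ← h y, (Prod.mk.inj hxy).1, (Prod.mk.inj hxy).2]
  · obtain ⟨a, rfl⟩ := mk_surjective x
    obtain ⟨b, rfl⟩ := mk_surjective y
    exact ⟨mk (S.pair a b), Prod.ext (congrArg mk (SemiMackeyFunctor.res_inl_pair a b))
      (congrArg mk (SemiMackeyFunctor.res_inr_pair a b))⟩

noncomputable def toSemiMackey : SemiMackeyFunctor G where
  obj := Obj d₀ d₁
  nonempty X := (S.nonempty X).map mk
  res := res
  tr := tr
  res_id := res_id
  res_comp := res_comp
  tr_id X x := by
    obtain ⟨a, rfl⟩ := mk_surjective x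
    rw [tr_mk, S.tr_id]
  tr_comp f g x := by
    obtain ⟨a, rfl⟩ := mk_surjective x
    rw [tr_mk, tr_mk, tr_mk, S.tr_comp]
  bijective_res := SemiMackeyFunctor.bijective_res_of_sum res_id res_comp (bijective_res h₀ h₁)
  res_tr p q j i h x := by
    obtain ⟨a, rfl⟩ := mk_surjective x
    rw [tr_mk, res_mk, S.res_tr p q j i h, res_mk, tr_mk]

/-- The projection to the quotient. -/
noncomputable def projMackey :
    SemiMackeyFunctor.Hom S.toSemiMackeyFunctor (toSemiMackey h₀ h₁) where
  app _ := mk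
  app_res _ _ := rfl
  app_tr _ _ := rfl

end ReflQuot

section

variable {W S : TambaraFunctor G} {d₀ d₁ : W ⟶ S} {s : S ⟶ W}
  (h₀ : ∀ X a, d₀.app X (s.app X a) = a) (h₁ : ∀ X a, d₁.app X (s.app X a) = a)

open ReflQuot in
/-- The coequalizer of a reflexive pair of maps of Tambara functors. -/
noncomputable def reflQuot : TambaraFunctor G where
  toSemiMackeyFunctor := toSemiMackey h₀ h₁
  nm := nm
  nm_id X x := by
    obtain ⟨a, rfl⟩ := mk_surjective x
    rw [nm_mk, S.nm_id]
  nm_comp f g x := by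
    obtain ⟨a, rfl⟩ := mk_surjective x
    rw [nm_mk, nm_mk, nm_mk, S.nm_comp]
  res_nm p q j i h x := by
    obtain ⟨a, rfl⟩ := mk_surjective x
    exact congrArg ReflQuot.mk (S.res_nm p q j i h a)
  nm_tr i j f g h H x := by
    obtain ⟨a, rfl⟩ := mk_surjective x
    exact congrArg ReflQuot.mk (S.nm_tr i j f g h H a)
  exists_neg X x := by
    obtain ⟨a, rfl⟩ := mk_surjective x
    obtain ⟨b, hb⟩ := S.exists_neg X a
    exact ⟨ReflQuot.mk b, ((projMackey h₀ h₁).app_add a b).symm.trans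
      ((congrArg ((projMackey h₀ h₁).app X) hb).trans ((projMackey h₀ h₁).app_zero X))⟩

namespace reflQuot

/-- The projection to the coequalizer. -/
noncomputable def proj : S ⟶ reflQuot h₀ h₁ where
  toHom := ReflQuot.projMackey h₀ h₁
  app_nm _ _ := rfl

theorem proj_surjective {X : FinGSet G} (x : (reflQuot h₀ h₁).obj X) :
    ∃ a, x = (proj h₀ h₁).app X a := ReflQuot.mk_surjective x

theorem proj_eq {X : FinGSet G} (w : W.obj X) :
    (proj h₀ h₁).app X (d₀.app X w) = (proj h₀ h₁).app X (d₁.app X w) :=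
  Quot.sound ⟨w, rfl, rfl⟩

/-- Maps of semi-Mackey functors descend to the quotient. -/
noncomputable def descMackey {N : SemiMackeyFunctor G}
    (φ : SemiMackeyFunctor.Hom S.toSemiMackeyFunctor N)
    (hφ : ∀ X w, φ.app X (d₀.app X w) = φ.app X (d₁.app X w)) :
    SemiMackeyFunctor.Hom (reflQuot h₀ h₁).toSemiMackeyFunctor N where
  app X := Quot.lift (φ.app X) (by rintro _ _ ⟨w, rfl, rfl⟩; exact hφ X w)
  app_res f x := by
    obtain ⟨a, rfl⟩ := ReflQuot.mk_surjective x
    exact φ.app_res f a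
  app_tr f x := by
    obtain ⟨a, rfl⟩ := ReflQuot.mk_surjective x
    exact φ.app_tr f a

/-- Maps of commutative Green functors descend to the quotient. -/
noncomputable def descGreen {Q : CommGreenFunctor G} (φ : S.toGreen ⟶ Q)
    (hφ : ∀ X w, φ.app X (d₀.app X w) = φ.app X (d₁.app X w)) :
    (reflQuot h₀ h₁).toGreen ⟶ Q where
  toHom := descMackey h₀ h₁ φ.toHom hφ
  app_mul a b := by
    obtain ⟨a, rfl⟩ := proj_surjective h₀ h₁ a
    obtain ⟨b, rfl⟩ := proj_surjective h₀ h₁ b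
    exact (congrArg _ ((toGreenHom (proj h₀ h₁)).app_mul a b).symm).trans (φ.app_mul a b)
  app_one X := (congrArg _ ((toGreenHom (proj h₀ h₁)).app_one X).symm).trans (φ.app_one X)

theorem greenHom_ext {Q : CommGreenFunctor G} {φ ψ : (reflQuot h₀ h₁).toGreen ⟶ Q}
    (h : toGreenHom (proj h₀ h₁) ≫ φ = toGreenHom (proj h₀ h₁) ≫ ψ) : φ = ψ :=
  CommGreenFunctor.hom_ext fun X x => by
    obtain ⟨a, rfl⟩ := proj_surjective h₀ h₁ x
    exact CommGreenFunctor.congr_app h a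

theorem mackeyHom_ext {N : SemiMackeyFunctor G}
    {φ ψ : SemiMackeyFunctor.Hom (reflQuot h₀ h₁).toSemiMackeyFunctor N}
    (h : ∀ X a, φ.app X ((proj h₀ h₁).app X a) = ψ.app X ((proj h₀ h₁).app X a)) : φ = ψ := by
  refine SemiMackeyFunctor.Hom.ext (funext fun X => funext fun x => ?_)
  obtain ⟨a, rfl⟩ := proj_surjective h₀ h₁ x
  exact h X a

/-- Maps of Tambara functors descend to the quotient. -/
noncomputable def desc {T : TambaraFunctor G} (φ : S ⟶ T) (hφ : d₀ ≫ φ = d₁ ≫ φ) :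
    reflQuot h₀ h₁ ⟶ T where
  toHom := descMackey h₀ h₁ φ.toHom fun _ w => congr_app hφ w
  app_nm f x := by
    obtain ⟨a, rfl⟩ := proj_surjective h₀ h₁ x
    exact φ.app_nm f a

end reflQuot

end

/-! ### Coequalizers of Tambara functors -/

section

variable {R S : TambaraFunctor G}

/-- The two-element family. -/
def two (R S : TambaraFunctor G) (b : ULift.{u} Bool) : TambaraFunctor G :=
  match b with
  | ⟨true⟩ => R
  | ⟨false⟩ => S

/-- Maps out of the two members of a family. -/
def twoHom {C : Type*} [Category C] {F : TambaraFunctor G → C} {Q : C} (f : F R ⟶ Q)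
    (g : F S ⟶ Q) : ∀ b, F (two R S b) ⟶ Q
  | ⟨true⟩ => f
  | ⟨false⟩ => g

/-- The pair of maps `R ⊔ S ⟶ S` with components `f` and the identity. -/
noncomputable def extend (f : R ⟶ S) : coprod (two R S) ⟶ S :=
  coprod.desc (twoHom (F := fun T => T) f (𝟙 S))

/-- The common section. -/
noncomputable def extendSection (R S : TambaraFunctor G) : S ⟶ coprod (two R S) :=
  coprod.incl (R := two R S) ⟨false⟩

theorem incl_desc {ι : Type u} [Nonempty ι] {R : ι → TambaraFunctor G} {T : TambaraFunctor G}
    (φ : ∀ i, R i ⟶ T) (i : ι) : coprod.incl i ≫ coprod.desc φ = φ i :=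
  toGreenHom_injective (coprod.inclGreen_descGreen (fun i => toGreenHom (φ i)) i)

theorem extend_section (f : R ⟶ S) (X : FinGSet G) (a : S.obj X) :
    (extend f).app X ((extendSection R S).app X a) = a :=
  congr_app (incl_desc (twoHom (F := fun T => T) f (𝟙 S)) ⟨false⟩) a

theorem extend_incl (f : R ⟶ S) {X : FinGSet G} (a : R.obj X) :
    (extend f).app X ((coprod.incl (R := two R S) ⟨true⟩).app X a) = f.app X a :=
  congr_app (incl_desc (twoHom (F := fun T => T) f (𝟙 S)) ⟨true⟩) a

/-- The coequalizer of two maps of Tambara functors. -/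
noncomputable def coeq (f g : R ⟶ S) : TambaraFunctor G :=
  reflQuot (d₀ := extend f) (d₁ := extend g) (extend_section f) (extend_section g)

/-- The projection to the coequalizer. -/
noncomputable def coeqProj (f g : R ⟶ S) : S ⟶ coeq f g := reflQuot.proj _ _

theorem coeq_condition (f g : R ⟶ S) : f ≫ coeqProj f g = g ≫ coeqProj f g := by
  refine hom_ext fun X a => ?_
  rw [comp_app, comp_app, ← extend_incl f, ← extend_incl g]
  exact reflQuot.proj_eq _ _ _

/-- On the summand `S` both extensions are the identity, so the reflexive pair is coequalized by the
same maps as `f` and `g`. The comparison takes place among Green functors because the coproduct is a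
coproduct there too. -/
theorem extend_green_eq {f g : R ⟶ S} {Q : CommGreenFunctor G} (φ : S.toGreen ⟶ Q)
    (h : toGreenHom f ≫ φ = toGreenHom g ≫ φ) :
    toGreenHom (extend f) ≫ φ = toGreenHom (extend g) ≫ φ := by
  refine coprod.greenHom_ext ?_
  rintro ⟨_ | _⟩
  · refine CommGreenFunctor.hom_ext fun X a => congrArg (φ.app X) ?_
    exact (extend_section f X a).trans (extend_section g X a).symm
  · refine CommGreenFunctor.hom_ext fun X a => ?_
    refine (congrArg (φ.app X) (extend_incl f a)).trans ?_
    refine (CommGreenFunctor.congr_app h a).trans ?_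
    exact (congrArg (φ.app X) (extend_incl g a)).symm

theorem extend_eq {f g : R ⟶ S} {T : TambaraFunctor G} (φ : S ⟶ T) (h : f ≫ φ = g ≫ φ) :
    extend f ≫ φ = extend g ≫ φ :=
  toGreenHom_injective (extend_green_eq (toGreenHom φ) (congrArg toGreenHom h))

/-- The coequalizer of Tambara functors. -/
noncomputable def coeqIsColimit (f g : R ⟶ S) :
    IsColimit (Cofork.ofπ (coeqProj f g) (coeq_condition f g)) :=
  Cofork.IsColimit.mk _ (fun s => reflQuot.desc _ _ s.π (extend_eq s.π s.condition))
    (fun _ => rfl)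
    (fun _ _ hm => toGreenHom_injective (reflQuot.greenHom_ext _ _
      (congrArg toGreenHom hm)))

theorem coeq_condition_green (f g : R ⟶ S) :
    toGreenHom f ≫ toGreenHom (coeqProj f g) = toGreenHom g ≫ toGreenHom (coeqProj f g) :=
  congrArg toGreenHom (coeq_condition f g)

/-- The coequalizer of Tambara functors is a coequalizer of commutative Green functors. -/
noncomputable def coeqGreenIsColimit (f g : R ⟶ S) :
    IsColimit (Cofork.ofπ (toGreenHom (coeqProj f g)) (coeq_condition_green f g)) :=
  Cofork.IsColimit.mk _
    (fun s => reflQuot.descGreen _ _ s.π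
      fun _ w => CommGreenFunctor.congr_app (extend_green_eq s.π s.condition) w)
    (fun _ => rfl)
    (fun _ _ hm => reflQuot.greenHom_ext _ _ hm)

end

end TambaraFunctor

/-! ### Lifting properties of finite `G`-sets -/

namespace FinGSet

variable {G : Type u} [Group G]

noncomputable instance (X Y : FinGSet G) : Fintype (X ⟶ Y) :=
  have : Finite (X ⟶ Y) :=
    Finite.of_injective (fun (f : X ⟶ Y) (x : X) => f x) fun _ _ h => hom_ext (congrFun h)
  Fintype.ofFinite _

/-- The lifts of `w : W ⟶ Y` along `f : X ⟶ Y`. -/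
abbrev Lifts {X Y W : FinGSet G} (f : X ⟶ Y) (w : W ⟶ Y) : Type u := {l : W ⟶ X // l ≫ f = w}

noncomputable instance {X Y W : FinGSet G} (f : X ⟶ Y) (w : W ⟶ Y) : Fintype (Lifts f w) :=
  Fintype.ofFinite _

theorem isPullback_sum {W W' X Y P P' : FinGSet G} {g : X ⟶ Y} {w : W ⟶ Y} {w' : W' ⟶ Y}
    {p : P ⟶ W} {q : P ⟶ X} {p' : P' ⟶ W'} {q' : P' ⟶ X} (h : IsPullback p q w g)
    (h' : IsPullback p' q' w' g) :
    IsPullback (sumMap p p') (sumDesc q q') (sumDesc w w') g := by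
  refine isPullback_of_elements ?_ ?_ ?_
  · rintro (a | a)
    · exact pullback_w h a
    · exact pullback_w h' a
  · rintro (a | a) x hx
    · obtain ⟨b, rfl, rfl⟩ := pullback_exists h hx
      exact ⟨Sum.inl b, rfl, rfl⟩
    · obtain ⟨b, rfl, rfl⟩ := pullback_exists h' hx
      exact ⟨Sum.inr b, rfl, rfl⟩
  · rintro (a | a) (b | b) h1 h2
    · exact congrArg Sum.inl (pullback_ext h (Sum.inl_injective h1) h2)
    · exact absurd h1 Sum.inl_ne_inr
    · exact absurd h1 Sum.inr_ne_inl
    · exact congrArg Sum.inr (pullback_ext h' (Sum.inr_injective h1) h2)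

/-- The bijection between lifts to the `G`-set of sections and partial sections. -/
noncomputable def IsExp.liftMap {A B X Y Z W : FinGSet G} {i : X ⟶ Y} {j : Y ⟶ Z} {f : A ⟶ X}
    {g : A ⟶ B} {h : B ⟶ Z} (H : IsExp i j f g h) {w : W ⟶ Z} (m : Lifts h w) : pb w j ⟶ A :=
  H.isPullback.lift (pbFst w j ≫ m.1) (pbSnd w j)
    (by rw [Category.assoc, m.2]; exact (isPullback_pb w j).w)

section

variable {A B X Y Z W : FinGSet G} {i : X ⟶ Y} {j : Y ⟶ Z} {f : A ⟶ X}
  {g : A ⟶ B} {h : B ⟶ Z} (H : IsExp i j f g h) {w : W ⟶ Z}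

theorem IsExp.liftMap_fst (m : Lifts h w) : H.liftMap m ≫ g = pbFst w j ≫ m.1 :=
  H.isPullback.lift_fst _ _ _

theorem IsExp.liftMap_snd (m : Lifts h w) : H.liftMap m ≫ f ≫ i = pbSnd w j :=
  H.isPullback.lift_snd _ _ _

/-- Pasting with the pullback square of the exponential diagram gives the fibre product of `w` and
`j`. In the ghost functor a norm along `g`, evaluated at `m`, can therefore be read off at `liftMap
m`. -/
theorem IsExp.isPullback_liftMap (m : Lifts h w) :
    IsPullback (pbFst w j) (H.liftMap m) m.1 g := by
  have e := H.liftMap_snd m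
  refine IsPullback.of_bot ?_ (H.liftMap_fst m).symm H.isPullback
  rw [e, m.2]
  exact isPullback_pb w j

/-- The universal property of exponential diagrams. -/
theorem IsExp.bijective_liftMap : Function.Bijective
    (fun m : Lifts h w => (⟨H.liftMap m ≫ f, H.liftMap_snd m⟩ : Lifts i (pbSnd w j))) := by
  constructor
  · intro m m' hm
    have hl : ∀ y, f (H.liftMap m y) = f (H.liftMap m' y) := fun y =>
      congr_hom (congrArg Subtype.val hm) y
    refine Subtype.ext (hom_ext fun c => H.ext _ _ ?_ fun a a' ha ha' haa => ?_)
    · exact (congr_hom m.2 c).trans (congr_hom m'.2 c).symm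
    · have hc : w c = j (i (f a)) := by rw [H.comm, ha]; exact (congr_hom m.2 c).symm
      let y : pb w j := ⟨(c, i (f a)), hc⟩
      have e1 : H.liftMap m y = a :=
        H.inj _ _ (congr_hom (H.liftMap_snd m) y) ((congr_hom (H.liftMap_fst m) y).trans ha.symm)
      have e2 : H.liftMap m' y = a' :=
        H.inj _ _ ((congr_hom (H.liftMap_snd m') y).trans haa)
          ((congr_hom (H.liftMap_fst m') y).trans ha'.symm)
      rw [← e1, ← e2, hl]
  · rintro ⟨l, hl⟩
    have hl' : ∀ y : pb w j, i (l y) = y.1.2 := fun y => congr_hom hl y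
    -- Over each point `c` the partial lift `l` restricts to a section on the fibre of `j` at `w c`,
    -- and so gives a point of `B`. Equivariance of this choice follows because `B` contains each
    -- section only once.
    have hs : ∀ c : W, ∃ b, h b = w c ∧ ∀ a (ha : w c = j (i (f a))), g a = b →
        f a = l ⟨(c, i (f a)), ha⟩ := fun c => by
      obtain ⟨b, h1, h2⟩ := H.sect (w c) (fun y => l ⟨(c, y.1), y.2.symm⟩) (fun y => hl' _)
      exact ⟨b, h1, fun a ha => h2 a ha.symm⟩
    choose b hb1 hb2 using hs
    have hsm : ∀ (γ : G) (c : W), b (γ • c) = γ • b c := by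
      intro γ c
      have e : h (γ • b c) = w (γ • c) := by rw [hom_smul, hom_smul, hb1]
      refine H.ext _ _ ((hb1 _).trans e.symm) fun a a' ha ha' haa => ?_
      have h1 : w (γ • c) = j (i (f a)) := by rw [H.comm, ha, hb1]
      have h2 : g (γ⁻¹ • a') = b c := by rw [hom_smul, ha', inv_smul_smul]
      have h3 : w c = j (i (f (γ⁻¹ • a'))) := by rw [H.comm, h2, hb1]
      have h4 := hb2 c _ h3 h2
      have h5 : f a' = γ • f (γ⁻¹ • a') := by rw [hom_smul, smul_inv_smul]
      rw [hb2 _ a h1 ha, h5, h4]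
      refine Eq.trans ?_ (hom_smul l γ (⟨(c, i (f (γ⁻¹ • a'))), h3⟩ : pb w j))
      refine congrArg l (Subtype.ext (Prod.ext rfl ?_))
      change i (f a) = γ • i (f (γ⁻¹ • a'))
      rw [← hom_smul i, ← h5, haa]
    let m : Lifts h w := ⟨mkHom b hsm, hom_ext hb1⟩
    refine ⟨m, Subtype.ext (hom_ext fun y => ?_)⟩
    have e1 : i (f (H.liftMap m y)) = y.1.2 := congr_hom (H.liftMap_snd m) y
    have e2 : g (H.liftMap m y) = b y.1.1 := congr_hom (H.liftMap_fst m) y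
    have e3 : w y.1.1 = j (i (f (H.liftMap m y))) := by rw [e1]; exact y.2
    exact (hb2 y.1.1 _ e3 e2).trans (congrArg l (Subtype.ext (Prod.ext rfl e1)))

end

/-- Base change for lifts. -/
theorem bijective_lifts_pullback {P X Y Z W : FinGSet G} {p : P ⟶ X} {q : P ⟶ Y} {j : X ⟶ Z}
    {i : Y ⟶ Z} (h : IsPullback p q j i) (w : W ⟶ X) : Function.Bijective
      (fun l : Lifts p w => (⟨l.1 ≫ q, by rw [Category.assoc, ← h.w, ← Category.assoc, l.2]⟩ :
        Lifts i (w ≫ j))) := by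
  constructor
  · intro l l' hl
    exact Subtype.ext (h.hom_ext (l.2.trans l'.2.symm) (congrArg Subtype.val hl))
  · rintro ⟨l, hl⟩
    exact ⟨⟨h.lift w l hl.symm, h.lift_fst _ _ _⟩, Subtype.ext (h.lift_snd _ _ _)⟩

theorem card_orbits_eq_of_iso {W W' : FinGSet G} (e : W' ≅ W) :
    Nat.card (MulAction.orbitRel.Quotient G W') = Nat.card (MulAction.orbitRel.Quotient G W) := by
  refine Nat.card_congr (Quotient.congr (Equiv.ofBijective _ (bijective_of_iso e)) ?_)
  intro a b
  change a ∈ MulAction.orbit G b ↔ e.hom a ∈ MulAction.orbit G (e.hom b)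
  constructor
  · rintro ⟨g, rfl⟩
    exact ⟨g, (hom_smul _ _ _).symm⟩
  · rintro ⟨g, hg⟩
    exact ⟨g, (bijective_of_iso e).1 ((hom_smul _ _ _).trans hg)⟩

theorem card_orbits_sum (W W' : FinGSet G) :
    Nat.card (MulAction.orbitRel.Quotient G (W.sum W')) =
      Nat.card (MulAction.orbitRel.Quotient G W) +
        Nat.card (MulAction.orbitRel.Quotient G W') := by
  rw [← Nat.card_sum]
  let F : MulAction.orbitRel.Quotient G W ⊕ MulAction.orbitRel.Quotient G W' →
      MulAction.orbitRel.Quotient G (W.sum W') :=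
    Sum.elim
      (Quotient.map' (inl W W') fun a b => by
        rintro ⟨g, rfl⟩
        exact ⟨g, rfl⟩)
      (Quotient.map' (inr W W') fun a b => by
        rintro ⟨g, rfl⟩
        exact ⟨g, rfl⟩)
  refine (Nat.card_congr (Equiv.ofBijective F ⟨?_, ?_⟩)).symm
  · rintro (a | a) (b | b) <;> induction a using Quotient.inductionOn' <;>
      induction b using Quotient.inductionOn' <;> intro h <;>
      obtain ⟨g, hg⟩ := Quotient.exact h
    · exact congrArg Sum.inl (Quotient.sound ⟨g, Sum.inl_injective hg⟩)
    · exact absurd hg.symm Sum.inl_ne_inr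
    · exact absurd hg.symm Sum.inr_ne_inl
    · exact congrArg Sum.inr (Quotient.sound ⟨g, Sum.inr_injective hg⟩)
  · intro x
    induction x using Quotient.inductionOn' with | h x =>
    rcases x with x | x
    · exact ⟨Sum.inl (Quotient.mk'' x), rfl⟩
    · exact ⟨Sum.inr (Quotient.mk'' x), rfl⟩

/-- A nonempty finite `G`-set contains a transitive one as a summand. -/
theorem exists_iso_sum_transitive (W : FinGSet G) [Nonempty W] :
    ∃ (O W' : FinGSet G) (_ : O.sum W' ≅ W), Nonempty O ∧ MulAction.IsPretransitive G O := by
  obtain ⟨x⟩ := ‹Nonempty W›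
  have h1 : ∀ (g : G) (y : W), y ∈ MulAction.orbit G x → g • y ∈ MulAction.orbit G x :=
    fun g y hy => (MulAction.mem_orbit_of_mem_orbit g hy)
  have h2 := fun g y => not_smul_of_not h1 g y
  refine ⟨sub W _ h1, sub W _ h2, isoOfBijective (sumDesc (subIncl W _ h1) (subIncl W _ h2))
    ⟨?_, ?_⟩, ⟨⟨x, MulAction.mem_orbit_self x⟩⟩, ⟨?_⟩⟩
  · rintro (a | a) (b | b) h
    · exact congrArg Sum.inl (Subtype.ext h)
    · exact absurd a.2 (by have h' : a.1 = b.1 := h; rw [h']; exact b.2)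
    · exact absurd b.2 (by have h' : a.1 = b.1 := h; rw [← h']; exact a.2)
    · exact congrArg Sum.inr (Subtype.ext h)
  · intro y
    by_cases hy : y ∈ MulAction.orbit G x
    · exact ⟨Sum.inl ⟨y, hy⟩, rfl⟩
    · exact ⟨Sum.inr ⟨y, hy⟩, rfl⟩
  · rintro ⟨_, g, rfl⟩ ⟨_, g', rfl⟩
    refine ⟨g' * g⁻¹, Subtype.ext ?_⟩
    change (g' * g⁻¹) • g • x = g' • x
    rw [mul_smul, inv_smul_smul]

end FinGSet

/-! ### The ghost Tambara functor -/

namespace FinGSet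

variable {G : Type u} [Group G]

/-- Invariant multiplicative functions on the finite `G`-sets over `X`. -/
structure MulFn (X : FinGSet G) : Type (u + 1) where
  val : ∀ {W : FinGSet G}, (W ⟶ X) → ℤ
  iso : ∀ {W W' : FinGSet G} (e : W' ≅ W) (w : W ⟶ X), val (e.hom ≫ w) = val w
  one : val (fromEmpty X) = 1
  mul : ∀ {W W' : FinGSet G} (w : W ⟶ X) (w' : W' ⟶ X), val (sumDesc w w') = val w * val w'

namespace MulFn

theorem ext {X : FinGSet G} {φ ψ : MulFn X}
    (h : ∀ (W : FinGSet G) (w : W ⟶ X), φ.val w = ψ.val w) : φ = ψ := by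
  obtain ⟨φ, h1, h2, h3⟩ := φ
  obtain ⟨ψ, h1', h2', h3'⟩ := ψ
  obtain rfl : @φ = @ψ := funext fun W => funext fun w => h W w
  rfl

theorem val_iso_eq {X W W' : FinGSet G} (φ : MulFn X) (e : W' ≅ W) {w : W ⟶ X} {w' : W' ⟶ X}
    (h : e.hom ≫ w = w') : φ.val w' = φ.val w := by rw [← h, φ.iso]

theorem val_of_isEmpty {X W : FinGSet G} (φ : MulFn X) [IsEmpty W] (w : W ⟶ X) : φ.val w = 1 := by
  rw [← φ.one]
  refine (φ.val_iso_eq (isoOfBijective (fromEmpty W)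
    ⟨fun x => isEmptyElim x, fun x => isEmptyElim x⟩) ?_).symm
  ext x
  exact isEmptyElim x

/-- Invariance under isomorphisms determines such a function by its values on the standard finite
`G`-sets. -/
instance (X : FinGSet G) : Small.{u} (MulFn X) := by
  refine small_of_injective (β := (Σ s : StdGSet G, (s.toFinGSet ⟶ X)) → ℤ)
    (f := fun φ s => φ.val s.2) fun φ ψ h => ext fun W w => ?_
  obtain ⟨s, ⟨e⟩⟩ := exists_stdGSet_iso W
  rw [← φ.iso e, ← ψ.iso e]
  exact congrFun h ⟨s, e.hom ≫ w⟩

/-- The model is the function counting lifts to a `G`-set `B`. Lifts to a base change of `B` are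
lifts of the composite; lifts to a dependent product along `g` are lifts of the fibre product with
`g`; a lift through `B ⟶ X ⟶ Y` first selects a lift to `X`. The three operations transcribe this
for arbitrary multiplicative functions. -/
def res {X Y : FinGSet G} (f : X ⟶ Y) (φ : MulFn Y) : MulFn X where
  val w := φ.val (w ≫ f)
  iso e w := by rw [Category.assoc, φ.iso]
  one := φ.val_of_isEmpty _
  mul w w' := by rw [comp_sumDesc_desc, φ.mul]

theorem val_pullback {X Y W P P' : FinGSet G} {g : X ⟶ Y} {w : W ⟶ Y} {p : P ⟶ W} {q : P ⟶ X}
    {p' : P' ⟶ W} {q' : P' ⟶ X} (h : IsPullback p q w g) (h' : IsPullback p' q' w g)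
    (φ : MulFn X) : φ.val q = φ.val q' :=
  φ.val_iso_eq (h.isoIsPullback _ _ h') (h.isoIsPullback_hom_snd _ _ h')

def nm {X Y : FinGSet G} (g : X ⟶ Y) (φ : MulFn X) : MulFn Y where
  val w := φ.val (pbSnd w g)
  iso e w := by
    have h : IsPullback (pbFst (e.hom ≫ w) g ≫ e.hom) (pbSnd (e.hom ≫ w) g) w g := by
      have h1 := isPullback_pb (e.hom ≫ w) g
      have h2 : IsPullback e.hom (𝟙 _ ≫ e.hom ≫ w) w (𝟙 _) :=
        IsPullback.of_horiz_isIso ⟨by simp⟩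
      refine isPullback_of_elements (fun a => pullback_w h1 a) (fun x y hxy => ?_) (fun a b hab hab' => ?_)
      · obtain ⟨x, rfl⟩ := (bijective_of_iso e).2 x
        obtain ⟨a, rfl, rfl⟩ := pullback_exists h1 hxy
        exact ⟨a, rfl, rfl⟩
      · exact pullback_ext h1 ((bijective_of_iso e).1 hab) hab'
    exact val_pullback h (isPullback_pb w g) φ
  one := by
    have : IsEmpty (pb (fromEmpty Y) g) := ⟨fun x => isEmptyElim x.1.1⟩
    exact φ.val_of_isEmpty _
  mul w w' := by
    rw [← φ.mul]
    exact val_pullback (isPullback_pb _ _)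
      (isPullback_sum (isPullback_pb w g) (isPullback_pb w' g)) φ

theorem nm_val {X Y W P : FinGSet G} {g : X ⟶ Y} {w : W ⟶ Y} {p : P ⟶ W} {q : P ⟶ X}
    (h : IsPullback p q w g) (φ : MulFn X) : (nm g φ).val w = φ.val q :=
  val_pullback (isPullback_pb w g) h φ

noncomputable def tr {X Y : FinGSet G} (f : X ⟶ Y) (φ : MulFn X) : MulFn Y where
  val w := ∑ l : Lifts f w, φ.val l.1
  iso {W W'} e w := by
    refine (Function.Bijective.sum_comp (e := fun l : Lifts f w =>
      (⟨e.hom ≫ l.1, by rw [Category.assoc, l.2]⟩ : Lifts f (e.hom ≫ w))) ⟨?_, ?_⟩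
      (fun l => φ.val l.1)).symm.trans (Finset.sum_congr rfl fun l _ => φ.iso e l.1)
    · intro l l' h
      exact Subtype.ext ((cancel_epi e.hom).mp (congrArg Subtype.val h))
    · intro l
      refine ⟨⟨e.inv ≫ l.1, by rw [Category.assoc, l.2, Iso.inv_hom_id_assoc]⟩, Subtype.ext ?_⟩
      simp
  one := by
    have : Unique (Lifts f (fromEmpty Y)) :=
      { default := ⟨fromEmpty X, by ext x; exact isEmptyElim x⟩
        uniq := fun l => Subtype.ext (by ext x; exact isEmptyElim x) }
    rw [Fintype.sum_unique]
    exact φ.val_of_isEmpty _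
  mul {W W'} w w' := by
    rw [Finset.sum_mul_sum, ← Fintype.sum_prod_type' (f := fun (l : Lifts f w) (l' : Lifts f w') =>
      φ.val l.1 * φ.val l'.1)]
    refine (Function.Bijective.sum_comp (e := fun l : Lifts f w × Lifts f w' =>
      (⟨sumDesc l.1.1 l.2.1, by rw [comp_sumDesc_desc, l.1.2, l.2.2]⟩ :
        Lifts f (sumDesc w w'))) ⟨?_, ?_⟩ (fun l => φ.val l.1)).symm.trans
        (Finset.sum_congr rfl fun l _ => φ.mul l.1.1 l.2.1)
    · intro l l' h
      have h' := congrArg Subtype.val h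
      exact Prod.ext (Subtype.ext (congrArg (fun k => inl W W' ≫ k) h'))
        (Subtype.ext (congrArg (fun k => inr W W' ≫ k) h'))
    · intro l
      refine ⟨(⟨inl W W' ≫ l.1, by rw [Category.assoc, l.2]; rfl⟩,
        ⟨inr W W' ≫ l.1, by rw [Category.assoc, l.2]; rfl⟩), Subtype.ext ?_⟩
      exact sum_hom_ext rfl rfl

theorem tr_val {X Y W : FinGSet G} (f : X ⟶ Y) (φ : MulFn X) (w : W ⟶ Y) :
    (tr f φ).val w = ∑ l : Lifts f w, φ.val l.1 := rfl

instance (X : FinGSet G) : One (MulFn X) := ⟨⟨fun _ => 1, fun _ _ => rfl, rfl, fun _ _ => rfl⟩⟩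

instance (X : FinGSet G) : Mul (MulFn X) :=
  ⟨fun φ ψ => ⟨fun w => φ.val w * ψ.val w, fun e w => by rw [φ.iso, ψ.iso],
    by rw [φ.one, ψ.one, _root_.one_mul], fun w w' => by rw [φ.mul, ψ.mul]; ring⟩⟩

theorem mul_val {X W : FinGSet G} (φ ψ : MulFn X) (w : W ⟶ X) :
    (φ * ψ).val w = φ.val w * ψ.val w := rfl

/-- The sign function, which is equal to `-1` on transitive `G`-sets. -/
noncomputable def sign (X : FinGSet G) : MulFn X where
  val {W} _ := (-1) ^ Nat.card (MulAction.orbitRel.Quotient G W)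
  iso e _ := by rw [card_orbits_eq_of_iso e]
  one := by
    have : IsEmpty (MulAction.orbitRel.Quotient G (empty G)) :=
      ⟨fun x => Quotient.inductionOn' x fun y => isEmptyElim y⟩
    rw [Nat.card_of_isEmpty, pow_zero]
  mul _ _ := by rw [card_orbits_sum, pow_add]

/-- The norm from `X` takes the value `1` on `G`-sets lying over `Y`, and symmetrically, so
multiplying the two norms glues the functions. -/
noncomputable def pair {X Y : FinGSet G} (φ : MulFn X) (ψ : MulFn Y) : MulFn (X.sum Y) :=
  nm (inl X Y) φ * nm (inr X Y) ψ

theorem res_id {X : FinGSet G} (φ : MulFn X) : res (𝟙 X) φ = φ := rfl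

theorem res_comp {X Y Z : FinGSet G} (f : X ⟶ Y) (g : Y ⟶ Z) (φ : MulFn Z) :
    res (f ≫ g) φ = res f (res g φ) := rfl

theorem res_inl_pair {X Y : FinGSet G} (φ : MulFn X) (ψ : MulFn Y) :
    res (inl X Y) (pair φ ψ) = φ := by
  refine ext fun W w => ?_
  change (nm (inl X Y) φ).val (w ≫ inl X Y) * ψ.val (pbSnd (w ≫ inl X Y) (inr X Y)) = φ.val w
  have : IsEmpty (pb (w ≫ inl X Y) (inr X Y)) := ⟨fun x => absurd x.2 Sum.inl_ne_inr⟩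
  have h : IsPullback (𝟙 W) w (w ≫ inl X Y) (inl X Y) :=
    isPullback_of_elements (fun _ => rfl) (fun x y hxy => ⟨x, rfl, Sum.inl_injective hxy⟩)
      fun _ _ h _ => h
  rw [nm_val h, ψ.val_of_isEmpty, mul_one]

theorem res_inr_pair {X Y : FinGSet G} (φ : MulFn X) (ψ : MulFn Y) :
    res (inr X Y) (pair φ ψ) = ψ := by
  refine ext fun W w => ?_
  change φ.val (pbSnd (w ≫ inr X Y) (inl X Y)) * (nm (inr X Y) ψ).val (w ≫ inr X Y) = ψ.val w
  have : IsEmpty (pb (w ≫ inr X Y) (inl X Y)) := ⟨fun x => absurd x.2 Sum.inr_ne_inl⟩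
  have h : IsPullback (𝟙 W) w (w ≫ inr X Y) (inr X Y) :=
    isPullback_of_elements (fun _ => rfl) (fun x y hxy => ⟨x, rfl, Sum.inr_injective hxy⟩)
      fun _ _ h _ => h
  rw [nm_val h, φ.val_of_isEmpty, _root_.one_mul]

theorem sum_ext {X Y : FinGSet G} {φ ψ : MulFn (X.sum Y)} (h1 : res (inl X Y) φ = res (inl X Y) ψ)
    (h2 : res (inr X Y) φ = res (inr X Y) ψ) : φ = ψ := by
  refine ext fun W w => ?_
  obtain ⟨B, C, b, c, e, he⟩ := exists_iso_sumMap w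
  rw [← φ.iso e, ← ψ.iso e, he]
  change φ.val (sumDesc _ _) = ψ.val (sumDesc _ _)
  rw [φ.mul, ψ.mul]
  change (res (inl X Y) φ).val b * (res (inr X Y) φ).val c = _
  rw [h1, h2]
  rfl

theorem tr_id {X : FinGSet G} (φ : MulFn X) : tr (𝟙 X) φ = φ := by
  refine ext fun W w => ?_
  let _ : Unique (Lifts (𝟙 X) w) :=
    { default := ⟨w, Category.comp_id w⟩
      uniq := fun l => Subtype.ext ((Category.comp_id _).symm.trans l.2) }
  rw [tr_val, Fintype.sum_unique]
  rfl

theorem tr_comp {X Y Z : FinGSet G} (f : X ⟶ Y) (g : Y ⟶ Z) (φ : MulFn X) :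
    tr (f ≫ g) φ = tr g (tr f φ) := by
  refine ext fun W w => ?_
  simp only [tr_val]
  rw [← Fintype.sum_sigma' (fun (m : Lifts g w) (l : Lifts f m.1) => φ.val l.1)]
  refine (Function.Bijective.sum_comp (e := fun l : (Σ m : Lifts g w, Lifts f m.1) =>
    (⟨l.2.1, by rw [← Category.assoc, l.2.2, l.1.2]⟩ : Lifts (f ≫ g) w)) ⟨?_, ?_⟩
    (fun l => φ.val l.1)).symm
  · rintro ⟨⟨m, hm⟩, l, hl⟩ ⟨⟨m', hm'⟩, l', hl'⟩ h
    obtain rfl : l = l' := congrArg Subtype.val h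
    obtain rfl : m = m' := hl.symm.trans hl'
    rfl
  · rintro ⟨l, hl⟩
    exact ⟨⟨⟨l ≫ f, by rw [Category.assoc, hl]⟩, l, rfl⟩, rfl⟩

theorem res_tr {P X Y Z : FinGSet G} (p : P ⟶ X) (q : P ⟶ Y) (j : X ⟶ Z) (i : Y ⟶ Z)
    (h : IsPullback p q j i) (φ : MulFn Y) : res j (tr i φ) = tr p (res q φ) := by
  refine ext fun W w => ?_
  exact (Function.Bijective.sum_comp (bijective_lifts_pullback h w) (fun l => φ.val l.1)).symm

theorem nm_id {X : FinGSet G} (φ : MulFn X) : nm (𝟙 X) φ = φ :=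
  ext fun W w => nm_val (IsPullback.of_horiz_isIso ⟨by simp⟩ : IsPullback (𝟙 W) w w (𝟙 X)) φ

theorem nm_comp {X Y Z : FinGSet G} (f : X ⟶ Y) (g : Y ⟶ Z) (φ : MulFn X) :
    nm (f ≫ g) φ = nm g (nm f φ) := by
  refine ext fun W w => ?_
  have h1 := isPullback_pb w g
  have h2 := isPullback_pb (pbSnd w g) f
  exact nm_val (h2.flip.paste_vert h1.flip).flip φ

theorem res_nm {P X Y Z : FinGSet G} (p : P ⟶ X) (q : P ⟶ Y) (j : X ⟶ Z) (i : Y ⟶ Z)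
    (h : IsPullback p q j i) (φ : MulFn Y) : res j (nm i φ) = nm p (res q φ) := by
  refine ext fun W w => ?_
  exact nm_val ((isPullback_pb w p).paste_vert h) φ

/-- Both sides are sums of values of `φ`, over lifts of the fibre product to `X` and over lifts of
`w` to `B`. The universal property of exponential diagrams matches the two index sets and the
summands. -/
theorem nm_tr {A B X Y Z : FinGSet G} (i : X ⟶ Y) (j : Y ⟶ Z) (f : A ⟶ X) (g : A ⟶ B) (h : B ⟶ Z)
    (H : IsExponential i j f g h) (φ : MulFn X) : nm j (tr i φ) = tr h (nm g (res f φ)) := by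
  refine ext fun W w => ?_
  have H' := isExponential_iff.mp H
  refine (Function.Bijective.sum_comp H'.bijective_liftMap (fun l => φ.val l.1)).symm.trans ?_
  exact Finset.sum_congr rfl fun m _ => (nm_val (H'.isPullback_liftMap m) (res f φ)).symm

theorem sign_val_of_transitive {X W : FinGSet G} [Nonempty W] [MulAction.IsPretransitive G W]
    (w : W ⟶ X) : (sign X).val w = -1 := by
  have : Nat.card (MulAction.orbitRel.Quotient G W) = 1 := by
    rw [Nat.card_eq_one_iff_unique]
    refine ⟨⟨fun a b => ?_⟩, ⟨Quotient.mk'' (Classical.arbitrary W)⟩⟩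
    induction a using Quotient.inductionOn' with | h a =>
    induction b using Quotient.inductionOn' with | h b =>
    exact Quotient.sound (MulAction.exists_smul_eq G b a)
  change (-1 : ℤ) ^ _ = _
  rw [this, pow_one]

/-- The sum of a multiplicative function and its twist by the sign vanishes. -/
theorem tr_fold_pair_sign {X : FinGSet G} (φ : MulFn X) (ψ : MulFn (empty G)) :
    tr (fold X) (pair φ (φ * sign X)) = tr (fromEmpty X) ψ := by
  refine ext fun W w => ?_
  -- Over the empty `G`-set every multiplicative function is `1`. Over a nonempty one the right-hand
  -- side is an empty sum, and the left-hand side vanishes once it vanishes on a single orbit, by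
  -- multiplicativity.
  by_cases hW : IsEmpty W
  · rw [val_of_isEmpty, val_of_isEmpty]
  rw [not_isEmpty_iff] at hW
  have h0 : (tr (fromEmpty X) ψ).val w = 0 := by
    have : IsEmpty (Lifts (fromEmpty X) w) :=
      ⟨fun l => isEmptyElim (l.1 (Classical.arbitrary W))⟩
    rw [tr_val, Fintype.sum_empty]
  rw [h0]
  obtain ⟨O, W', e, hO, hO'⟩ := exists_iso_sum_transitive W
  have h1 : ∀ o : O ⟶ X, (tr (fold X) (pair φ (φ * sign X))).val o = 0 := by
    intro o
    -- A transitive `G`-set over `X` lifts to the disjoint union `X ⊔ X` in exactly two ways, into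
    -- one copy or the other. The two values of the glued function are negatives of each other.
    have hb : Function.Bijective (fun b : Bool => (if b then ⟨o ≫ inl X X, rfl⟩
        else ⟨o ≫ inr X X, rfl⟩ : Lifts (fold X) o)) := by
      obtain ⟨x⟩ := hO
      constructor
      · intro b b' h
        have h' := congr_hom (congrArg Subtype.val h) x
        cases b <;> cases b'
        · rfl
        · exact absurd h' Sum.inr_ne_inl
        · exact absurd h' Sum.inl_ne_inr
        · rfl
      · rintro ⟨l, rfl⟩
        rcases hx : l x with y | y
        · refine ⟨true, Subtype.ext (hom_ext fun z => ?_)⟩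
          obtain ⟨g, rfl⟩ := MulAction.exists_smul_eq G x z
          change inl X X (fold X (l (g • x))) = l (g • x)
          rw [hom_smul, hx]
          rfl
        · refine ⟨false, Subtype.ext (hom_ext fun z => ?_)⟩
          obtain ⟨g, rfl⟩ := MulAction.exists_smul_eq G x z
          change inr X X (fold X (l (g • x))) = l (g • x)
          rw [hom_smul, hx]
          rfl
    rw [tr_val, ← hb.sum_comp, Fintype.sum_bool]
    change (res (inl X X) (pair φ (φ * sign X))).val o +
      (res (inr X X) (pair φ (φ * sign X))).val o = 0
    rw [res_inl_pair, res_inr_pair, mul_val, sign_val_of_transitive]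
    ring
  rw [← iso _ e]
  have h2 : e.hom ≫ w = sumDesc (inl _ _ ≫ e.hom ≫ w) (inr _ _ ≫ e.hom ≫ w) :=
    sum_hom_ext rfl rfl
  rw [h2, mul, h1, zero_mul]

end MulFn

end FinGSet

/-- The semi-Tambara functor of invariant multiplicative functions. -/
noncomputable def semiGhost (G : Type u) [Group G] : SemiTambaraFunctor G where
  obj X := Shrink.{u} (MulFn X)
  nonempty X := ⟨equivShrink _ 1⟩
  res f a := equivShrink _ (((equivShrink _).symm a).res f)
  tr f a := equivShrink _ (((equivShrink _).symm a).tr f)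
  nm f a := equivShrink _ (((equivShrink _).symm a).nm f)
  res_id X a := by rw [MulFn.res_id, Equiv.apply_symm_apply]
  res_comp f g a := by rw [MulFn.res_comp, Equiv.symm_apply_apply]
  tr_id X a := by rw [MulFn.tr_id, Equiv.apply_symm_apply]
  tr_comp f g a := by rw [MulFn.tr_comp, Equiv.symm_apply_apply]
  nm_id X a := by rw [MulFn.nm_id, Equiv.apply_symm_apply]
  nm_comp f g a := by rw [MulFn.nm_comp, Equiv.symm_apply_apply]
  bijective_res := SemiMackeyFunctor.bijective_res_of_sum
    (obj := fun X : FinGSet G => Shrink.{u} (MulFn X))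
    (res := fun f a => equivShrink _ (((equivShrink _).symm a).res f))
    (fun X a => by rw [MulFn.res_id, Equiv.apply_symm_apply])
    (fun f g a => by rw [MulFn.res_comp, Equiv.symm_apply_apply])
    (fun X Y => by
      constructor
      · intro a b h
        have h' := Prod.mk.inj h
        refine (equivShrink _).symm.injective (MulFn.sum_ext ?_ ?_)
        · exact (equivShrink _).injective h'.1
        · exact (equivShrink _).injective h'.2
      · rintro ⟨a, b⟩
        refine ⟨equivShrink _ (MulFn.pair ((equivShrink _).symm a) ((equivShrink _).symm b)), ?_⟩
        simp only [Equiv.symm_apply_apply, MulFn.res_inl_pair, MulFn.res_inr_pair,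
          Equiv.apply_symm_apply])
  res_tr p q j i h a := by
    rw [Equiv.symm_apply_apply, Equiv.symm_apply_apply, MulFn.res_tr p q j i h]
  res_nm p q j i h a := by
    rw [Equiv.symm_apply_apply, Equiv.symm_apply_apply, MulFn.res_nm p q j i h]
  nm_tr i j f g h H a := by
    rw [Equiv.symm_apply_apply, Equiv.symm_apply_apply, Equiv.symm_apply_apply,
      MulFn.nm_tr i j f g h H]

/-- The multiplicative function given by an element of the ghost functor. -/
noncomputable def ghostFn {G : Type u} [Group G] {X : FinGSet G} (a : (semiGhost G).obj X) :
    MulFn X := (equivShrink (MulFn X)).symm a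

/-- The element of the ghost functor given by a multiplicative function. -/
noncomputable def ofGhostFn {G : Type u} [Group G] {X : FinGSet G} (φ : MulFn X) :
    (semiGhost G).obj X := equivShrink (MulFn X) φ

theorem ghostFn_ofGhostFn {G : Type u} [Group G] {X : FinGSet G} (φ : MulFn X) :
    ghostFn (ofGhostFn φ) = φ := (equivShrink (MulFn X)).symm_apply_apply φ

theorem ghostFn_injective {G : Type u} [Group G] {X : FinGSet G} :
    Function.Injective (ghostFn (G := G) (X := X)) := (equivShrink (MulFn X)).symm.injective

section

variable {G : Type u} [Group G]

theorem ghostFn_res {X Y : FinGSet G} (f : X ⟶ Y) (a : (semiGhost G).obj Y) :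
    ghostFn ((semiGhost G).res f a) = (ghostFn a).res f := Equiv.symm_apply_apply _ _

theorem ghostFn_tr {X Y : FinGSet G} (f : X ⟶ Y) (a : (semiGhost G).obj X) :
    ghostFn ((semiGhost G).tr f a) = (ghostFn a).tr f := Equiv.symm_apply_apply _ _

theorem ghostFn_nm {X Y : FinGSet G} (f : X ⟶ Y) (a : (semiGhost G).obj X) :
    ghostFn ((semiGhost G).nm f a) = (ghostFn a).nm f := Equiv.symm_apply_apply _ _

theorem ghostFn_pair {X Y : FinGSet G} (a : (semiGhost G).obj X) (b : (semiGhost G).obj Y) :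
    ghostFn ((semiGhost G).pair a b) = (ghostFn a).pair (ghostFn b) := by
  refine MulFn.sum_ext ?_ ?_
  · rw [MulFn.res_inl_pair, ← ghostFn_res, SemiMackeyFunctor.res_inl_pair]
  · rw [MulFn.res_inr_pair, ← ghostFn_res, SemiMackeyFunctor.res_inr_pair]

theorem ghostFn_one {X W : FinGSet G} (w : W ⟶ X) : (ghostFn ((semiGhost G).one X)).val w = 1 := by
  rw [SemiTambaraFunctor.one, ghostFn_nm]
  have : IsEmpty (pb w (fromEmpty X)) := ⟨fun x => isEmptyElim x.1.2⟩
  exact MulFn.val_of_isEmpty (W := pb w (fromEmpty X)) _ _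

/-- The Tambara functor of invariant multiplicative functions. -/
noncomputable def ghost (G : Type u) [Group G] : TambaraFunctor G where
  toSemiTambaraFunctor := semiGhost G
  exists_neg X a := by
    -- On transitive `G`-sets, where addition is pointwise, the twist by the sign is negation; on
    -- other `G`-sets it is not.
    refine ⟨ofGhostFn (ghostFn a * MulFn.sign X), ghostFn_injective ?_⟩
    refine (ghostFn_tr _ _).trans (Eq.trans ?_ (ghostFn_tr _ _).symm)
    rw [ghostFn_pair, ghostFn_ofGhostFn]
    exact MulFn.tr_fold_pair_sign _ _

end

/-! ### Virtual classes in a Tambara functor -/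

namespace MackeyFunctor

variable {G : Type u} [Group G]

noncomputable instance (M : MackeyFunctor G) (X : FinGSet G) : Add (M.obj X) := ⟨M.add⟩

noncomputable instance (M : MackeyFunctor G) (X : FinGSet G) : Zero (M.obj X) := ⟨M.zero X⟩

noncomputable instance (M : MackeyFunctor G) (X : FinGSet G) : Neg (M.obj X) :=
  ⟨fun a => (M.exists_neg X a).choose⟩

/-- The additive groups of a Mackey functor. -/
noncomputable instance addCommGroup (M : MackeyFunctor G) (X : FinGSet G) :
    AddCommGroup (M.obj X) where
  add_assoc := SemiMackeyFunctor.add_assoc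
  zero_add := SemiMackeyFunctor.zero_add
  add_zero := SemiMackeyFunctor.add_zero
  add_comm := SemiMackeyFunctor.add_comm
  neg_add_cancel a := (SemiMackeyFunctor.add_comm _ _).trans (M.exists_neg X a).choose_spec
  nsmul := nsmulRec
  zsmul := zsmulRec

variable (M : MackeyFunctor G)

theorem tr_sub {X Y : FinGSet G} (f : X ⟶ Y) (a b : M.obj X) :
    M.tr f (a - b) = M.tr f a - M.tr f b :=
  map_sub (AddMonoidHom.mk' (M.tr f) (SemiMackeyFunctor.tr_add f)) a b

theorem res_sub {X Y : FinGSet G} (f : X ⟶ Y) (a b : M.obj Y) :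
    M.res f (a - b) = M.res f a - M.res f b :=
  map_sub (AddMonoidHom.mk' (M.res f) (SemiMackeyFunctor.res_add f)) a b

theorem app_sub {M N : MackeyFunctor G}
    (φ : SemiMackeyFunctor.Hom M.toSemiMackeyFunctor N.toSemiMackeyFunctor) {X : FinGSet G}
    (a b : M.obj X) : φ.app X (a - b) = φ.app X a - φ.app X b :=
  map_sub (AddMonoidHom.mk' (φ.app X) φ.app_add) a b

end MackeyFunctor

/-- The decomposition of an element over a coproduct. -/
theorem SemiMackeyFunctor.eq_add_of_bijective {G : Type u} [Group G] {M : SemiMackeyFunctor G}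
    {X Y Z : FinGSet G} (i : X ⟶ Z) (j : Y ⟶ Z) (h : Function.Bijective (sumDesc i j))
    (a : M.obj Z) : a = M.add (M.tr i (M.res i a)) (M.tr j (M.res j a)) := by
  have h1 := eq_add_tr_res (M.res (isoOfBijective _ h).hom a)
  rw [← M.res_comp, ← M.res_comp] at h1
  have h2 := congrArg (M.tr (isoOfBijective _ h).hom) h1
  rwa [tr_inv_res, tr_add, ← M.tr_comp, ← M.tr_comp] at h2

/-! ### Ring structures and classes of finite `G`-sets -/

namespace CommGreenFunctor

variable {G : Type u} [Group G]

/-- The rings of a commutative Green functor. -/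
noncomputable instance commRing (R : CommGreenFunctor G) (X : FinGSet G) : CommRing (R.obj X) :=
  { R.commMonoid X, R.toMackeyFunctor.addCommGroup X with
    left_distrib := R.mul_add
    right_distrib := fun a b c => by
      change R.mul (R.add a b) c = R.add (R.mul a c) (R.mul b c)
      rw [R.mul_comm, R.mul_add, R.mul_comm c, R.mul_comm c]
    zero_mul := fun a => by
      change R.mul (R.zero X) a = R.zero X
      -- Zero is a transfer from the empty `G`-set. By Frobenius reciprocity so is its product with
      -- `b`, and over the empty `G`-set there is only one element, so the product is independent of
      -- `b` and may be computed at `b = 1`.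
      have h : ∀ b : R.obj X, R.mul (R.zero X) b = R.tr (fromEmpty X) (R.one _) := fun b => by
        have h0 : R.zero X = R.tr (fromEmpty X) (R.one _) :=
          congrArg _ (SemiMackeyFunctor.subsingleton_empty _ _)
        rw [h0, ← R.frobenius]
        exact congrArg _ (SemiMackeyFunctor.subsingleton_empty _ _)
      rw [h a, ← h (R.one X), R.mul_comm, R.one_mul]
    mul_zero := fun a => by
      change R.mul a (R.zero X) = R.zero X
      have h : ∀ b : R.obj X, R.mul b (R.zero X) = R.tr (fromEmpty X) (R.one _) := fun b => by
        have h0 : R.zero X = R.tr (fromEmpty X) (R.one _) :=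
          congrArg _ (SemiMackeyFunctor.subsingleton_empty _ _)
        rw [R.mul_comm, h0, ← R.frobenius]
        exact congrArg _ (SemiMackeyFunctor.subsingleton_empty _ _)
      rw [h a, ← h (R.one X), R.one_mul] }

/-- The class of a finite `G`-set over `X`. -/
def cls (R : CommGreenFunctor G) {B X : FinGSet G} (f : B ⟶ X) : R.obj X := R.tr f (R.one B)

variable (R : CommGreenFunctor G)

theorem cls_id (X : FinGSet G) : R.cls (𝟙 X) = 1 := R.tr_id _ _

theorem cls_of_isEmpty {B X : FinGSet G} [IsEmpty B] (f : B ⟶ X) : R.cls f = 0 := by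
  let e : B ≅ empty G := isoOfBijective (mkHom isEmptyElim fun _ x => isEmptyElim x)
    ⟨fun x => isEmptyElim x, fun x => isEmptyElim x⟩
  have hf : f = e.hom ≫ fromEmpty X := by
    ext x
    exact isEmptyElim x
  rw [cls, hf, R.tr_comp]
  exact congrArg _ (SemiMackeyFunctor.subsingleton_empty _ _)

theorem cls_sumDesc {B C X : FinGSet G} (f : B ⟶ X) (g : C ⟶ X) :
    R.cls (sumDesc f g) = R.cls f + R.cls g := by
  refine Eq.trans ?_ (SemiMackeyFunctor.tr_sumDesc_pair f g (R.one B) (R.one C))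
  exact congrArg _ (SemiMackeyFunctor.eq_pair (R.res_one _) (R.res_one _))

theorem cls_iso {B C X : FinGSet G} (e : B ≅ C) {f : C ⟶ X} {g : B ⟶ X} (h : e.hom ≫ f = g) :
    R.cls g = R.cls f := by
  rw [cls, ← h, R.tr_comp, SemiMackeyFunctor.tr_iso, R.res_one, cls]

theorem tr_cls {B X Y : FinGSet G} (f : B ⟶ X) (k : X ⟶ Y) : R.tr k (R.cls f) = R.cls (f ≫ k) :=
  (R.tr_comp _ _ _).symm

theorem res_cls {P B X Y : FinGSet G} {p : P ⟶ X} {q : P ⟶ B} {k : X ⟶ Y} {f : B ⟶ Y}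
    (h : IsPullback p q k f) : R.res k (R.cls f) = R.cls p := by
  rw [cls, R.res_tr _ _ _ _ h, R.res_one, cls]

theorem cls_mul {B C X : FinGSet G} (f : B ⟶ X) (g : C ⟶ X) :
    R.cls f * R.cls g = R.cls (pbFst f g ≫ f) := by
  rw [mul_def, cls, ← R.frobenius, R.one_mul, R.res_cls (isPullback_pb f g), tr_cls]

theorem app_cls {R S : CommGreenFunctor G} (φ : R ⟶ S) {B X : FinGSet G} (f : B ⟶ X) :
    φ.app X (R.cls f) = S.cls f := by
  rw [cls, φ.app_tr, φ.app_one, cls]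

end CommGreenFunctor

namespace TambaraFunctor

variable {G : Type u} [Group G]

noncomputable instance addCommGroup (T : TambaraFunctor G) (X : FinGSet G) :
    AddCommGroup (T.obj X) := T.toGreen.toMackeyFunctor.addCommGroup X

/-- The class of a finite `G`-set over `X`. -/
noncomputable def cls (T : TambaraFunctor G) {B X : FinGSet G} (f : B ⟶ X) : T.obj X :=
  T.tr f (T.one B)

section

variable (T : TambaraFunctor G)

theorem tr_sub {X Y : FinGSet G} (f : X ⟶ Y) (a b : T.obj X) :
    T.tr f (a - b) = T.tr f a - T.tr f b := T.toGreen.toMackeyFunctor.tr_sub f a b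

theorem res_sub {X Y : FinGSet G} (f : X ⟶ Y) (a b : T.obj Y) :
    T.res f (a - b) = T.res f a - T.res f b := T.toGreen.toMackeyFunctor.res_sub f a b

theorem cls_sumDesc {B C X : FinGSet G} (f : B ⟶ X) (g : C ⟶ X) :
    T.cls (sumDesc f g) = T.cls f + T.cls g := T.toGreen.cls_sumDesc f g

theorem tr_cls {B X Y : FinGSet G} (f : B ⟶ X) (k : X ⟶ Y) : T.tr k (T.cls f) = T.cls (f ≫ k) :=
  (T.tr_comp _ _ _).symm

theorem res_cls {P B X Y : FinGSet G} {p : P ⟶ X} {q : P ⟶ B} {k : X ⟶ Y} {f : B ⟶ Y}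
    (h : IsPullback p q k f) : T.res k (T.cls f) = T.cls p := T.toGreen.res_cls h

/-- The element `-1`. -/
noncomputable def negOne (X : FinGSet G) : T.obj X := 0 - T.one X

theorem res_negOne {X Y : FinGSet G} (f : X ⟶ Y) : T.res f (T.negOne Y) = T.negOne X := by
  rw [negOne, res_sub, SemiTambaraFunctor.res_one]
  exact congrArg (· - T.one X) (SemiMackeyFunctor.res_zero f)

/-- For the multiplicative semi-Mackey structure a norm along a summand inclusion extends by the
neutral element, which is `1`. -/
theorem nm_inr_negOne (B C : FinGSet G) :
    T.nm (inr B C) (T.negOne C) = T.pair (T.one B) (T.negOne C) :=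
  SemiMackeyFunctor.tr_inr (M := T.normSemiMackey) _

/-- Over the disjoint union of `B` and `C` the element with entries `1` and `-1` is a norm of `-1`.
In this form a difference of classes is open to the distributive law. -/
theorem cls_sub_cls {B C X : FinGSet G} (f : B ⟶ X) (g : C ⟶ X) :
    T.cls f - T.cls g = T.tr (sumDesc f g) (T.nm (inr B C) (T.negOne C)) := by
  rw [nm_inr_negOne]
  refine Eq.trans ?_ (SemiMackeyFunctor.tr_sumDesc_pair f g _ _).symm
  change _ = T.cls f + T.tr g (0 - T.one C)
  rw [tr_sub, sub_eq_add_neg, sub_eq_add_neg]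
  congr 1
  refine (zero_add _).symm.trans (congrArg (· + -T.cls g) ?_)
  exact (SemiMackeyFunctor.tr_zero g).symm

end

/-- A family of elements of Tambara functors which is uniformly a difference of two classes. -/
def IsVirtual {X : FinGSet G} (u : ∀ T : TambaraFunctor G, T.obj X) : Prop :=
  ∃ (B C : FinGSet G) (f : B ⟶ X) (g : C ⟶ X), ∀ T, u T = T.cls f - T.cls g

theorem isVirtual_cls {B X : FinGSet G} (f : B ⟶ X) : IsVirtual fun T => T.cls f :=
  ⟨B, empty G, f, fromEmpty X, fun T => by
    have : T.cls (fromEmpty X) = 0 := T.toGreen.cls_of_isEmpty _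
    rw [this, sub_zero]⟩

theorem IsVirtual.sub {X : FinGSet G} {u v : ∀ T : TambaraFunctor G, T.obj X} (hu : IsVirtual u)
    (hv : IsVirtual v) : IsVirtual fun T => u T - v T := by
  obtain ⟨B, C, f, g, hu⟩ := hu
  obtain ⟨B', C', f', g', hv⟩ := hv
  refine ⟨B.sum C', C.sum B', sumDesc f g', sumDesc g f', fun T => ?_⟩
  change u T - v T = _
  rw [hu, hv, cls_sumDesc, cls_sumDesc]
  abel

theorem IsVirtual.tr {X Y : FinGSet G} {u : ∀ T : TambaraFunctor G, T.obj X} (hu : IsVirtual u)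
    (k : X ⟶ Y) : IsVirtual fun T => T.tr k (u T) := by
  obtain ⟨B, C, f, g, hu⟩ := hu
  refine ⟨B, C, f ≫ k, g ≫ k, fun T => ?_⟩
  change T.tr k (u T) = _
  rw [hu, tr_sub, tr_cls, tr_cls]

theorem IsVirtual.res {X Y : FinGSet G} {u : ∀ T : TambaraFunctor G, T.obj Y} (hu : IsVirtual u)
    (k : X ⟶ Y) : IsVirtual fun T => T.res k (u T) := by
  obtain ⟨B, C, f, g, hu⟩ := hu
  refine ⟨_, _, pbFst k f, pbFst k g, fun T => ?_⟩
  change T.res k (u T) = _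
  rw [hu, res_sub, res_cls T (isPullback_pb k f), res_cls T (isPullback_pb k g)]

/-- The norm of zero is the class of the `G`-set of sections of the empty `G`-set. -/
theorem nm_zero {X Y : FinGSet G} (g : X ⟶ Y) (T : TambaraFunctor G) :
    T.nm g 0 = T.cls (depProdProj (fromEmpty X) g) := by
  have h : (0 : T.obj X) = T.tr (fromEmpty X) (T.one _) :=
    congrArg _ (SemiMackeyFunctor.subsingleton_empty _ _)
  rw [h, T.nm_tr _ _ _ _ _ (depProd_isExponential _ _), SemiTambaraFunctor.res_one,
    SemiTambaraFunctor.nm_one, cls]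

/-- The norms of `-1` are virtual classes. -/
theorem isVirtual_nm_negOne {X Y : FinGSet G} (g : X ⟶ Y) :
    IsVirtual fun T => T.nm g (T.negOne X) := by
  suffices h : ∀ (n : ℕ) {X Y : FinGSet G} (g : X ⟶ Y), (∀ y, Nat.card {x // g x = y} ≤ n) →
      IsVirtual fun T => T.nm g (T.negOne X) from
    h (Nat.card X) g fun y => Nat.card_le_card_of_injective _ Subtype.val_injective
  intro n
  induction n with
  | zero =>
    intro X Y g hg
    have hX : IsEmpty X := ⟨fun x => by
      have h := hg (g x)
      have : Nonempty {x' // g x' = g x} := ⟨⟨x, rfl⟩⟩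
      exact absurd h (by have := Nat.card_pos (α := {x' // g x' = g x}); omega)⟩
    have e : X ≅ empty G := isoOfBijective (mkHom isEmptyElim fun _ x => isEmptyElim x)
      ⟨fun x => isEmptyElim x, fun x => isEmptyElim x⟩
    convert isVirtual_cls (𝟙 Y) using 2 with T
    have h1 : T.negOne X = T.one X := by
      rw [← T.res_negOne (X := X) (Y := empty G) e.hom, ← SemiTambaraFunctor.res_one e.hom]
      exact congrArg _ (SemiMackeyFunctor.subsingleton_empty _ _)
    rw [h1, SemiTambaraFunctor.nm_one, cls, T.tr_id]
  | succ n ih =>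
    intro X Y g hg
    -- The idea is to expand the norm of `0 = 1 + (-1)`. A point of `E` is a point of `Y` together
    -- with a choice of summand, `1` or `-1`, at each point of its fibre. The map `r` collects the
    -- points where `-1` is chosen, and the expansion is the transfer along `h` of the norm of `-1`
    -- along `r`.
    let E := depProd (fold X) g
    let ε := depProdEval (fold X) g
    let r : pb ε (inr X X) ⟶ E := pbFst ε (inr X X) ≫ depProdSnd (fold X) g
    let h : E ⟶ Y := depProdProj (fold X) g
    have hε : ∀ c : pb ε (inr X X), ∃ x : X, ∃ s : FibreSection (fold X) g, ∃ hx : g x = s.pt,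
        s.sec ⟨x, hx⟩ = Sum.inr x ∧ c.1 = (⟨(x, s), hx⟩, x) := by
      rintro ⟨⟨⟨⟨x, s⟩, hx⟩, x'⟩, hc⟩
      have h1 : s.sec ⟨x, hx⟩ = Sum.inr x' := hc
      have h2 : fold X (s.sec ⟨x, hx⟩) = x := s.sec_spec ⟨x, hx⟩
      rw [h1] at h2
      obtain rfl : x' = x := h2
      exact ⟨x', s, hx, h1, rfl⟩
    have hP : ∀ (γ : G) (s : E), (∃ x x', FibreSection.sec s x = Sum.inl x') →
        ∃ x x', FibreSection.sec (γ • s) x = Sum.inl x' := by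
      rintro γ s ⟨⟨x, hx⟩, x', hs⟩
      refine ⟨⟨γ • x, (hom_smul g γ x).trans (congrArg (γ • ·) hx)⟩, γ • x', ?_⟩
      refine (FibreSection.smul_sec γ s _ _).trans (Eq.trans ?_ (congrArg (γ • ·) hs))
      exact congrArg (γ • ·) (FibreSection.sec_congr rfl (inv_smul_smul _ _) _ _)
    -- The `G`-set `E` splits into the choices that take `1` somewhere (`ι`) and those that take
    -- `-1` everywhere (`σ`), one for each point of `Y`. The latter contribute the norm that is
    -- sought; over the former the fibres of `r` are smaller than those of `g`.
    let ι := subIncl E _ hP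
    let σ : Y ⟶ E := mkHom (Y := E)
      (fun y => (⟨y, fun x => Sum.inr x.1, fun _ => rfl⟩ : FibreSection (fold X) g)) (by
        intro γ y
        refine FibreSection.ext' rfl fun x hx hx' => ?_
        exact congrArg Sum.inr (smul_inv_smul γ x).symm)
    have hb : Function.Bijective (sumDesc σ ι) := by
      constructor
      · rintro (y | s) (y' | s') hs
        · exact congrArg Sum.inl (congrArg FibreSection.pt hs)
        · obtain ⟨s', x, x', hx⟩ := s'
          obtain rfl : σ y = s' := hs
          exact absurd hx Sum.inr_ne_inl
        · obtain ⟨s, x, x', hx⟩ := s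
          obtain rfl : s = σ y' := hs
          exact absurd hx Sum.inr_ne_inl
        · exact congrArg Sum.inr (Subtype.ext hs)
      · intro s
        by_cases hs : ∃ x x', FibreSection.sec s x = Sum.inl x'
        · exact ⟨Sum.inr ⟨s, hs⟩, rfl⟩
        · refine ⟨Sum.inl (FibreSection.pt s), FibreSection.ext' rfl fun x hx hx' => ?_⟩
          have h2 : fold X (FibreSection.sec s ⟨x, hx'⟩) = x := FibreSection.sec_spec s ⟨x, hx'⟩
          change Sum.inr x = _
          rcases hc : FibreSection.sec s ⟨x, hx'⟩ with x' | x'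
          · exact absurd ⟨_, _, hc⟩ hs
          · rw [hc] at h2
            exact congrArg Sum.inr h2.symm
    let q : X ⟶ pb ε (inr X X) := mkHom (Y := pb ε (inr X X))
      (fun x => ⟨(⟨(x, σ (g x)), rfl⟩, x), rfl⟩) (fun γ x => by
        refine Subtype.ext (Prod.ext (Subtype.ext (Prod.ext rfl ?_)) rfl)
        change σ (g (γ • x)) = γ • σ (g x)
        rw [hom_smul, hom_smul])
    -- Over a choice of `-1` everywhere, the fibre of `r` is the whole fibre of `g`.
    have hq : IsPullback g q σ r := by
      refine isPullback_of_elements (fun _ => rfl) ?_ fun x x' _ hx => ?_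
      · intro y c hy
        obtain ⟨x, s, hx, hs, hc⟩ := hε c
        have h1 : σ y = s := hy.trans (congrArg (fun d => d.1.1.2) hc)
        subst h1
        obtain rfl : g x = y := hx
        exact ⟨x, rfl, Subtype.ext hc.symm⟩
      · exact congrArg (fun d => d.1.2) hx
    have hn : ∀ e, Nat.card {a // pbFst ι r a = e} ≤ n := by
      intro e
      have h1 : ∀ a : {a // pbFst ι r a = e}, ∃ x : {x // g x = FibreSection.pt e.1},
          FibreSection.sec e.1 x = Sum.inr x.1 ∧ a.1.1.2.1 = (⟨(x.1, e.1), x.2⟩, x.1) := by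
        rintro ⟨⟨⟨e, c⟩, hec⟩, rfl⟩
        obtain ⟨x, s, hx, hs, hc⟩ := hε c
        have h1 : e.1 = s := hec.trans (congrArg (fun d => d.1.1.2) hc)
        subst h1
        exact ⟨⟨x, hx⟩, hs, hc⟩
      choose F hF1 hF2 using h1
      have hF : Function.Injective F := by
        intro a a' haa
        refine Subtype.ext (Subtype.ext (Prod.ext (a.2.trans a'.2.symm) (Subtype.ext ?_)))
        rw [hF2, hF2, haa]
      obtain ⟨x, x', hx⟩ := e.2
      -- The injection `F` embeds the fibre into one of `g`, which has at most `n + 1` points. More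
      -- than `n` points would make `F` surjective, and the choice `e` would be `-1` everywhere,
      -- against `e.2`.
      by_contra hlt
      have h2 := hF.bijective_of_nat_card_le ((hg _).trans (by omega))
      obtain ⟨a, rfl⟩ := h2.2 x
      exact Sum.inr_ne_inl ((hF1 a).symm.trans hx)
    have key : ∀ T : TambaraFunctor G, T.nm g (T.negOne X) =
        T.cls (depProdProj (fromEmpty X) g) - T.tr (ι ≫ h) (T.nm (pbFst ι r) (T.negOne _)) := by
      intro T
      have h0 : (0 : T.obj X) = T.tr (fold X) (T.nm (inr X X) (T.negOne X)) := by
        rw [nm_inr_negOne]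
        exact (add_sub_cancel (T.one X) 0).symm
      have h1 : T.nm g 0 = T.tr h (T.nm r (T.negOne _)) := by
        rw [h0, T.nm_tr _ _ _ _ _ (depProd_isExponential _ _), T.res_nm _ _ _ _ (isPullback_pb _ _),
          ← T.nm_comp, res_negOne]
      rw [eq_sub_iff_add_eq, ← nm_zero, h1]
      have h2 := congrArg (T.tr h) (SemiMackeyFunctor.eq_add_of_bijective σ ι hb (T.nm r (T.negOne _)))
      rw [h2, SemiMackeyFunctor.tr_add, ← T.tr_comp, ← T.tr_comp, T.res_nm _ _ _ _ hq,
        T.res_nm _ _ _ _ (isPullback_pb ι r), res_negOne, res_negOne]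
      have h3 : σ ≫ h = 𝟙 Y := rfl
      rw [h3, T.tr_id]
      rfl
    rw [funext key]
    exact (isVirtual_cls _).sub ((ih _ hn).tr _)

/-- A difference of classes is a transfer of a norm of `-1`, so the distributive law presents its
norm as a transfer of another norm of `-1`. -/
theorem IsVirtual.nm {X Y : FinGSet G} {u : ∀ T : TambaraFunctor G, T.obj X} (hu : IsVirtual u)
    (k : X ⟶ Y) : IsVirtual fun T => T.nm k (u T) := by
  obtain ⟨B, C, f, g, hu⟩ := hu
  have key : ∀ T : TambaraFunctor G, T.nm k (u T) = T.tr (depProdProj (sumDesc f g) k)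
      (T.nm (pbFst (depProdEval (sumDesc f g) k) (inr B C) ≫ depProdSnd (sumDesc f g) k)
        (T.negOne _)) := by
    intro T
    rw [hu, cls_sub_cls, T.nm_tr _ _ _ _ _ (depProd_isExponential _ _),
      T.res_nm _ _ _ _ (isPullback_pb _ _), ← T.nm_comp, res_negOne]
  rw [funext key]
  exact (isVirtual_nm_negOne _).tr _

end TambaraFunctor

/-! ### Finite `G`-sets over `X` are determined by their numbers of lifts -/

namespace FinGSet

variable {G : Type u} [Group G]

/-- The lifts along an injection are the lifts with the same kernel. -/
theorem card_injective_lifts {B X W Q : FinGSet G} (f : B ⟶ X) (p : W ⟶ Q)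
    (hp : Function.Surjective p) (v : Q ⟶ X) {w : W ⟶ X} (hw : p ≫ v = w) {r : W → W → Prop}
    (hr : ∀ a b, p a = p b ↔ r a b) :
    Nat.card {m : Lifts f v // Function.Injective m.1} =
      Nat.card {l : Lifts f w // ∀ a b, l.1 a = l.1 b ↔ r a b} := by
  subst hw
  obtain rfl : (fun a b => p a = p b) = r := funext fun a => funext fun b => propext (hr a b)
  refine Nat.card_congr (Equiv.ofBijective (fun m => ⟨⟨p ≫ m.1.1, by rw [Category.assoc, m.1.2]⟩,
    fun a b => m.2.eq_iff⟩) ⟨?_, ?_⟩)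
  · intro m m' h
    refine Subtype.ext (Subtype.ext (hom_ext fun x => ?_))
    obtain ⟨a, rfl⟩ := hp x
    exact congr_hom (congrArg (fun l => l.1.1) h) a
  · rintro ⟨⟨l, hl⟩, h⟩
    choose s hs using hp
    have hm : ∀ a, l (s (p a)) = l a := fun a => (h _ _).mpr (hs _)
    let m : Q ⟶ B := mkHom (fun x => l (s x)) fun γ x => by
      have hp' : p (s (γ • x)) = p (γ • s x) := by rw [hs, hom_smul, hs]
      exact ((h _ _).mpr hp').trans (hom_smul l γ (s x))
    have hpm : p ≫ m = l := hom_ext hm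
    have hmv : m ≫ f = v := hom_ext fun x => by
      have := congr_hom hl (s x)
      exact this.trans (congrArg v (hs x))
    refine ⟨⟨⟨m, hmv⟩, fun x y hxy => ?_⟩, Subtype.ext (Subtype.ext hpm)⟩
    have : p (s x) = p (s y) := (h _ _).mp hxy
    rwa [hs, hs] at this

/-- The number of injective lifts is determined by the numbers of lifts. -/
theorem card_injective_lifts_eq {B B' X : FinGSet G} (f : B ⟶ X) (f' : B' ⟶ X)
    (h : ∀ (W : FinGSet G) (w : W ⟶ X), Nat.card (Lifts f w) = Nat.card (Lifts f' w))
    {W : FinGSet G} (w : W ⟶ X) : Nat.card {m : Lifts f w // Function.Injective m.1} =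
      Nat.card {m : Lifts f' w // Function.Injective m.1} := by
  induction hn : Nat.card W using Nat.strong_induction_on generalizing W with
  | _ n ih =>
  subst hn
  have : Finite (Setoid W) :=
    Finite.of_injective (fun s : Setoid W => s.r) fun s t hst => Setoid.ext fun a b => by
      rw [show s.r = t.r from hst]
  let _ : Fintype (Setoid W) := Fintype.ofFinite _
  -- Lifts are sorted by their kernels. The sum runs over all equivalence relations; those which are
  -- not `G`-invariant contribute nothing.
  have hs : ∀ {B : FinGSet G} (f : B ⟶ X), Nat.card (Lifts f w) =
      ∑ r : Setoid W, Nat.card {l : Lifts f w // ∀ a b, l.1 a = l.1 b ↔ r a b} := by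
    intro B f
    rw [← Nat.card_sigma]
    refine Nat.card_congr (Equiv.ofBijective (fun l => ⟨Setoid.ker l.1, l, fun a b => Iff.rfl⟩)
      ⟨fun l l' hl => ?_, ?_⟩)
    · exact congrArg (fun x => x.2.1) hl
    · rintro ⟨r, l, hl⟩
      obtain rfl : r = Setoid.ker l.1 := Setoid.ext fun a b => (hl a b).symm
      exact ⟨l, rfl⟩
  have hlt : ∀ {B B' : FinGSet G} (f : B ⟶ X) (f' : B' ⟶ X),
      (∀ (Q : FinGSet G) (v : Q ⟶ X), Nat.card Q < Nat.card W →
        Nat.card {m : Lifts f v // Function.Injective m.1} =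
          Nat.card {m : Lifts f' v // Function.Injective m.1}) →
      ∀ r : Setoid W, r ≠ ⊥ → Nonempty {l : Lifts f w // ∀ a b, l.1 a = l.1 b ↔ r a b} →
        Nat.card {l : Lifts f w // ∀ a b, l.1 a = l.1 b ↔ r a b} =
          Nat.card {l : Lifts f' w // ∀ a b, l.1 a = l.1 b ↔ r a b} := by
    rintro B B' f f' H r hr ⟨⟨⟨l, hl⟩, hlr⟩⟩
    -- The quotient of `W` by `r` is realised as the image of one lift with kernel `r`. Lifts with
    -- this kernel then correspond to injective lifts of the smaller `G`-set `Q`, which are counted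
    -- by induction.
    let Q := sub B (fun b => ∃ a, l a = b) fun γ b ⟨a, ha⟩ => ⟨γ • a, by rw [hom_smul, ha]⟩
    let p : W ⟶ Q := mkHom (Y := Q) (fun a => ⟨l a, a, rfl⟩) fun γ a => Subtype.ext (hom_smul l γ a)
    have hp : Function.Surjective p := by
      rintro ⟨_, a, rfl⟩
      exact ⟨a, rfl⟩
    have hpr : ∀ a b, p a = p b ↔ r a b := fun a b => Subtype.ext_iff.trans (hlr a b)
    have hQ : Nat.card Q < Nat.card W := by
      refine lt_of_le_of_ne (Nat.card_le_card_of_surjective _ hp) fun he => hr ?_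
      have hi := (hp.bijective_of_nat_card_le he.ge).1
      refine Setoid.ext fun a b => (hpr a b).symm.trans hi.eq_iff
    have hw : p ≫ subIncl B _ _ ≫ f = w := hl
    rw [← card_injective_lifts f p hp _ hw hpr, ← card_injective_lifts f' p hp _ hw hpr, H _ _ hQ]
  have hne : ∀ r : Setoid W, r ≠ ⊥ →
      Nat.card {l : Lifts f w // ∀ a b, l.1 a = l.1 b ↔ r a b} =
        Nat.card {l : Lifts f' w // ∀ a b, l.1 a = l.1 b ↔ r a b} := by
    intro r hr
    -- A lift with kernel `r` on either side suffices to construct the quotient; without any, both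
    -- counts are zero.
    rcases isEmpty_or_nonempty {l : Lifts f w // ∀ a b, l.1 a = l.1 b ↔ r a b} with h1 | h1
    · rcases isEmpty_or_nonempty {l : Lifts f' w // ∀ a b, l.1 a = l.1 b ↔ r a b} with h2 | h2
      · rw [Nat.card_of_isEmpty, Nat.card_of_isEmpty]
      · exact (hlt f' f (fun Q v hQ => (ih _ hQ v rfl).symm) r hr h2).symm
    · exact hlt f f' (fun Q v hQ => ih _ hQ v rfl) r hr h1
  have hbot : ∀ {B : FinGSet G} (f : B ⟶ X),
      Nat.card {m : Lifts f w // Function.Injective m.1} =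
        Nat.card {l : Lifts f w // ∀ a b, l.1 a = l.1 b ↔ (⊥ : Setoid W) a b} := by
    intro B f
    refine Nat.card_congr (Equiv.subtypeEquivRight fun l => ?_)
    exact ⟨fun hl a b => hl.eq_iff, fun hl a b hab => (hl a b).mp hab⟩
  have hh := h W w
  classical
  rw [hs, hs, ← Finset.add_sum_erase _ _ (Finset.mem_univ (⊥ : Setoid W)),
    ← Finset.add_sum_erase _ (fun r : Setoid W =>
      Nat.card {l : Lifts f' w // ∀ a b, l.1 a = l.1 b ↔ r a b}) (Finset.mem_univ (⊥ : Setoid W)),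
    Finset.sum_congr rfl fun r hr => hne r (Finset.ne_of_mem_erase hr)] at hh
  rw [hbot, hbot]
  exact Nat.add_right_cancel hh

/-- Finite `G`-sets over `X` with the same numbers of lifts are isomorphic. -/
theorem exists_iso_of_card_lifts {B B' X : FinGSet G} (f : B ⟶ X) (f' : B' ⟶ X)
    (h : ∀ (W : FinGSet G) (w : W ⟶ X), Nat.card (Lifts f w) = Nat.card (Lifts f' w)) :
    ∃ e : B ≅ B', e.hom ≫ f' = f := by
  have key : ∀ {B B' : FinGSet G} (f : B ⟶ X) (f' : B' ⟶ X),
      (∀ (W : FinGSet G) (w : W ⟶ X), Nat.card (Lifts f w) = Nat.card (Lifts f' w)) →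
      ∃ m : B ⟶ B', m ≫ f' = f ∧ Function.Injective m := by
    intro B B' f f' h
    -- The test object is `B` itself: the identity is an injective lift along `f`, hence there is an
    -- injective lift along `f'`. By finiteness, injections in both directions are bijections.
    have h1 := card_injective_lifts_eq f f' h f
    have : Nonempty {m : Lifts f f // Function.Injective m.1} :=
      ⟨⟨⟨𝟙 B, Category.id_comp f⟩, fun _ _ hab => hab⟩⟩
    have h2 := Nat.card_pos (α := {m : Lifts f f // Function.Injective m.1})
    rw [h1] at h2
    obtain ⟨⟨⟨m, hm⟩, hi⟩⟩ := (Nat.card_pos_iff.mp h2).1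
    exact ⟨m, hm, hi⟩
  obtain ⟨m, hm, hi⟩ := key f f' h
  obtain ⟨m', -, hi'⟩ := key f' f fun W w => (h W w).symm
  exact ⟨isoOfBijective m (hi.bijective_of_nat_card_le (Nat.card_le_card_of_injective _ hi')), hm⟩

end FinGSet

/-! ### The Burnside Tambara functor -/

namespace TambaraFunctor

variable {G : Type u} [Group G]

/-- The Tambara functor given by subgroups closed under restrictions, transfers and norms. -/
noncomputable def ofClosedSemi (T : TambaraFunctor G) (p : ∀ {X : FinGSet G}, T.obj X → Prop)
    (hres : ∀ {X Y : FinGSet G} (f : X ⟶ Y) {a : T.obj Y}, p a → p (T.res f a))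
    (htr : ∀ {X Y : FinGSet G} (f : X ⟶ Y) {a : T.obj X}, p a → p (T.tr f a))
    (hnm : ∀ {X Y : FinGSet G} (f : X ⟶ Y) {a : T.obj X}, p a → p (T.nm f a))
    (hzero : ∀ X : FinGSet G, p (0 : T.obj X))
    (hsub : ∀ {X : FinGSet G} {a b : T.obj X}, p a → p b → p (a - b)) : SemiTambaraFunctor G where
  obj X := {a : T.obj X // p a}
  nonempty X := ⟨⟨0, hzero X⟩⟩
  res f a := ⟨T.res f a.1, hres f a.2⟩
  tr f a := ⟨T.tr f a.1, htr f a.2⟩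
  nm f a := ⟨T.nm f a.1, hnm f a.2⟩
  res_id X a := Subtype.ext (T.res_id X a.1)
  res_comp f g a := Subtype.ext (T.res_comp f g a.1)
  tr_id X a := Subtype.ext (T.tr_id X a.1)
  tr_comp f g a := Subtype.ext (T.tr_comp f g a.1)
  nm_id X a := Subtype.ext (T.nm_id X a.1)
  nm_comp f g a := Subtype.ext (T.nm_comp f g a.1)
  bijective_res := SemiMackeyFunctor.bijective_res_of_sum
    (obj := fun X => {a : T.obj X // p a}) (res := fun f a => ⟨T.res f a.1, hres f a.2⟩)
    (fun X a => Subtype.ext (T.res_id X a.1)) (fun f g a => Subtype.ext (T.res_comp f g a.1))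
    (fun X Y => by
      constructor
      · intro a b h
        exact Subtype.ext (SemiMackeyFunctor.sum_ext
          (congrArg Subtype.val (Prod.mk.inj h).1) (congrArg Subtype.val (Prod.mk.inj h).2))
      · rintro ⟨a, b⟩
        refine ⟨⟨T.pair a.1 b.1, ?_⟩, Prod.ext (Subtype.ext (SemiMackeyFunctor.res_inl_pair _ _))
          (Subtype.ext (SemiMackeyFunctor.res_inr_pair _ _))⟩
        -- A pair is the sum of the transfers of its entries, and closure under sums comes from
        -- closure under differences.
        have h1 := SemiMackeyFunctor.eq_add_tr_res (T.pair a.1 b.1)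
        rw [SemiMackeyFunctor.res_inl_pair, SemiMackeyFunctor.res_inr_pair] at h1
        have h2 : T.pair a.1 b.1 = T.tr (inl X Y) a.1 - (0 - T.tr (inr X Y) b.1) := by
          rw [zero_sub, sub_neg_eq_add]
          exact h1
        rw [h2]
        exact hsub (htr _ a.2) (hsub (hzero _) (htr _ b.2)))
  res_tr p q j i h a := Subtype.ext (T.res_tr p q j i h a.1)
  res_nm p q j i h a := Subtype.ext (T.res_nm p q j i h a.1)
  nm_tr i j f g h H a := Subtype.ext (T.nm_tr i j f g h H a.1)

section

variable (T : TambaraFunctor G) (p : ∀ {X : FinGSet G}, T.obj X → Prop)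
  (hres : ∀ {X Y : FinGSet G} (f : X ⟶ Y) {a : T.obj Y}, p a → p (T.res f a))
  (htr : ∀ {X Y : FinGSet G} (f : X ⟶ Y) {a : T.obj X}, p a → p (T.tr f a))
  (hnm : ∀ {X Y : FinGSet G} (f : X ⟶ Y) {a : T.obj X}, p a → p (T.nm f a))
  (hzero : ∀ X : FinGSet G, p (0 : T.obj X))
  (hsub : ∀ {X : FinGSet G} {a b : T.obj X}, p a → p b → p (a - b))

def ofClosedVal : SemiMackeyFunctor.Hom
    (T.ofClosedSemi p hres htr hnm hzero hsub).toSemiMackeyFunctor T.toSemiMackeyFunctor where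
  app _ a := a.1
  app_res _ _ := rfl
  app_tr _ _ := rfl

/-- The Tambara functor given by subgroups closed under restrictions, transfers and norms. -/
noncomputable def ofClosed : TambaraFunctor G where
  toSemiTambaraFunctor := T.ofClosedSemi p hres htr hnm hzero hsub
  exists_neg X a := by
    refine ⟨(⟨0 - a.1, hsub (hzero X) a.2⟩ : {a : T.obj X // p a}), Subtype.ext ?_⟩
    refine ((T.ofClosedVal p hres htr hnm hzero hsub).app_add _ _).trans (Eq.trans ?_
      ((T.ofClosedVal p hres htr hnm hzero hsub).app_zero X).symm)
    exact add_sub_cancel a.1 0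

end

/-- The unit of the ghost functor is the constant function `1`, and its transfer sums this constant
over the lifts. -/
theorem ghost_cls_val {B X W : FinGSet G} (f : B ⟶ X) (w : W ⟶ X) :
    (ghostFn ((ghost G).cls f)).val w = Nat.card (Lifts f w) := by
  have h : ghostFn ((ghost G).cls f) = (ghostFn ((semiGhost G).one B)).tr f := ghostFn_tr _ _
  rw [h, MulFn.tr_val, Finset.sum_congr rfl fun l _ => ghostFn_one l.1, Finset.sum_const,
    Finset.card_univ, Nat.card_eq_fintype_card, nsmul_eq_mul, mul_one]

theorem exists_iso_of_ghost_cls_eq {B C X : FinGSet G} {f : B ⟶ X} {g : C ⟶ X}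
    (h : (ghost G).cls f = (ghost G).cls g) : ∃ e : B ≅ C, e.hom ≫ g = f := by
  refine exists_iso_of_card_lifts f g fun W w => ?_
  have h1 := ghost_cls_val f w
  rw [h, ghost_cls_val] at h1
  exact_mod_cast h1.symm

/-- The Burnside Tambara functor, generated by the classes of the finite `G`-sets. -/
noncomputable def burnside (G : Type u) [Group G] : TambaraFunctor G :=
  (ghost G).ofClosed
    (fun {X} a => ∃ (B C : FinGSet G) (f : B ⟶ X) (g : C ⟶ X),
      a = (ghost G).cls f - (ghost G).cls g)
    (fun k a ⟨B, C, f, g, h⟩ => by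
      obtain ⟨B', C', f', g', h'⟩ := IsVirtual.res ⟨B, C, f, g, fun _ => rfl⟩ k
      exact ⟨B', C', f', g', by rw [h]; exact h' _⟩)
    (fun k a ⟨B, C, f, g, h⟩ => by
      obtain ⟨B', C', f', g', h'⟩ := IsVirtual.tr ⟨B, C, f, g, fun _ => rfl⟩ k
      exact ⟨B', C', f', g', by rw [h]; exact h' _⟩)
    (fun k a ⟨B, C, f, g, h⟩ => by
      obtain ⟨B', C', f', g', h'⟩ := IsVirtual.nm ⟨B, C, f, g, fun _ => rfl⟩ k
      exact ⟨B', C', f', g', by rw [h]; exact h' _⟩)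
    (fun X => ⟨X, X, 𝟙 X, 𝟙 X, (sub_self _).symm⟩)
    (fun {X a b} ⟨B, C, f, g, h⟩ ⟨B', C', f', g', h'⟩ => by
      obtain ⟨_, _, f'', g'', h''⟩ := IsVirtual.sub ⟨B, C, f, g, fun _ => rfl⟩
        ⟨B', C', f', g', fun _ => rfl⟩
      exact ⟨_, _, f'', g'', by rw [h, h']; exact h'' _⟩)

namespace burnside

noncomputable def incl : burnside G ⟶ ghost G where
  app _ a := a.1
  app_res _ _ := rfl
  app_tr _ _ := rfl
  app_nm _ _ := rfl

theorem app_sub_cls {T U : TambaraFunctor G} (φ : T ⟶ U) {B C X : FinGSet G} (f : B ⟶ X)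
    (g : C ⟶ X) : φ.app X (T.cls f - T.cls g) = U.cls f - U.cls g := by
  refine (MackeyFunctor.app_sub (M := T.toGreen.toMackeyFunctor) (N := U.toGreen.toMackeyFunctor)
    φ.toHom _ _).trans ?_
  exact congrArg₂ (fun a b => a - b) (CommGreenFunctor.app_cls (toGreenHom φ) f)
    (CommGreenFunctor.app_cls (toGreenHom φ) g)

theorem exists_eq {X : FinGSet G} (x : (burnside G).obj X) :
    ∃ (B C : FinGSet G) (f : B ⟶ X) (g : C ⟶ X), x = (burnside G).cls f - (burnside G).cls g := by
  obtain ⟨B, C, f, g, h⟩ := x.2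
  exact ⟨B, C, f, g, Subtype.ext (h.trans (app_sub_cls incl f g).symm)⟩

/-- Equalities between virtual classes in the Burnside functor hold universally. -/
theorem sub_cls_eq {B C B' C' X : FinGSet G} {f : B ⟶ X} {g : C ⟶ X} {f' : B' ⟶ X} {g' : C' ⟶ X}
    (h : (burnside G).cls f - (burnside G).cls g = (burnside G).cls f' - (burnside G).cls g')
    (R : CommGreenFunctor G) : R.cls f - R.cls g = R.cls f' - R.cls g' := by
  have h1 := congrArg (incl.app X) h
  rw [app_sub_cls, app_sub_cls, sub_eq_sub_iff_add_eq_add, ← cls_sumDesc, ← cls_sumDesc] at h1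
  -- With the subtractions moved across, the equality in the ghost functor yields an isomorphism
  -- over `X` between the disjoint unions of `B` with `C'` and of `B'` with `C`. Nothing specific to
  -- the ghost functor remains.
  obtain ⟨e, he⟩ := exists_iso_of_ghost_cls_eq h1
  rw [sub_eq_sub_iff_add_eq_add, ← R.cls_sumDesc, ← R.cls_sumDesc]
  exact R.cls_iso e he

section

variable (R : CommGreenFunctor G)

/-- The value is read off from a chosen representation as a difference of classes; `sub_cls_eq`
makes it independent of the choice. -/
noncomputable def app (X : FinGSet G) (x : (burnside G).obj X) : R.obj X :=
  R.cls (exists_eq x).choose_spec.choose_spec.choose -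
    R.cls (exists_eq x).choose_spec.choose_spec.choose_spec.choose

theorem app_eq {B C X : FinGSet G} (f : B ⟶ X) (g : C ⟶ X) {x : (burnside G).obj X}
    (hx : x = (burnside G).cls f - (burnside G).cls g) : app R X x = R.cls f - R.cls g :=
  sub_cls_eq ((exists_eq x).choose_spec.choose_spec.choose_spec.choose_spec.symm.trans hx) R

/-- The map from the Burnside functor to a commutative Green functor. -/
noncomputable def descGreen : (burnside G).toGreen ⟶ R where
  app := app R
  app_res {X Y} k x := by
    obtain ⟨B, C, f, g, h⟩ := exists_eq x
    rw [app_eq R f g h, R.res_sub, R.res_cls (isPullback_pb k f), R.res_cls (isPullback_pb k g)]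
    refine app_eq R _ _ ?_
    rw [h]
    refine ((burnside G).res_sub _ _ _).trans ?_
    rw [res_cls _ (isPullback_pb k f), res_cls _ (isPullback_pb k g)]
  app_tr {X Y} k x := by
    obtain ⟨B, C, f, g, h⟩ := exists_eq x
    rw [app_eq R f g h, R.tr_sub, R.tr_cls, R.tr_cls]
    refine app_eq R _ _ ?_
    rw [h]
    refine ((burnside G).tr_sub _ _ _).trans ?_
    rw [tr_cls, tr_cls]
  app_mul {X} x y := by
    obtain ⟨B, C, f, g, h⟩ := exists_eq x
    obtain ⟨B', C', f', g', h'⟩ := exists_eq y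
    have key : ∀ R : CommGreenFunctor G, (R.cls f - R.cls g) * (R.cls f' - R.cls g') =
        R.cls (sumDesc (pbFst f f' ≫ f) (pbFst g g' ≫ g)) -
          R.cls (sumDesc (pbFst f g' ≫ f) (pbFst g f' ≫ g)) := by
      intro R
      rw [R.cls_sumDesc, R.cls_sumDesc, ← R.cls_mul, ← R.cls_mul, ← R.cls_mul, ← R.cls_mul]
      ring
    refine Eq.trans ?_ ((key R).symm.trans
      (congrArg₂ R.mul (app_eq R f g h).symm (app_eq R f' g' h').symm))
    exact app_eq R _ _ ((congrArg₂ (burnside G).mul h h').trans (key (burnside G).toGreen))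
  app_one X := by
    have h : (burnside G).one X = (burnside G).cls (𝟙 X) - (burnside G).cls (fromEmpty X) := by
      have h1 : (burnside G).cls (fromEmpty X) = 0 := (burnside G).toGreen.cls_of_isEmpty _
      rw [h1, sub_zero]
      exact ((burnside G).tr_id _ _).symm
    refine (app_eq R _ _ h).trans ?_
    rw [R.cls_id, R.cls_of_isEmpty, sub_zero]
    rfl

theorem greenHom_ext (φ ψ : (burnside G).toGreen ⟶ R) : φ = ψ := by
  have h : ∀ φ : (burnside G).toGreen ⟶ R, φ = descGreen R := by
    intro φ
    refine CommGreenFunctor.hom_ext fun X x => ?_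
    obtain ⟨B, C, f, g, h⟩ := exists_eq x
    refine Eq.trans ?_ (app_eq R f g h).symm
    rw [← CommGreenFunctor.app_cls φ, ← CommGreenFunctor.app_cls φ, h]
    exact MackeyFunctor.app_sub (M := (burnside G).toGreen.toMackeyFunctor) φ.toHom _ _
  rw [h φ, h ψ]

end

/-- The map from the Burnside functor to a Tambara functor. -/
noncomputable def desc (T : TambaraFunctor G) : burnside G ⟶ T where
  app := app T.toGreen
  app_res := (descGreen T.toGreen).app_res
  app_tr := (descGreen T.toGreen).app_tr
  app_nm {X Y} k x := by
    obtain ⟨B, C, f, g, h⟩ := exists_eq x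
    -- The representation of the norm is uniform in the Tambara functor, so the same `f'` and `g'`
    -- serve in the Burnside functor and in `T`.
    obtain ⟨B', C', f', g', h'⟩ := IsVirtual.nm ⟨B, C, f, g, fun _ => rfl⟩ k
    refine (app_eq T.toGreen f' g' ((congrArg _ h).trans (h' _))).trans ((h' T).symm.trans ?_)
    exact congrArg (T.nm k) (app_eq T.toGreen f g h).symm

/-- The Burnside functor is an initial Tambara functor. -/
noncomputable def isInitial : IsInitial (burnside G) :=
  IsInitial.ofUniqueHom desc fun _ _ => toGreenHom_injective (greenHom_ext _ _ _)

/-- The Burnside functor is an initial commutative Green functor. -/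
noncomputable def isInitialGreen : IsInitial (burnside G).toGreen :=
  IsInitial.ofUniqueHom descGreen fun _ _ => greenHom_ext _ _ _

end burnside

end TambaraFunctor

/-! ### Colimits of Tambara functors -/

namespace TambaraFunctor

variable {G : Type u} [Group G]

/-- Every family has a coproduct which is also a coproduct of commutative Green functors. -/
theorem exists_isColimit_cofan {ι : Type u} (X : ι → TambaraFunctor G) :
    ∃ (T : TambaraFunctor G) (i : ∀ k, X k ⟶ T), Nonempty (IsColimit (Cofan.mk T i)) ∧
      Nonempty (IsColimit (Cofan.mk (f := fun k => (forgetToGreen G).obj (X k))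
        ((forgetToGreen G).obj T) fun k => (forgetToGreen G).map (i k))) := by
  rcases isEmpty_or_nonempty ι with h | h
  · refine ⟨burnside G, isEmptyElim, ⟨?_⟩, ⟨?_⟩⟩
    · exact Cofan.IsColimit.mk _ (fun s => burnside.desc _) (fun s k => isEmptyElim k)
        (fun s m _ => burnside.isInitial.hom_ext _ _)
    · exact Cofan.IsColimit.mk _ (fun s => burnside.descGreen _) (fun s k => isEmptyElim k)
        (fun s m _ => burnside.isInitialGreen.hom_ext _ _)
  · exact ⟨coprod X, coprod.incl, ⟨coprodIsColimit X⟩, ⟨coprodGreenIsColimit X⟩⟩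

instance : HasCoproducts.{u} (TambaraFunctor G) :=
  hasCoproducts_of_colimit_cofans
    (fun f => Cofan.mk _ (exists_isColimit_cofan f).choose_spec.choose)
    (fun f => (exists_isColimit_cofan f).choose_spec.choose_spec.1.some)

instance : HasCoequalizers (TambaraFunctor G) :=
  have : ∀ {X Y : TambaraFunctor G} {f g : X ⟶ Y}, HasColimit (parallelPair f g) :=
    fun {_ _ f g} => ⟨⟨⟨_, coeqIsColimit f g⟩⟩⟩
  hasCoequalizers_of_hasColimit_parallelPair _

instance (J : Type u) : PreservesColimitsOfShape (Discrete J) (forgetToGreen G) where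
  preservesColimit {K} := by
    have : PreservesColimit (Discrete.functor (K.obj ∘ Discrete.mk)) (forgetToGreen G) := by
      obtain ⟨T, i, ⟨h₁⟩, ⟨h₂⟩⟩ := exists_isColimit_cofan (K.obj ∘ Discrete.mk)
      exact preservesColimit_of_preserves_colimit_cocone h₁
        ((isColimitMapCoconeCofanMkEquiv _ _ _).symm h₂)
    exact preservesColimit_of_iso_diagram _ Discrete.natIsoFunctor.symm

instance : PreservesColimitsOfShape WalkingParallelPair (forgetToGreen G) where
  preservesColimit {K} := by
    have : PreservesColimit (parallelPair (K.map WalkingParallelPairHom.left)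
        (K.map WalkingParallelPairHom.right)) (forgetToGreen G) :=
      preservesColimit_of_preserves_colimit_cocone (coeqIsColimit _ _)
        ((isColimitMapCoconeCoforkEquiv _ _).symm (coeqGreenIsColimit _ _))
    exact preservesColimit_of_iso_diagram _ (diagramIsoParallelPair K).symm

instance : HasColimitsOfSize.{u, u} (TambaraFunctor G) :=
  has_colimits_of_hasCoequalizers_and_coproducts

instance : PreservesColimitsOfSize.{u, u} (forgetToGreen G) :=
  preservesColimits_of_preservesCoequalizers_and_coproducts _

end TambaraFunctor

/-! ### Tambara structures on colimits of commutative Green functors -/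

namespace TambaraStructure

variable {G : Type u} [Group G]

section

variable {R : CommGreenFunctor G} (S : TambaraStructure R)

theorem toTambara_mul {X : FinGSet G} (a b : R.obj X) : S.toTambara.mul a b = R.mul a b :=
  S.nm_fold X a b

theorem toTambara_one (X : FinGSet G) : S.toTambara.one X = R.one X := by
  refine (R.one_mul _).symm.trans ((S.toTambara_mul _ _).symm.trans ?_)
  exact (SemiTambaraFunctor.mul_comm _ _).trans
    (SemiTambaraFunctor.one_mul (T := S.toTambara.toSemiTambaraFunctor) (R.one X))

/-- The commutative Green functor underlying a Tambara structure. -/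
def counit : (TambaraFunctor.forgetToGreen G).obj S.toTambara ⟶ R where
  app _ a := a
  app_res _ _ := rfl
  app_tr _ _ := rfl
  app_mul := S.toTambara_mul
  app_one := S.toTambara_one

variable {S} {T : TambaraFunctor G} (e : (TambaraFunctor.forgetToGreen G).obj T ≅ R)

/-- This is how uniqueness of Tambara structures is proved: the universal property among Tambara
functors provides `d`, the one among Green functors identifies `d` with the isomorphism `e`, and so
`e` respects the norms of `S`. -/
theorem eq_ofIso_of_hom (d : T ⟶ S.toTambara)
    (h : (TambaraFunctor.forgetToGreen G).map d ≫ S.counit = e.hom) : S = ofIso e := by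
  refine eq_ofIso e S ?_
  rw [← h]
  exact fun f a => d.app_nm f a

theorem isTambaraMap_ofIso {U : TambaraFunctor G} {i : U ⟶ T}
    {j : (TambaraFunctor.forgetToGreen G).obj U ⟶ R}
    (h : (TambaraFunctor.forgetToGreen G).map i ≫ e.hom = j) : (ofIso e).IsTambaraMap j := by
  subst h
  intro X Y f a
  exact (congrArg (e.hom.app Y) (i.app_nm f a)).trans (ofIso_isTambaraMap e f (i.app X a))

theorem comp_isoOfIso {U : TambaraFunctor G} {i : U ⟶ T}
    {j : (TambaraFunctor.forgetToGreen G).obj U ⟶ R}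
    (h : (TambaraFunctor.forgetToGreen G).map i ≫ e.hom = j) :
    i ≫ (isoOfIso e).hom = (ofIso e).lift j (isTambaraMap_ofIso e h) :=
  TambaraFunctor.hom_ext fun _ a => CommGreenFunctor.congr_app h a

end

/-- The unique Tambara structure on a coproduct of commutative Green functors. -/
theorem exists_of_isColimit_cofan {ι : Type u} (X : ι → TambaraFunctor G)
    (c : Cofan (fun k => (TambaraFunctor.forgetToGreen G).obj (X k))) (hc : IsColimit c) :
    ∃ (S : TambaraStructure c.pt) (h : ∀ k, S.IsTambaraMap (c.inj k)),
      (∀ S' : TambaraStructure c.pt, (∀ k, S'.IsTambaraMap (c.inj k)) → S' = S) ∧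
      Nonempty (IsColimit (Cofan.mk S.toTambara fun k => S.lift (c.inj k) (h k))) := by
  obtain ⟨T, i, ⟨h₁⟩, ⟨h₂⟩⟩ := TambaraFunctor.exists_isColimit_cofan X
  let e : (TambaraFunctor.forgetToGreen G).obj T ≅ c.pt := h₂.coconePointUniqueUpToIso hc
  have he : ∀ k, (TambaraFunctor.forgetToGreen G).map (i k) ≫ e.hom = c.inj k := fun k =>
    h₂.comp_coconePointUniqueUpToIso_hom hc ⟨k⟩
  refine ⟨ofIso e, fun k => isTambaraMap_ofIso e (he k), fun S' hS' => ?_,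
    ⟨h₁.ofIsoColimit (Cofan.ext (isoOfIso e) fun k => comp_isoOfIso e (he k))⟩⟩
  -- Any competing structure receives a map from the coproduct of Tambara functors; on underlying
  -- Green functors it can only be `e`.
  let d : T ⟶ S'.toTambara := Cofan.IsColimit.desc h₁ fun k => S'.lift (c.inj k) (hS' k)
  have hd : ∀ k, i k ≫ d = S'.lift (c.inj k) (hS' k) := fun k =>
    Cofan.IsColimit.fac h₁ (fun k => S'.lift (c.inj k) (hS' k)) k
  refine eq_ofIso_of_hom e d (Cofan.IsColimit.hom_ext h₂ _ _ fun k => ?_)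
  refine CommGreenFunctor.hom_ext fun Y a => ?_
  exact (TambaraFunctor.congr_app (hd k) a).trans (CommGreenFunctor.congr_app (he k) a).symm

/-- The unique Tambara structure on a binary coproduct of commutative Green functors. -/
theorem exists_of_isColimit_binaryCofan {T R₁ R₂ : TambaraFunctor G} {i₁ : R₁ ⟶ T} {i₂ : R₂ ⟶ T}
    (h₁ : IsColimit (BinaryCofan.mk i₁ i₂))
    (h₂ : IsColimit (BinaryCofan.mk ((TambaraFunctor.forgetToGreen G).map i₁)
      ((TambaraFunctor.forgetToGreen G).map i₂)))
    {P : CommGreenFunctor G} {j₁ : (TambaraFunctor.forgetToGreen G).obj R₁ ⟶ P}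
    {j₂ : (TambaraFunctor.forgetToGreen G).obj R₂ ⟶ P}
    (hc : IsColimit (BinaryCofan.mk j₁ j₂)) :
    ∃ (S : TambaraStructure P) (h₁ : S.IsTambaraMap j₁) (h₂ : S.IsTambaraMap j₂),
      (∀ S' : TambaraStructure P, S'.IsTambaraMap j₁ → S'.IsTambaraMap j₂ → S' = S) ∧
      Nonempty (IsColimit (BinaryCofan.mk (S.lift j₁ h₁) (S.lift j₂ h₂))) := by
  let e : (TambaraFunctor.forgetToGreen G).obj T ≅ P := h₂.coconePointUniqueUpToIso hc
  have he₁ : (TambaraFunctor.forgetToGreen G).map i₁ ≫ e.hom = j₁ :=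
    h₂.comp_coconePointUniqueUpToIso_hom hc ⟨WalkingPair.left⟩
  have he₂ : (TambaraFunctor.forgetToGreen G).map i₂ ≫ e.hom = j₂ :=
    h₂.comp_coconePointUniqueUpToIso_hom hc ⟨WalkingPair.right⟩
  refine ⟨ofIso e, isTambaraMap_ofIso e he₁, isTambaraMap_ofIso e he₂, fun S' hS₁ hS₂ => ?_,
    ⟨h₁.ofIsoColimit (BinaryCofan.ext (isoOfIso e) (comp_isoOfIso e he₁) (comp_isoOfIso e he₂))⟩⟩
  obtain ⟨d, hd₁, hd₂⟩ := BinaryCofan.IsColimit.desc' h₁ (S'.lift j₁ hS₁) (S'.lift j₂ hS₂)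
  refine eq_ofIso_of_hom e d (BinaryCofan.IsColimit.hom_ext h₂ ?_ ?_)
  · exact CommGreenFunctor.hom_ext fun Y a =>
      (TambaraFunctor.congr_app hd₁ a).trans (CommGreenFunctor.congr_app he₁ a).symm
  · exact CommGreenFunctor.hom_ext fun Y a =>
      (TambaraFunctor.congr_app hd₂ a).trans (CommGreenFunctor.congr_app he₂ a).symm

/-- The unique Tambara structure on a pushout of commutative Green functors. -/
theorem exists_of_isPushout {T R₀ R₁ R₂ : TambaraFunctor G} {g₁ : R₀ ⟶ R₁} {g₂ : R₀ ⟶ R₂}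
    {i₁ : R₁ ⟶ T} {i₂ : R₂ ⟶ T} (h₁ : IsPushout g₁ g₂ i₁ i₂)
    (h₂ : IsPushout ((TambaraFunctor.forgetToGreen G).map g₁)
      ((TambaraFunctor.forgetToGreen G).map g₂) ((TambaraFunctor.forgetToGreen G).map i₁)
      ((TambaraFunctor.forgetToGreen G).map i₂))
    {P : CommGreenFunctor G} {j₁ : (TambaraFunctor.forgetToGreen G).obj R₁ ⟶ P}
    {j₂ : (TambaraFunctor.forgetToGreen G).obj R₂ ⟶ P}
    (hc : IsPushout ((TambaraFunctor.forgetToGreen G).map g₁)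
      ((TambaraFunctor.forgetToGreen G).map g₂) j₁ j₂) :
    ∃ (S : TambaraStructure P) (h₁ : S.IsTambaraMap j₁) (h₂ : S.IsTambaraMap j₂),
      (∀ S' : TambaraStructure P, S'.IsTambaraMap j₁ → S'.IsTambaraMap j₂ → S' = S) ∧
      IsPushout g₁ g₂ (S.lift j₁ h₁) (S.lift j₂ h₂) := by
  let e : (TambaraFunctor.forgetToGreen G).obj T ≅ P := h₂.isoIsPushout _ _ hc
  have he₁ : (TambaraFunctor.forgetToGreen G).map i₁ ≫ e.hom = j₁ := h₂.inl_isoIsPushout_hom _ _ hc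
  have he₂ : (TambaraFunctor.forgetToGreen G).map i₂ ≫ e.hom = j₂ := h₂.inr_isoIsPushout_hom _ _ hc
  refine ⟨ofIso e, isTambaraMap_ofIso e he₁, isTambaraMap_ofIso e he₂, fun S' hS₁ hS₂ => ?_, ?_⟩
  · have w : g₁ ≫ S'.lift j₁ hS₁ = g₂ ≫ S'.lift j₂ hS₂ :=
      TambaraFunctor.hom_ext fun Y a => CommGreenFunctor.congr_app hc.w a
    refine eq_ofIso_of_hom e (h₁.desc _ _ w) (h₂.hom_ext ?_ ?_)
    · exact CommGreenFunctor.hom_ext fun Y a =>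
        (TambaraFunctor.congr_app (h₁.inl_desc _ _ w) a).trans
          (CommGreenFunctor.congr_app he₁ a).symm
    · exact CommGreenFunctor.hom_ext fun Y a =>
        (TambaraFunctor.congr_app (h₁.inr_desc _ _ w) a).trans
          (CommGreenFunctor.congr_app he₂ a).symm
  · exact h₁.of_iso (Iso.refl _) (Iso.refl _) (Iso.refl _) (isoOfIso e) (by simp) (by simp)
      ((comp_isoOfIso e he₁).trans (Category.id_comp _).symm)
      ((comp_isoOfIso e he₂).trans (Category.id_comp _).symm)

end TambaraStructure

/-! ### Universal pairings -/

/-- The composition of maps of semi-Mackey functors. -/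
def SemiMackeyFunctor.Hom.comp {G : Type u} [Group G] {M N P : SemiMackeyFunctor G} (φ : Hom M N)
    (ψ : Hom N P) : Hom M P where
  app X a := ψ.app X (φ.app X a)
  app_res f a := by rw [φ.app_res, ψ.app_res]
  app_tr f a := by rw [φ.app_tr, ψ.app_tr]

namespace CommGreenFunctor

variable {G : Type u} [Group G] {R₀ R₁ R₂ P Q : CommGreenFunctor G}

/-- The pairing `(a, b) ↦ j₁(a) · j₂(b)` is universal among the pairings with the property `B`. -/
def IsUniversalPairing
    (B : ∀ N : MackeyFunctor G, DressPairing R₁.toMackeyFunctor R₂.toMackeyFunctor N → Prop)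
    (j₁ : R₁ ⟶ P) (j₂ : R₂ ⟶ P) : Prop :=
  B P.toMackeyFunctor (pairing j₁ j₂) ∧
  ∀ (N : MackeyFunctor G) (θ : DressPairing R₁.toMackeyFunctor R₂.toMackeyFunctor N), B N θ →
    ∃! φ : SemiMackeyFunctor.Hom P.toSemiMackeyFunctor N.toSemiMackeyFunctor,
      ∀ (X : FinGSet G) (a : R₁.obj X) (b : R₂.obj X),
        φ.app X ((pairing j₁ j₂).app a b) = θ.app a b

theorem isUniversalPairing_true_iff {j₁ : R₁ ⟶ P} {j₂ : R₂ ⟶ P} :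
    IsUniversalPairing (fun _ _ => True) j₁ j₂ ↔ IsBoxProduct j₁ j₂ :=
  ⟨fun h N θ => h.2 N θ trivial, fun h => ⟨trivial, fun N θ _ => h N θ⟩⟩

namespace IsUniversalPairing

variable {B : ∀ N : MackeyFunctor G, DressPairing R₁.toMackeyFunctor R₂.toMackeyFunctor N → Prop}
  {i₁ : R₁ ⟶ Q} {i₂ : R₂ ⟶ Q} {j₁ : R₁ ⟶ P} {j₂ : R₂ ⟶ P}

theorem of_iso (h : IsUniversalPairing B i₁ i₂) (e : Q ≅ P) (h₁ : i₁ ≫ e.hom = j₁)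
    (h₂ : i₂ ≫ e.hom = j₂) (hB : B P.toMackeyFunctor (pairing j₁ j₂)) :
    IsUniversalPairing B j₁ j₂ := by
  refine ⟨hB, fun N θ hθ => ?_⟩
  obtain ⟨φ, hφ, hu⟩ := h.2 N θ hθ
  have he : ∀ {X : FinGSet G} (a : R₁.obj X) (b : R₂.obj X),
      (pairing j₁ j₂).app a b = e.hom.app X ((pairing i₁ i₂).app a b) := by
    intro X a b
    subst h₁ h₂
    exact (e.hom.app_mul _ _).symm
  have hi : ∀ {X : FinGSet G} (x : Q.obj X), e.inv.app X (e.hom.app X x) = x :=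
    fun x => congr_app e.hom_inv_id x
  have hi' : ∀ {X : FinGSet G} (x : P.obj X), e.hom.app X (e.inv.app X x) = x :=
    fun x => congr_app e.inv_hom_id x
  refine ⟨e.inv.toHom.comp φ, fun X a b => ?_, fun ψ hψ => ?_⟩
  · refine (congrArg (fun x => φ.app X (e.inv.app X x)) (he a b)).trans ?_
    exact (congrArg (φ.app X) (hi _)).trans (hφ X a b)
  · have h1 : e.hom.toHom.comp ψ = φ := hu _ fun X a b =>
      (congrArg (ψ.app X) (he a b).symm).trans (hψ X a b)
    rw [← h1]
    refine SemiMackeyFunctor.Hom.ext (funext fun X => funext fun x => ?_)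
    exact (congrArg (ψ.app X) (hi' x)).symm

/-- Universal pairings are unique up to isomorphism of commutative Green functors. -/
theorem exists_iso (h : IsUniversalPairing B i₁ i₂) (h' : IsUniversalPairing B j₁ j₂)
    (hgen : ∀ (X : FinGSet G) (x : Q.obj X), ∃ (A : FinGSet G) (f : A ⟶ X) (a : R₁.obj A)
      (b : R₂.obj A), x = Q.tr f (Q.mul (i₁.app A a) (i₂.app A b))) :
    ∃ e : Q ≅ P, i₁ ≫ e.hom = j₁ ∧ i₂ ≫ e.hom = j₂ := by
  obtain ⟨φ, hφ, -⟩ := h.2 _ (pairing j₁ j₂) h'.1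
  obtain ⟨ψ, hψ, -⟩ := h'.2 _ (pairing i₁ i₂) h.1
  have hψφ : ∀ {X : FinGSet G} (x : Q.obj X), ψ.app X (φ.app X x) = x := by
    have := (h.2 _ (pairing i₁ i₂) h.1).unique (y₁ := φ.comp ψ)
      (y₂ := ⟨fun _ x => x, fun _ _ => rfl, fun _ _ => rfl⟩)
      (fun X a b => (congrArg (ψ.app X) (hφ X a b)).trans (hψ X a b)) (fun _ _ _ => rfl)
    exact fun {X} x => congrFun (congrFun (congrArg SemiMackeyFunctor.Hom.app this) X) x
  have hφψ : ∀ {X : FinGSet G} (x : P.obj X), φ.app X (ψ.app X x) = x := by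
    have := (h'.2 _ (pairing j₁ j₂) h'.1).unique (y₁ := ψ.comp φ)
      (y₂ := ⟨fun _ x => x, fun _ _ => rfl, fun _ _ => rfl⟩)
      (fun X a b => (congrArg (φ.app X) (hψ X a b)).trans (hφ X a b)) (fun _ _ _ => rfl)
    exact fun {X} x => congrFun (congrFun (congrArg SemiMackeyFunctor.Hom.app this) X) x
  -- Universality yields only maps of Mackey functors. Multiplicativity of `φ` is checked on the
  -- products of elements of `R₁` and `R₂`, whose transfers exhaust `Q` by `hgen`.
  have hmul : ∀ {X : FinGSet G} (x y : Q.obj X),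
      φ.app X (Q.mul x y) = P.mul (φ.app X x) (φ.app X y) := by
    refine map_mul_of_generators φ
      (fun X x => ∃ (a : R₁.obj X) (b : R₂.obj X), x = Q.mul (i₁.app X a) (i₂.app X b)) ?_ ?_ ?_
    · rintro X Y f _ ⟨a, b, rfl⟩
      exact ⟨R₁.res f a, R₂.res f b, by rw [Q.res_mul, i₁.app_res, i₂.app_res]⟩
    · intro X x
      obtain ⟨A, f, a, b, hx⟩ := hgen X x
      exact ⟨A, f, _, ⟨a, b, rfl⟩, hx⟩
    · rintro X _ _ ⟨a, b, rfl⟩ ⟨a', b', rfl⟩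
      have e1 : Q.mul (Q.mul (i₁.app X a) (i₂.app X b)) (Q.mul (i₁.app X a') (i₂.app X b')) =
          (pairing i₁ i₂).app (R₁.mul a a') (R₂.mul b b') := by
        refine Eq.trans ?_ (congrArg₂ Q.mul (i₁.app_mul a a') (i₂.app_mul b b')).symm
        exact mul_mul_mul_comm (i₁.app X a) (i₂.app X b) (i₁.app X a') (i₂.app X b')
      rw [e1, hφ]
      refine (congrArg₂ P.mul (j₁.app_mul a a') (j₂.app_mul b b')).trans ?_
      refine (mul_mul_mul_comm (j₁.app X a) (j₁.app X a') (j₂.app X b) (j₂.app X b')).trans ?_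
      exact congrArg₂ P.mul (hφ X a b).symm (hφ X a' b').symm
  -- The compatibility with pairings, taken with one entry equal to `1`, gives compatibility with
  -- the structure maps.
  have hone₁ : ∀ {X : FinGSet G} (a : R₁.obj X), φ.app X (i₁.app X a) = j₁.app X a := by
    intro X a
    have h1 := hφ X a (R₂.one X)
    change φ.app X (Q.mul (i₁.app X a) (i₂.app X (R₂.one X))) =
      P.mul (j₁.app X a) (j₂.app X (R₂.one X)) at h1
    rwa [i₂.app_one, j₂.app_one, Q.mul_comm, Q.one_mul, P.mul_comm, P.one_mul] at h1
  have hone₂ : ∀ {X : FinGSet G} (b : R₂.obj X), φ.app X (i₂.app X b) = j₂.app X b := by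
    intro X b
    have h1 := hφ X (R₁.one X) b
    change φ.app X (Q.mul (i₁.app X (R₁.one X)) (i₂.app X b)) =
      P.mul (j₁.app X (R₁.one X)) (j₂.app X b) at h1
    rwa [i₁.app_one, j₁.app_one, Q.one_mul, P.one_mul] at h1
  have hone : ∀ X, φ.app X (Q.one X) = P.one X := fun X => by
    rw [← i₁.app_one, hone₁, j₁.app_one]
  let f : Q ⟶ P := ({ toHom := φ, app_mul := hmul, app_one := hone } : Hom Q P)
  let g : P ⟶ Q := ({
    toHom := ψ
    app_mul := fun a b => by
      rw [← hψφ (Q.mul (ψ.app _ a) (ψ.app _ b)), hmul, hφψ, hφψ]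
    app_one := fun X => by rw [← hone, hψφ] } : Hom P Q)
  exact ⟨⟨f, g, hom_ext fun X a => hψφ a, hom_ext fun X a => hφψ a⟩, hom_ext fun X a => hone₁ a,
    hom_ext fun X a => hone₂ a⟩

end IsUniversalPairing

theorem isBalanced_pairing {g₁ : R₀ ⟶ R₁} {g₂ : R₀ ⟶ R₂} {j₁ : R₁ ⟶ P} {j₂ : R₂ ⟶ P}
    (w : g₁ ≫ j₁ = g₂ ≫ j₂) : IsBalanced g₁ g₂ (pairing j₁ j₂) := by
  intro X a c b
  change P.mul (j₁.app X (R₁.mul a (g₁.app X c))) (j₂.app X b) =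
    P.mul (j₁.app X a) (j₂.app X (R₂.mul (g₂.app X c) b))
  have h : j₁.app X (g₁.app X c) = j₂.app X (g₂.app X c) := congr_app w c
  rw [j₁.app_mul, j₂.app_mul, h, P.mul_assoc]

end CommGreenFunctor

/-! ### Box products of Tambara functors -/

namespace TambaraFunctor

open TambaraCoproduct

variable {G : Type u} [Group G]

section

variable (R₁ R₂ : TambaraFunctor G)

noncomputable def boxInl : R₁ ⟶ coprod (two R₁ R₂) := coprod.incl (R := two R₁ R₂) ⟨true⟩

noncomputable def boxInr : R₂ ⟶ coprod (two R₁ R₂) := coprod.incl (R := two R₁ R₂) ⟨false⟩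

variable {R₁ R₂}

/-- The two-element family with given members. -/
def famTwo {A : FinGSet G} (a : R₁.obj A) (b : R₂.obj A) : Fam (two R₁ R₂) A where
  val
    | ⟨true⟩ => a
    | ⟨false⟩ => b
  finite := Set.toFinite _

theorem ofFam_two {A : FinGSet G} (m : Fam (two R₁ R₂) A) : coprod.ofFam m =
    (coprod (two R₁ R₂)).mul ((boxInl R₁ R₂).app A (m.val ⟨true⟩))
      ((boxInr R₁ R₂).app A (m.val ⟨false⟩)) := by
  refine Eq.trans (congrArg coprod.ofFam ?_) (coprod.ofFam_mul (R := two R₁ R₂)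
    (Fam.single ⟨true⟩ (m.val ⟨true⟩)) (Fam.single ⟨false⟩ (m.val ⟨false⟩)))
  refine Fam.ext (funext ?_)
  rintro ⟨_ | _⟩
  · refine (SemiTambaraFunctor.one_mul _).symm.trans ?_
    exact congrArg₂ (two R₁ R₂ ⟨false⟩).mul (Fam.single_ne _ (by simp)).symm
      (Fam.single_self _ _).symm
  · refine (SemiTambaraFunctor.one_mul _).symm.trans ((SemiTambaraFunctor.mul_comm _ _).trans ?_)
    exact congrArg₂ (two R₁ R₂ ⟨true⟩).mul (Fam.single_self _ _).symm
      (Fam.single_ne _ (by simp)).symm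

theorem exists_eq_tr_mul {X : FinGSet G} (x : (coprod (two R₁ R₂)).obj X) :
    ∃ (A : FinGSet G) (f : A ⟶ X) (a : R₁.obj A) (b : R₂.obj A),
      x = (coprod (two R₁ R₂)).tr f ((coprod (two R₁ R₂)).mul ((boxInl R₁ R₂).app A a)
        ((boxInr R₁ R₂).app A b)) := by
  obtain ⟨A, f, m, rfl⟩ := coprod.eq_tr_ofFam x
  exact ⟨A, f, _, _, congrArg _ (ofFam_two m)⟩

variable (R₁ R₂)

/-- The coproduct of two Tambara functors. -/
noncomputable def isColimitBox : IsColimit (BinaryCofan.mk (boxInl R₁ R₂) (boxInr R₁ R₂)) :=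
  BinaryCofan.isColimitMk (fun s => coprod.desc (twoHom (F := fun T => T) s.inl s.inr))
    (fun s => incl_desc (twoHom (F := fun T => T) s.inl s.inr) ⟨true⟩)
    (fun s => incl_desc (twoHom (F := fun T => T) s.inl s.inr) ⟨false⟩)
    (fun s m h₁ h₂ => Cofan.IsColimit.hom_ext (coprodIsColimit (two R₁ R₂)) _ _ (by
      rintro ⟨_ | _⟩
      · exact h₂.trans (incl_desc (twoHom (F := fun T => T) s.inl s.inr) ⟨false⟩).symm
      · exact h₁.trans (incl_desc (twoHom (F := fun T => T) s.inl s.inr) ⟨true⟩).symm))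

/-- The coproduct of two Tambara functors is a coproduct of commutative Green functors. -/
noncomputable def isColimitBoxGreen : IsColimit (BinaryCofan.mk
    ((forgetToGreen G).map (boxInl R₁ R₂)) ((forgetToGreen G).map (boxInr R₁ R₂))) :=
  BinaryCofan.isColimitMk (fun s => coprod.descGreen (twoHom (F := toGreen) s.inl s.inr))
    (fun s => coprod.inclGreen_descGreen (twoHom (F := toGreen) s.inl s.inr) ⟨true⟩)
    (fun s => coprod.inclGreen_descGreen (twoHom (F := toGreen) s.inl s.inr) ⟨false⟩)
    (fun s m h₁ h₂ => coprod.greenHom_ext (by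
      rintro ⟨_ | _⟩
      · exact h₂.trans
          (coprod.inclGreen_descGreen (twoHom (F := toGreen) s.inl s.inr) ⟨false⟩).symm
      · exact h₁.trans
          (coprod.inclGreen_descGreen (twoHom (F := toGreen) s.inl s.inr) ⟨true⟩).symm))

/-- The coproduct of two Tambara functors is their box product. -/
theorem isBoxProduct_coprod : CommGreenFunctor.IsBoxProduct
    ((forgetToGreen G).map (boxInl R₁ R₂)) ((forgetToGreen G).map (boxInr R₁ R₂)) := by
  intro N θ
  have hres : ∀ {A B : FinGSet G} (f : A ⟶ B) (m : Fam (two R₁ R₂) B),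
      θ.app ((m.res f).val ⟨true⟩) ((m.res f).val ⟨false⟩) =
        N.res f (θ.app (m.val ⟨true⟩) (m.val ⟨false⟩)) := fun f m => (θ.res_app f _ _).symm
  -- For two factors the relation has two cases, according to the distinguished index, and these are
  -- the two Frobenius identities of a Dress pairing.
  have hlink : ∀ {A' A : FinGSet G} (v : A' ⟶ A) (m : Fam (two R₁ R₂) A') (n : Fam (two R₁ R₂) A),
      Link (two R₁ R₂) v m n → N.tr v (θ.app (m.val ⟨true⟩) (m.val ⟨false⟩)) =
        θ.app (n.val ⟨true⟩) (n.val ⟨false⟩) := by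
    rintro A' A v m n ⟨⟨_ | _⟩, h1, h2⟩
    · rw [h1, h2 ⟨true⟩ (by simp)]
      exact θ.tr_right v _ _
    · rw [h1, h2 ⟨false⟩ (by simp)]
      exact θ.tr_left v _ _
  refine ⟨coprod.descMackey (N := N.toSemiMackeyFunctor)
    (fun A m => θ.app (m.val ⟨true⟩) (m.val ⟨false⟩)) hres hlink, fun X a b => ?_, fun ψ hψ => ?_⟩
  · exact (congrArg _ (ofFam_two (famTwo a b)).symm).trans
      (coprod.descMackey_ofFam (N := N.toSemiMackeyFunctor) _ hres hlink (famTwo a b))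
  · exact coprod.mackeyHom_ext fun A m => (congrArg (ψ.app A) (ofFam_two m)).trans
      ((hψ A _ _).trans (coprod.descMackey_ofFam (N := N.toSemiMackeyFunctor) _ hres hlink m).symm)

end

end TambaraFunctor

/-! ### Relative box products of Tambara functors -/

/-- A pushout constructed from a coproduct and a coequalizer. -/
theorem isPushout_of_isColimit_cofork {C : Type*} [Category C] {A B₁ B₂ S Q : C} {g₁ : A ⟶ B₁}
    {g₂ : A ⟶ B₂} {i₁ : B₁ ⟶ S} {i₂ : B₂ ⟶ S} (h : IsColimit (BinaryCofan.mk i₁ i₂)) {π : S ⟶ Q}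
    (w : (g₁ ≫ i₁) ≫ π = (g₂ ≫ i₂) ≫ π) (h' : IsColimit (Cofork.ofπ π w)) :
    IsPushout g₁ g₂ (i₁ ≫ π) (i₂ ≫ π) := by
  have w' : g₁ ≫ i₁ ≫ π = g₂ ≫ i₂ ≫ π := by simpa using w
  refine ⟨⟨w'⟩, ⟨PushoutCocone.isColimitAux' _ fun s => ?_⟩⟩
  obtain ⟨k, hk₁, hk₂⟩ : {k : S ⟶ s.pt // i₁ ≫ k = s.inl ∧ i₂ ≫ k = s.inr} :=
    let k := BinaryCofan.IsColimit.desc' h s.inl s.inr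
    ⟨k.1, k.2⟩
  obtain ⟨l, hl⟩ : {l : Q ⟶ s.pt // π ≫ l = k} :=
    let l := Cofork.IsColimit.desc' h' k (by
      rw [Category.assoc, Category.assoc, hk₁, hk₂, s.condition])
    ⟨l.1, l.2⟩
  have hu : ∀ m : Q ⟶ s.pt, (i₁ ≫ π) ≫ m = s.inl → (i₂ ≫ π) ≫ m = s.inr → m = l := by
    intro m h₁ h₂
    refine Cofork.IsColimit.hom_ext h' (BinaryCofan.IsColimit.hom_ext h ?_ ?_)
    · change i₁ ≫ π ≫ m = i₁ ≫ π ≫ l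
      rw [← Category.assoc, h₁, hl, hk₁]
    · change i₂ ≫ π ≫ m = i₂ ≫ π ≫ l
      rw [← Category.assoc, h₂, hl, hk₂]
  refine ⟨l, ?_, ?_, fun {m} h₁ h₂ => hu m h₁ h₂⟩
  · change (i₁ ≫ π) ≫ l = s.inl
    rw [Category.assoc, hl, hk₁]
  · change (i₂ ≫ π) ≫ l = s.inr
    rw [Category.assoc, hl, hk₂]

namespace TambaraFunctor

variable {G : Type u} [Group G] {R₀ R₁ R₂ : TambaraFunctor G} (g₁ : R₀ ⟶ R₁) (g₂ : R₀ ⟶ R₂)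

/-- The pushout of two maps of Tambara functors. -/
noncomputable def relBox : TambaraFunctor G := coeq (g₁ ≫ boxInl R₁ R₂) (g₂ ≫ boxInr R₁ R₂)

noncomputable def relBoxProj : coprod (two R₁ R₂) ⟶ relBox g₁ g₂ := coeqProj _ _

noncomputable def relBoxInl : R₁ ⟶ relBox g₁ g₂ := boxInl R₁ R₂ ≫ relBoxProj g₁ g₂

noncomputable def relBoxInr : R₂ ⟶ relBox g₁ g₂ := boxInr R₁ R₂ ≫ relBoxProj g₁ g₂

theorem isPushout_relBox : IsPushout g₁ g₂ (relBoxInl g₁ g₂) (relBoxInr g₁ g₂) :=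
  isPushout_of_isColimit_cofork (isColimitBox R₁ R₂) (coeq_condition _ _) (coeqIsColimit _ _)

theorem isPushout_relBox_green : IsPushout ((forgetToGreen G).map g₁) ((forgetToGreen G).map g₂)
    ((forgetToGreen G).map (relBoxInl g₁ g₂)) ((forgetToGreen G).map (relBoxInr g₁ g₂)) :=
  isPushout_of_isColimit_cofork (g₁ := (forgetToGreen G).map g₁) (g₂ := (forgetToGreen G).map g₂)
    (π := (forgetToGreen G).map (relBoxProj g₁ g₂)) (isColimitBoxGreen R₁ R₂)
    (coeq_condition_green (g₁ ≫ boxInl R₁ R₂) (g₂ ≫ boxInr R₁ R₂))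
    (coeqGreenIsColimit (g₁ ≫ boxInl R₁ R₂) (g₂ ≫ boxInr R₁ R₂))

theorem exists_eq_tr_mul_relBox {X : FinGSet G} (x : (relBox g₁ g₂).obj X) :
    ∃ (A : FinGSet G) (f : A ⟶ X) (a : R₁.obj A) (b : R₂.obj A),
      x = (relBox g₁ g₂).tr f ((relBox g₁ g₂).mul ((relBoxInl g₁ g₂).app A a)
        ((relBoxInr g₁ g₂).app A b)) := by
  obtain ⟨y, rfl⟩ : ∃ y, x = (relBoxProj g₁ g₂).app X y := reflQuot.proj_surjective _ _ x
  obtain ⟨A, f, a, b, rfl⟩ := exists_eq_tr_mul y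
  refine ⟨A, f, a, b, ((relBoxProj g₁ g₂).app_tr _ _).trans (congrArg _ ?_)⟩
  exact ((forgetToGreen G).map (relBoxProj g₁ g₂)).app_mul _ _

/-- Maps out of the coproduct given by a balanced pairing identify the images of `R₀`. -/
theorem app_mul_eq_of_isBalanced {N : MackeyFunctor G}
    {θ : DressPairing R₁.toGreen.toMackeyFunctor R₂.toGreen.toMackeyFunctor N}
    (hθ : CommGreenFunctor.IsBalanced ((forgetToGreen G).map g₁) ((forgetToGreen G).map g₂) θ)
    {φ : SemiMackeyFunctor.Hom (coprod (two R₁ R₂)).toSemiMackeyFunctor N.toSemiMackeyFunctor}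
    (hφ : ∀ (X : FinGSet G) (a : R₁.obj X) (b : R₂.obj X),
      φ.app X ((coprod (two R₁ R₂)).mul ((boxInl R₁ R₂).app X a) ((boxInr R₁ R₂).app X b)) =
        θ.app a b) {X : FinGSet G} (c : R₀.obj X) (t : (coprod (two R₁ R₂)).obj X) :
    φ.app X ((coprod (two R₁ R₂)).mul ((boxInl R₁ R₂).app X (g₁.app X c)) t) =
      φ.app X ((coprod (two R₁ R₂)).mul ((boxInr R₁ R₂).app X (g₂.app X c)) t) := by
  obtain ⟨A, f, a, b, rfl⟩ := exists_eq_tr_mul t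
  -- Frobenius reciprocity moves the factor from `R₀` inside the transfer, so that `t` may be taken
  -- to be a product of an element of `R₁` and one of `R₂`.
  have hf : ∀ s y, (coprod (two R₁ R₂)).mul s ((coprod (two R₁ R₂)).tr f y) =
      (coprod (two R₁ R₂)).tr f ((coprod (two R₁ R₂)).mul ((coprod (two R₁ R₂)).res f s) y) :=
    fun s y => (CommGreenFunctor.frobenius_right (R := (coprod (two R₁ R₂)).toGreen) f s y).symm
  rw [hf, hf, φ.app_tr, φ.app_tr, ← (boxInl R₁ R₂).app_res, ← (boxInr R₁ R₂).app_res,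
    ← g₁.app_res, ← g₂.app_res]
  refine congrArg (N.tr f) ?_
  have hm₁ : ∀ a a' : R₁.obj A, (boxInl R₁ R₂).app A (R₁.mul a a') = (coprod (two R₁ R₂)).mul
      ((boxInl R₁ R₂).app A a) ((boxInl R₁ R₂).app A a') :=
    ((forgetToGreen G).map (boxInl R₁ R₂)).app_mul
  have hm₂ : ∀ b b' : R₂.obj A, (boxInr R₁ R₂).app A (R₂.mul b b') = (coprod (two R₁ R₂)).mul
      ((boxInr R₁ R₂).app A b) ((boxInr R₁ R₂).app A b') :=
    ((forgetToGreen G).map (boxInr R₁ R₂)).app_mul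
  -- The image of `c` is gathered with `a` on the left-hand side and with `b` on the right-hand
  -- side, which leaves the two sides of the balancing condition.
  rw [← SemiTambaraFunctor.mul_assoc, SemiTambaraFunctor.mul_comm _ ((boxInl R₁ R₂).app A a),
    ← hm₁, hφ, SemiTambaraFunctor.mul_comm ((boxInr R₁ R₂).app A (g₂.app A _)),
    SemiTambaraFunctor.mul_assoc, SemiTambaraFunctor.mul_comm ((boxInr R₁ R₂).app A b), ← hm₂, hφ]
  exact hθ A a _ b

/-- The pushout of Tambara functors is their relative box product. -/
theorem isRelativeBoxProduct_relBox : CommGreenFunctor.IsRelativeBoxProduct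
    ((forgetToGreen G).map g₁) ((forgetToGreen G).map g₂)
    ((forgetToGreen G).map (relBoxInl g₁ g₂)) ((forgetToGreen G).map (relBoxInr g₁ g₂)) := by
  refine ⟨CommGreenFunctor.isBalanced_pairing (isPushout_relBox_green g₁ g₂).w, fun N θ hθ => ?_⟩
  obtain ⟨φ, hφ, hu⟩ := isBoxProduct_coprod R₁ R₂ N θ
  let f := g₁ ≫ boxInl R₁ R₂
  let g := g₂ ≫ boxInr R₁ R₂
  have hm : ∀ {X : FinGSet G} (a : R₁.obj X) (b : R₂.obj X),
      (relBox g₁ g₂).mul ((relBoxInl g₁ g₂).app X a) ((relBoxInr g₁ g₂).app X b) =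
        (relBoxProj g₁ g₂).app X ((coprod (two R₁ R₂)).mul ((boxInl R₁ R₂).app X a)
          ((boxInr R₁ R₂).app X b)) := fun a b =>
    (((forgetToGreen G).map (relBoxProj g₁ g₂)).app_mul _ _).symm
  -- The reflexive pair starts from the coproduct of `R₀` with the absolute box product, whose
  -- product classes are of the form `c * t`. The extension of `k` sends such a class to `k c * t`,
  -- so balancedness is all that must be checked.
  have hext : ∀ (k : R₀ ⟶ coprod (two R₁ R₂)) {X : FinGSet G} (c : R₀.obj X)
      (t : (coprod (two R₁ R₂)).obj X), (extend k).app X ((coprod (two R₀ (coprod (two R₁ R₂)))).mul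
        ((boxInl R₀ (coprod (two R₁ R₂))).app X c) ((boxInr R₀ (coprod (two R₁ R₂))).app X t)) =
        (coprod (two R₁ R₂)).mul (k.app X c) t := fun k X c t =>
    (((forgetToGreen G).map (extend k)).app_mul _ _).trans
      (congrArg₂ (coprod (two R₁ R₂)).mul (extend_incl k c) (extend_section k X t))
  have h : (extend f).toHom.comp φ = (extend g).toHom.comp φ := by
    refine coprod.mackeyHom_ext fun A m => ?_
    rw [ofFam_two]
    refine (congrArg (φ.app A) (hext f _ _)).trans (Eq.trans ?_ (congrArg (φ.app A) (hext g _ _)).symm)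
    exact app_mul_eq_of_isBalanced g₁ g₂ hθ hφ _ _
  have h' : ∀ X w, φ.app X ((extend f).app X w) = φ.app X ((extend g).app X w) := fun X w =>
    congrFun (congrFun (congrArg SemiMackeyFunctor.Hom.app h) X) w
  refine ⟨reflQuot.descMackey (extend_section f) (extend_section g) φ h', fun X a b => ?_,
    fun ψ hψ => reflQuot.mackeyHom_ext _ _ fun X a => ?_⟩
  · exact (congrArg _ (hm a b)).trans (hφ X a b)
  · have h1 : (relBoxProj g₁ g₂).toHom.comp ψ = φ := hu _ fun X a b =>
      (congrArg (ψ.app X) (hm a b).symm).trans (hψ X a b)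
    exact congrFun (congrFun (congrArg SemiMackeyFunctor.Hom.app h1) X) a

end TambaraFunctor

/-! ### The main theorem -/

theorem corollary5p6 (G : Type u) [Group G] [Finite G] :
    -- the category of Tambara functors is cocomplete
    HasColimitsOfSize.{u, u} (TambaraFunctor G) ∧
    -- the forgetful functor to commutative Green functors preserves colimits
    PreservesColimitsOfSize.{u, u} (TambaraFunctor.forgetToGreen G) ∧
    -- coproducts
    (∀ (ι : Type u) (X : ι → TambaraFunctor G),
      HasCoproduct (fun k => (TambaraFunctor.forgetToGreen G).obj (X k)) ∧
      ∀ c : Cofan (fun k => (TambaraFunctor.forgetToGreen G).obj (X k)), Nonempty (IsColimit c) →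
        ∃ (S : TambaraStructure c.pt) (h : ∀ k, S.IsTambaraMap (c.inj k)),
          (∀ S' : TambaraStructure c.pt, (∀ k, S'.IsTambaraMap (c.inj k)) → S' = S) ∧
          Nonempty (IsColimit (Cofan.mk S.toTambara fun k => S.lift (c.inj k) (h k)))) ∧
    -- binary coproducts as box products
    (∀ R₁ R₂ : TambaraFunctor G,
      (∃ (P : CommGreenFunctor G) (j₁ : (TambaraFunctor.forgetToGreen G).obj R₁ ⟶ P)
        (j₂ : (TambaraFunctor.forgetToGreen G).obj R₂ ⟶ P), CommGreenFunctor.IsBoxProduct j₁ j₂) ∧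
      ∀ (P : CommGreenFunctor G) (j₁ : (TambaraFunctor.forgetToGreen G).obj R₁ ⟶ P)
        (j₂ : (TambaraFunctor.forgetToGreen G).obj R₂ ⟶ P),
        (Nonempty (IsColimit (BinaryCofan.mk j₁ j₂)) ↔ CommGreenFunctor.IsBoxProduct j₁ j₂) ∧
        (CommGreenFunctor.IsBoxProduct j₁ j₂ →
          ∃ (S : TambaraStructure P) (h₁ : S.IsTambaraMap j₁) (h₂ : S.IsTambaraMap j₂),
            (∀ S' : TambaraStructure P, S'.IsTambaraMap j₁ → S'.IsTambaraMap j₂ → S' = S) ∧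
            Nonempty (IsColimit (BinaryCofan.mk (S.lift j₁ h₁) (S.lift j₂ h₂))))) ∧
    -- pushouts as relative box products
    (∀ (R₀ R₁ R₂ : TambaraFunctor G) (g₁ : R₀ ⟶ R₁) (g₂ : R₀ ⟶ R₂),
      (∃ (P : CommGreenFunctor G) (j₁ : (TambaraFunctor.forgetToGreen G).obj R₁ ⟶ P)
        (j₂ : (TambaraFunctor.forgetToGreen G).obj R₂ ⟶ P),
        CommGreenFunctor.IsRelativeBoxProduct ((TambaraFunctor.forgetToGreen G).map g₁)
          ((TambaraFunctor.forgetToGreen G).map g₂) j₁ j₂) ∧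
      ∀ (P : CommGreenFunctor G) (j₁ : (TambaraFunctor.forgetToGreen G).obj R₁ ⟶ P)
        (j₂ : (TambaraFunctor.forgetToGreen G).obj R₂ ⟶ P),
        (IsPushout ((TambaraFunctor.forgetToGreen G).map g₁)
            ((TambaraFunctor.forgetToGreen G).map g₂) j₁ j₂ ↔
          CommGreenFunctor.IsRelativeBoxProduct ((TambaraFunctor.forgetToGreen G).map g₁)
            ((TambaraFunctor.forgetToGreen G).map g₂) j₁ j₂) ∧
        (CommGreenFunctor.IsRelativeBoxProduct ((TambaraFunctor.forgetToGreen G).map g₁)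
            ((TambaraFunctor.forgetToGreen G).map g₂) j₁ j₂ →
          ∃ (S : TambaraStructure P) (h₁ : S.IsTambaraMap j₁) (h₂ : S.IsTambaraMap j₂),
            (∀ S' : TambaraStructure P, S'.IsTambaraMap j₁ → S'.IsTambaraMap j₂ → S' = S) ∧
            IsPushout g₁ g₂ (S.lift j₁ h₁) (S.lift j₂ h₂))) := by
  refine ⟨inferInstance, inferInstance, fun ι X => ⟨?_, fun c ⟨hc⟩ =>
    TambaraStructure.exists_of_isColimit_cofan X c hc⟩, fun R₁ R₂ => ?_,
    fun R₀ R₁ R₂ g₁ g₂ => ?_⟩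
  · obtain ⟨T, i, -, ⟨h⟩⟩ := TambaraFunctor.exists_isColimit_cofan X
    exact ⟨⟨⟨_, h⟩⟩⟩
  · have hbox := TambaraFunctor.isBoxProduct_coprod R₁ R₂
    have hcolim := TambaraFunctor.isColimitBoxGreen R₁ R₂
    -- The constructed object is both a coproduct and a box product, and each property determines an
    -- object with its structure maps up to isomorphism of Green functors. The two properties are
    -- therefore equivalent.
    have key : ∀ (P : CommGreenFunctor G) (j₁ : (TambaraFunctor.forgetToGreen G).obj R₁ ⟶ P)
        (j₂ : (TambaraFunctor.forgetToGreen G).obj R₂ ⟶ P),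
        Nonempty (IsColimit (BinaryCofan.mk j₁ j₂)) ↔ CommGreenFunctor.IsBoxProduct j₁ j₂ := by
      intro P j₁ j₂
      constructor
      · rintro ⟨hc⟩
        exact CommGreenFunctor.isUniversalPairing_true_iff.mp
          ((CommGreenFunctor.isUniversalPairing_true_iff.mpr hbox).of_iso
            (hcolim.coconePointUniqueUpToIso hc)
            (hcolim.comp_coconePointUniqueUpToIso_hom hc ⟨WalkingPair.left⟩)
            (hcolim.comp_coconePointUniqueUpToIso_hom hc ⟨WalkingPair.right⟩) trivial)
      · intro h
        obtain ⟨e, he₁, he₂⟩ := (CommGreenFunctor.isUniversalPairing_true_iff.mpr hbox).exists_iso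
          (CommGreenFunctor.isUniversalPairing_true_iff.mpr h)
          fun X x => TambaraFunctor.exists_eq_tr_mul x
        exact ⟨hcolim.ofIsoColimit (BinaryCofan.ext e he₁ he₂)⟩
    exact ⟨⟨_, _, _, hbox⟩, fun P j₁ j₂ => ⟨key P j₁ j₂, fun h =>
      TambaraStructure.exists_of_isColimit_binaryCofan (TambaraFunctor.isColimitBox R₁ R₂) hcolim
        ((key P j₁ j₂).mpr h).some⟩⟩
  · have hbox := TambaraFunctor.isRelativeBoxProduct_relBox g₁ g₂
    have hpush := TambaraFunctor.isPushout_relBox_green g₁ g₂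
    -- As in the absolute case, by comparison with one object that has both properties.
    -- Commutativity of a pushout square is what makes its pairing balanced.
    have key : ∀ (P : CommGreenFunctor G) (j₁ : (TambaraFunctor.forgetToGreen G).obj R₁ ⟶ P)
        (j₂ : (TambaraFunctor.forgetToGreen G).obj R₂ ⟶ P),
        IsPushout ((TambaraFunctor.forgetToGreen G).map g₁)
          ((TambaraFunctor.forgetToGreen G).map g₂) j₁ j₂ ↔
        CommGreenFunctor.IsRelativeBoxProduct ((TambaraFunctor.forgetToGreen G).map g₁)
          ((TambaraFunctor.forgetToGreen G).map g₂) j₁ j₂ := by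
      intro P j₁ j₂
      constructor
      · intro hc
        exact CommGreenFunctor.IsUniversalPairing.of_iso hbox (hpush.isoIsPushout _ _ hc)
          (hpush.inl_isoIsPushout_hom _ _ hc) (hpush.inr_isoIsPushout_hom _ _ hc)
          (CommGreenFunctor.isBalanced_pairing hc.w)
      · intro h
        obtain ⟨e, he₁, he₂⟩ := CommGreenFunctor.IsUniversalPairing.exists_iso hbox h
          fun X x => TambaraFunctor.exists_eq_tr_mul_relBox g₁ g₂ x
        exact hpush.of_iso (Iso.refl _) (Iso.refl _) (Iso.refl _) e (by simp) (by simp)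
          (he₁.trans (Category.id_comp _).symm) (he₂.trans (Category.id_comp _).symm)
    exact ⟨⟨_, _, _, hbox⟩, fun P j₁ j₂ => ⟨key P j₁ j₂, fun h =>
      TambaraStructure.exists_of_isPushout (TambaraFunctor.isPushout_relBox g₁ g₂) hpush
        ((key P j₁ j₂).mpr h)⟩⟩
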